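/- **Setting.** Let $\mathcal X$ be a compact metric space, $K:\mathcal X\times\mathcal X\to\mathbb R$ a Mercer kernel (continuous, symmetric, positive semi-definite) with reproducing kernel Hilbert space $\mathcal H_K$, $K_x=K(x,\cdot)$, and let $\kappa\ge 1$ satisfy $\sup_x K(x,x)\le\kappa^2$. Let $\rho_{\mathcal X}^{tr},\rho_{\mathcal X}^{te}$ be Borel probability measures on $\mathcal X$ with $\rho_{\mathcal X}^{te}\ll\rho_{\mathcal X}^{tr}$ and density ratio $w=d\rho_{\mathcal X}^{te}/d\rho_{\mathcal X}^{tr}$. Let $\rho(\cdot|x)$ be the common conditional distribution of the real output, $\rho^{tr}=\rho(y|x)\rho^{tr}_{\mathcal X}$, and $f_\rho(x)=\int y\,d\rho(y|x)$; assume $|y|\le M$ almost surely under $\rho^{tr}$. Let $L_Kf=\int f(x)K_x\,d\rho_{\mathcal X}^{te}(x)$ on $L^2_{\rho_{\mathcal X}^{te}}$ and $\mathcal N(\lambda)=\mathrm{Tr}((\lambda I+L_K)^{-1}L_K)$. Let $U\ge\kappa^2$ and let $g_\lambda:[0,U]\to\mathbb R$, $0<\lambda\le U$, be a filter function with qualification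 $\nu_g\ge 1/2$: there are constants $b>0$ and $\gamma_\nu>0$ $(0<\nu\le\nu_g)$, independent of $\lambda$, with $$\sup_{0<u\le U}|g_\lambda(u)|\le \frac b\lambda,\quad \sup_{0<u\le U}|g_\lambda(u)u|\le b,\quad \sup_{0<u\le U}|1-g_\lambda(u)u|u^\nu\le\gamma_\nu\lambda^\nu\quad(0<\nu\le\nu_g).$$ Given an i.i.d. sample $\mathbf z=\{(x_i,y_i)\}_{i=1}^n$, $n\ge1$, from $\rho^{tr}$, put $S_Xf=(f(x_1),\dots,f(x_n))^\top$ for $f\in\mathcal H_K$, $S_X^\top v=\frac1n\sum_{i=1}^n v_iK_{x_i}$ for $v\in\mathbb R^n$, $\bar y=(y_1,\dots,y_n)^\top$, $\overline W=\mathrm{diag}(\bar w(x_1),\dots,\bar w(x_n))$ with the normalized weights $\bar w(x_i)=w(x_i)/\big(\frac1n\sum_{j=1}^n w(x_j)\big)$ (and $\overline W=0$ if all $w(x_j)$ vanish). The weighted spectral algorithm with normalized weights is $$f^{\overline{\mathbf w}}_{\mathbf z,\lambda}=g_\lambda\big(S_X^\top\overline WS_X\big)S_X^\top\overline W\bar y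 .$$ **Theorem.** Assume that * (weights) for some $0<\alpha\le1$, $C>0$, $\sigma>0$ and all integers $p\ge2$: $\Big(\int_{\mathcal X} w^{(p-1)/\alpha}\,d\rho_{\mathcal X}^{te}\Big)^{\alpha}\le\frac12\,p!\,C^{p-2}\sigma^2$; * (source condition) $f_\rho=L_K^ru_\rho$ in $L^2_{\rho_{\mathcal X}^{te}}$ for some $u_\rho\in L^2_{\rho_{\mathcal X}^{te}}$ and $1/2\le r\le\nu_g$; * (capacity) $\mathcal N(\lambda)\le C_0\lambda^{-\beta}$ for all $\lambda>0$, with $0<\beta\le1$ and $C_0>0$; * $\beta+\alpha(1-\beta)\ge1$. Choose $\lambda=n^{-\frac1{\min\{2r,3\}+\beta+\alpha(1-\beta)}}$. Then for every $0<\delta<1$, with probability at least $1-\delta$, $$\big\|f^{\overline{\mathbf w}}_{\mathbf z,\lambda}-f_\rho\big\|_{L^2_{\rho_{\mathcal X}^{te}}}\le C'\,n^{-\frac{\min\{r,3/2\}}{\min\{2r,3\}+\beta+\alpha(1-\beta)}}\Big(\log\frac{12}\delta\Big)^3,$$ where $C'$ is independent of $n$ and $\delta$ and depends only on $\alpha,\beta,r,\nu_g,b,(\gamma_\nu)_\nu,C,\sigma,C_0,M,\kappa$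 and an upper bound for $\|u_\rho\|_{L^2_{\rho_{\mathcal X}^{te}}}$. -/

import Mathlib

open MeasureTheory ProbabilityTheory

open scoped ENNReal

noncomputable section

/-- A Mercer kernel on `X`: a continuous, symmetric, positive semi-definite function on `X × X`. -/
structure MercerKernel (X : Type*) [TopologicalSpace X] where
  toFun : X → X → ℝ
  continuous_uncurry : Continuous (Function.uncurry toFun)
  symm : ∀ x y, toFun x y = toFun y x
  posSemidef : ∀ (l : ℕ) (s : Fin l → X), (Matrix.of fun i j => toFun (s i) (s j)).PosSemidef

namespace MercerKernel

/-- The continuous function `K_x = K(x, ·)`. -/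
def sec {X : Type*} [TopologicalSpace X] (K : MercerKernel X) (x : X) : C(X, ℝ) :=
  ⟨K.toFun x, K.continuous_uncurry.comp (Continuous.prodMk_right x)⟩

/-- `H` is the reproducing kernel Hilbert space of `K` (it is determined by `K` up to a unique
isometry that respects the evaluation of its elements at points of `X`). -/
def IsKernelOf {X : Type*} [TopologicalSpace X] (K : MercerKernel X) (H : Type*)
    [NormedAddCommGroup H] [InnerProductSpace ℝ H] [CompleteSpace H] [RKHS ℝ H X ℝ] : Prop :=
  ∀ x y, RKHS.kernel H x y 1 = K.toFun x y

section IntegralOperator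

variable {X : Type*} [MetricSpace X] [CompactSpace X] [MeasurableSpace X] [BorelSpace X]
  (K : MercerKernel X) (μ : Measure X) [IsProbabilityMeasure μ]

/-- The class of `K_x` in `L²(μ)`. -/
def secLp (x : X) : Lp ℝ 2 μ := ContinuousMap.toLp 2 μ ℝ (K.sec x)

theorem continuous_secLp : Continuous (K.secLp μ) := by
  have h : Continuous K.sec :=
    ContinuousMap.continuous_of_continuous_uncurry _ K.continuous_uncurry
  exact (ContinuousMap.toLp (E := ℝ) 2 μ ℝ).continuous.comp h

theorem exists_norm_secLp_le : ∃ c : ℝ, 0 ≤ c ∧ ∀ x, ‖K.secLp μ x‖ ≤ c := by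
  obtain ⟨c, hc⟩ := isCompact_univ.exists_bound_of_continuousOn
    (K.continuous_secLp μ).continuousOn
  exact ⟨max c 0, le_max_right _ _, fun x => (hc x (Set.mem_univ x)).trans (le_max_left _ _)⟩

theorem integrable_smul_secLp (f : Lp ℝ 2 μ) :
    Integrable (fun x => f x • K.secLp μ x) μ := by
  obtain ⟨c, -, hc⟩ := K.exists_norm_secLp_le μ
  exact (((Lp.memLp f).integrable (by norm_num))).smul_bdd c
    ((K.continuous_secLp μ).stronglyMeasurable_of_hasCompactSupport
      (HasCompactSupport.of_compactSpace _)).aestronglyMeasurable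
    (Filter.Eventually.of_forall hc)

/-- The integral operator `L_K f = ∫ f(x) K_x dμ(x)` on `L²(μ)`. -/
def integralOp : Lp ℝ 2 μ →L[ℝ] Lp ℝ 2 μ :=
  LinearMap.mkContinuousOfExistsBound
    { toFun := fun f => ∫ x, f x • K.secLp μ x ∂μ
      map_add' := by
        intro f g
        rw [← integral_add (K.integrable_smul_secLp μ f) (K.integrable_smul_secLp μ g)]
        refine integral_congr_ae ?_
        filter_upwards [Lp.coeFn_add f g] with x hx
        rw [hx, Pi.add_apply, add_smul]
      map_smul' := by
        intro a f
        rw [RingHom.id_apply, ← integral_smul]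
        refine integral_congr_ae ?_
        filter_upwards [Lp.coeFn_smul a f] with x hx
        rw [hx, Pi.smul_apply, smul_assoc] }
    (by
      obtain ⟨c, hc0, hc⟩ := K.exists_norm_secLp_le μ
      refine ⟨c, fun f => ?_⟩
      have hf : Integrable f μ := (Lp.memLp f).integrable (by norm_num)
      have h1 : ‖∫ x, f x • K.secLp μ x ∂μ‖ ≤ ∫ x, c * ‖f x‖ ∂μ := by
        refine norm_integral_le_of_norm_le (hf.norm.const_mul c) ?_
        refine Filter.Eventually.of_forall fun x => ?_
        rw [norm_smul, mul_comm]
        exact mul_le_mul_of_nonneg_right (hc x) (norm_nonneg _)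
      have h2 : ∫ x, ‖f x‖ ∂μ ≤ ‖f‖ := by
        rw [integral_norm_eq_lintegral_enorm hf.1, ← eLpNorm_one_eq_lintegral_enorm, Lp.norm_def]
        refine ENNReal.toReal_mono (Lp.eLpNorm_ne_top f) ?_
        exact eLpNorm_le_eLpNorm_of_exponent_le (by norm_num) hf.1
      rw [integral_const_mul] at h1
      exact h1.trans (mul_le_mul_of_nonneg_left h2 hc0))

end IntegralOperator

end MercerKernel

section HilbertSpace

variable {E : Type*} [NormedAddCommGroup E] [InnerProductSpace ℝ E] [CompleteSpace E]

/-- Functional calculus of a compact (in particular: of a finite rank) self-adjoint operator `T`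
through its spectral decomposition: `φ(T) v = ∑_μ φ(μ) P_μ v`, where `P_μ` is the orthogonal
projection onto `ker (T - μ)`; only the eigenvalues `μ` of `T` contribute to the sum. -/
def spectralFun (T : E →L[ℝ] E) (φ : ℝ → ℝ) (v : E) : E :=
  ∑' μ : ℝ, φ μ • (Module.End.eigenspace (T : E →ₗ[ℝ] E) μ).starProjection v

/-- The trace `∑ᵢ ⟪eᵢ, T eᵢ⟫ ∈ [0, ∞]` of a positive operator, for a Hilbert basis `(eᵢ)` of `E`
(it does not depend on the Hilbert basis). -/
def positiveTrace (T : E →L[ℝ] E) : ℝ≥0∞ :=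
  ∑' e : (exists_hilbertBasis ℝ E).choose, ENNReal.ofReal (inner ℝ (e : E) (T e))

end HilbertSpace

/-- The effective dimension `N(t) = Tr ((t I + L_K)⁻¹ L_K)`. -/
def effectiveDimension {X : Type*} [MetricSpace X] [CompactSpace X] [MeasurableSpace X]
    [BorelSpace X] (K : MercerKernel X) (μ : Measure X) [IsProbabilityMeasure μ] (t : ℝ) : ℝ≥0∞ :=
  positiveTrace (Ring.inverse (t • (1 : Lp ℝ 2 μ →L[ℝ] Lp ℝ 2 μ) + K.integralOp μ)
    * K.integralOp μ)

/-- `(g_t)` with `0 < t ≤ U` is a family of filter functions on `[0, U]` with qualification `ν`,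
with the constants `b` and `γ_s`, `0 < s ≤ ν`. -/
structure IsFilterFunction (g : ℝ → ℝ → ℝ) (U ν b : ℝ) (γ : ℝ → ℝ) : Prop where
  U_pos : 0 < U
  half_le : 1 / 2 ≤ ν
  b_pos : 0 < b
  γ_pos : ∀ s, 0 < s → s ≤ ν → 0 < γ s
  abs_le : ∀ t u, 0 < t → t ≤ U → 0 < u → u ≤ U → |g t u| ≤ b / t
  abs_mul_le : ∀ t u, 0 < t → t ≤ U → 0 < u → u ≤ U → |g t u * u| ≤ b
  residual_le : ∀ s, 0 < s → s ≤ ν → ∀ t u, 0 < t → t ≤ U → 0 < u → u ≤ U →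
    |1 - g t u * u| * u ^ s ≤ γ s * t ^ s

section Algorithm

variable {X : Type*} (H : Type*) [NormedAddCommGroup H] [InnerProductSpace ℝ H]
  [CompleteSpace H] [RKHS ℝ H X ℝ] {n : ℕ}

/-- The sampling operator `S_X f = (f(x₁), …, f(xₙ))`. -/
def samplingOp (x : Fin n → X) : H →L[ℝ] (Fin n → ℝ) :=
  ContinuousLinearMap.pi fun i => (ContinuousLinearMap.proj (x i)).comp (RKHS.coeCLM ℝ)

/-- The operator `S_Xᵀ u = (1/n) ∑ᵢ uᵢ K(·, xᵢ)`. -/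
def samplingOpT (x : Fin n → X) : (Fin n → ℝ) →L[ℝ] H :=
  (1 / (n : ℝ)) • ∑ i, (ContinuousLinearMap.proj (R := ℝ) (φ := fun _ : Fin n => ℝ) i).smulRight
    (RKHS.kerFun H (x i) (1 : ℝ))

/-- The diagonal operator `diag(v₁, …, vₙ)`. -/
def diagOp (v : Fin n → ℝ) : (Fin n → ℝ) →L[ℝ] (Fin n → ℝ) :=
  (Matrix.toLin' (Matrix.diagonal v)).toContinuousLinearMap

/-- The normalized weights `w̄(xᵢ) = w(xᵢ) / ((1/n) ∑ⱼ w(xⱼ))`. -/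
def normalizedWeight (w : X → ℝ) (x : Fin n → X) (i : Fin n) : ℝ :=
  w (x i) / ((1 / (n : ℝ)) * ∑ j, w (x j))

/-- The weighted spectral algorithm with normalized weights and filter function `φ = g_t`:
`φ(S_Xᵀ W̄ S_X) S_Xᵀ W̄ y`, for the sample `z = ((x₁, y₁), …, (xₙ, yₙ))`. -/
def normalizedSpectralEstimator (w : X → ℝ) (φ : ℝ → ℝ) (z : Fin n → X × ℝ) : H :=
  let x : Fin n → X := fun i => (z i).1
  let W : (Fin n → ℝ) →L[ℝ] (Fin n → ℝ) := diagOp (normalizedWeight w x)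
  spectralFun (samplingOpT H x ∘L W ∘L samplingOp H x) φ (samplingOpT H x (W fun i => (z i).2))

end Algorithm

/-- The density ratio `w = dμte / dμtr`. -/
def densityRatio {X : Type*} [MeasurableSpace X] (μte μtr : Measure X) (x : X) : ℝ :=
  (μte.rnDeriv μtr x).toReal

/-- The moment condition on the density ratio `w = dμte / dμtr`, with `0 < α`:
`(∫ w^((p-1)/α) dμte)^α ≤ p! C^(p-2) σ² / 2` for all integers `p ≥ 2`. -/
def WeightMomentCondition {X : Type*} [MeasurableSpace X] (μte μtr : Measure X)
    (α C σ : ℝ) : Prop :=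
  ∀ p : ℕ, 2 ≤ p →
    (∫⁻ x, ENNReal.ofReal (densityRatio μte μtr x) ^ (((p : ℝ) - 1) / α) ∂μte) ^ α
      ≤ ENNReal.ofReal (1 / 2 * (p.factorial : ℝ) * C ^ (p - 2) * σ ^ 2)

/-- The regression function `f_ρ(x) = ∫ y dρ(y|x)`. -/
def regressionFun {X : Type*} [MeasurableSpace X] (ρ : Kernel X ℝ) (x : X) : ℝ :=
  ∫ y, y ∂(ρ x)

end

/-!
The error is measured in the reproducing kernel Hilbert space `H` of `K`. Let `J : H → L²(μte)` be
the inclusion and `T = J* J` the covariance operator (`covOp`), so that `L_K = J J*`. With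
`p = min r (3 / 2)`, the source condition gives `f_ρ = J f_H`, where `f_H = T ^ (p - 1/2) v`
(`exists_source`, through the polar decomposition of `J`), and `‖J h‖ ≤ ‖(T + a) ^ (1/2) h‖` for the
regularization parameter `a`. All functions of `T`, and of the empirical operator `B`, are taken in
Hilbert bases of eigenvectors (`EigenSystem`).

**Deterministic part.** Write `ĝ` for the vector `S_Xᵀ W̄ y`. The estimator `φ(B) ĝ` with the filter
function `φ` satisfies `φ(B) ĝ - f_H = φ(B) (ĝ - B f_H) - (1 - φ(B) B) f_H`. If
`‖(T + a) ^ (-1/2) (T - B)‖ ≤ Ψ`, then, with `k = 1 + Ψ / √a`, one can replace `(T + a) ^ (1/2)` by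
`(B + a) ^ (1/2)` at the cost of a factor `k`, and `T + a` by `B + a` at the cost of `k ^ 2`. The
Heinz inequality interpolates the latter to `(T + a) ^ s` for `0 ≤ s ≤ 1`, which is why smoothness
beyond `r = 3 / 2` does not help, and this moves the factor `T ^ (p - 1/2)` of `f_H` next to the
residual `1 - φ(B) B`. The result is `EigenSystem.norm_regPow_half_sub_le`.

**Probabilistic part.** Three averages have to be close to their means: the rank one operators
`w(x) K_x ⊗ (T + a) ^ (-1/2) K_x`, the noise vectors `w(x) (y - f_H(x)) (T + a) ^ (-1/2) K_x` (of
mean zero because `f_H` is the regression function almost everywhere for `μte`), and the weights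
`w(x)`. Bernstein's inequality for Hilbert space valued variables (`IsBernstein.measure_le`) is
proved by estimating the expectation of `cosh ‖∑ ξ_i‖` one summand at a time. Its moment hypothesis follows
from the condition on the weights by Hölder's inequality, since `‖(T + a) ^ (-1/2) K_x‖ ≤ κ / √a`
and the mean of `‖(T + a) ^ (-1/2) K_x‖ ^ 2` under `μte` is the effective dimension
(`effectiveDimension_eq`).

**Normalization.** Dividing by the empirical mean `d` of the weights is harmless when `d ≥ 1 / 2`,
as `T - B = d⁻¹ (T - B_w) + (1 - d⁻¹) T` for the empirical operator `B_w` with unnormalized weights.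
When the bound for `|d - 1|` exceeds `1 / 2`, the sample size `n` is so small compared with
`log (12 / δ)` that the a priori bound of the error suffices (`small_sample_rate_le`).
-/

noncomputable section

universe u

/-! ### Hilbert bases, diagonal operators and functional calculus -/

section Diagonal

variable {E : Type*} [NormedAddCommGroup E] [InnerProductSpace ℝ E] {ι : Type*}

theorem HilbertBasis.ext_inner (t : HilbertBasis ι ℝ E) {x y : E}
    (h : ∀ i, inner ℝ (t i) x = inner ℝ (t i) y) : x = y := by
  apply t.repr.injective
  ext i
  simpa [t.repr_apply_apply] using h i

theorem HilbertBasis.hasSum_sq_inner (t : HilbertBasis ι ℝ E) (x : E) :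
    HasSum (fun i => inner ℝ (t i) x ^ 2) (‖x‖ ^ 2) := by
  have h := t.hasSum_inner_mul_inner x x
  rw [real_inner_self_eq_norm_sq] at h
  have h' : (fun i => inner ℝ (t i) x ^ 2) = fun i => inner ℝ x (t i) * inner ℝ (t i) x :=
    funext fun i => by rw [sq, real_inner_comm]
  rwa [h']

theorem HilbertBasis.norm_le_of_abs_inner_le (t : HilbertBasis ι ℝ E) {x y : E} {c : ℝ}
    (hc : 0 ≤ c) (h : ∀ i, |inner ℝ (t i) x| ≤ c * |inner ℝ (t i) y|) : ‖x‖ ≤ c * ‖y‖ := by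
  refine le_of_sq_le_sq ?_ (by positivity)
  rw [mul_pow]
  refine hasSum_le (fun i => ?_) (t.hasSum_sq_inner x) ((t.hasSum_sq_inner y).mul_left (c ^ 2))
  rw [← mul_pow, ← sq_abs, ← sq_abs (c * _), abs_mul, abs_of_nonneg hc]
  exact pow_le_pow_left₀ (abs_nonneg _) (h i) 2

/-- The operator that is diagonal in the Hilbert basis `t`, with diagonal entries `φ i`; it is
set to `0` if `φ` is unbounded. -/
def HilbertBasis.diag (t : HilbertBasis ι ℝ E) (φ : ι → ℝ) : E →L[ℝ] E :=
  open scoped Classical in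
  if h : ∃ c, ∀ i, |φ i| ≤ c then
    have hmem (v : E) : Memℓp (fun i => φ i * t.repr v i) 2 := by
      obtain ⟨c, hc⟩ := h
      have h2 := ((memℓp_gen_iff (p := 2) (by norm_num)).1 (lp.memℓp (t.repr v))).mul_left (c ^ 2)
      refine memℓp_gen (h2.of_nonneg_of_le (fun i => by positivity) fun i => ?_)
      simp only [ENNReal.toReal_ofNat, Real.rpow_ofNat, norm_mul, mul_pow]
      gcongr
      exact hc i
    LinearMap.mkContinuous
      { toFun := fun v => t.repr.symm ⟨fun i => φ i * t.repr v i, hmem v⟩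
        map_add' := fun v w => t.ext_inner fun i => by
          simp only [← t.repr_apply_apply]
          simp only [LinearIsometryEquiv.apply_symm_apply, map_add, lp.coeFn_add, Pi.add_apply]
          exact mul_add _ _ _
        map_smul' := fun a v => t.ext_inner fun i => by
          simp only [← t.repr_apply_apply, RingHom.id_apply]
          simp [mul_left_comm] }
      (max h.choose 0) fun v => t.norm_le_of_abs_inner_le (le_max_right _ _) fun i => by
        rw [← t.repr_apply_apply, ← t.repr_apply_apply]
        simp only [LinearMap.coe_mk, AddHom.coe_mk, LinearIsometryEquiv.apply_symm_apply, abs_mul]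
        gcongr
        exact (h.choose_spec i).trans (le_max_left _ _)
  else 0

theorem HilbertBasis.inner_diag (t : HilbertBasis ι ℝ E) {φ : ι → ℝ} {c : ℝ}
    (h : ∀ i, |φ i| ≤ c) (i : ι) (v : E) :
    inner ℝ (t i) (t.diag φ v) = φ i * inner ℝ (t i) v := by
  have h' : ∃ c, ∀ i, |φ i| ≤ c := ⟨c, h⟩
  rw [HilbertBasis.diag, dif_pos h', ← t.repr_apply_apply, ← t.repr_apply_apply]
  simp

end Diagonal

section EigenSystem

variable {E : Type*} [NormedAddCommGroup E] [InnerProductSpace ℝ E]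

/-- A Hilbert basis of eigenvectors of `T`, with nonnegative eigenvalues bounded by `c`. -/
structure EigenSystem (T : E →L[ℝ] E) (c : ℝ) (ι : Type*) where
  basis : HilbertBasis ι ℝ E
  val : ι → ℝ
  apply_basis : ∀ i, T (basis i) = val i • basis i
  val_nonneg : ∀ i, 0 ≤ val i
  val_le : ∀ i, val i ≤ c

variable {T : E →L[ℝ] E} {c : ℝ} {ι : Type*}

namespace EigenSystem

theorem inner_apply (S : EigenSystem T c ι) (i : ι) (v : E) :
    inner ℝ (S.basis i) (T v) = S.val i * inner ℝ (S.basis i) v := by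
  have h := (S.basis.hasSum_repr v).mapL ((innerSL ℝ (S.basis i)).comp T)
  have h2 : HasSum (fun j => (innerSL ℝ (S.basis i)).comp T (S.basis.repr v j • S.basis j))
      (S.val i * S.basis.repr v i) := by
    convert hasSum_single i ?_ using 1
    · simp [S.apply_basis, S.basis.orthonormal.1 i, mul_comm]
    · intro j hj
      simp [S.apply_basis, S.basis.orthonormal.2 hj.symm]
  rw [← S.basis.repr_apply_apply v]
  exact h.unique h2

/-- The operator `φ(T)`, diagonal in the basis of eigenvectors; it is meaningful for functions `φ`
that are bounded on the eigenvalues (see `HilbertBasis.diag`). -/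
def fn (S : EigenSystem T c ι) (φ : ℝ → ℝ) : E →L[ℝ] E := S.basis.diag fun i => φ (S.val i)

/-- `φ` is bounded on `[0, c]`, which contains the eigenvalues. -/
def _root_.BddOnIcc (c : ℝ) (φ : ℝ → ℝ) : Prop := ∃ C, ∀ u, 0 ≤ u → u ≤ c → |φ u| ≤ C

theorem _root_.BddOnIcc.mul {φ ψ : ℝ → ℝ} (hφ : BddOnIcc c φ) (hψ : BddOnIcc c ψ) :
    BddOnIcc c (fun u => φ u * ψ u) := by
  obtain ⟨a, ha⟩ := hφ
  obtain ⟨b, hb⟩ := hψ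
  refine ⟨a * b, fun u h0 h1 => ?_⟩
  rw [abs_mul]
  exact mul_le_mul (ha u h0 h1) (hb u h0 h1) (abs_nonneg _) ((abs_nonneg _).trans (ha u h0 h1))

theorem _root_.BddOnIcc.const (a : ℝ) : BddOnIcc c (fun _ => a) := ⟨|a|, fun _ _ _ => le_rfl⟩

theorem _root_.BddOnIcc.id : BddOnIcc c (fun u => u) := ⟨c, fun u h0 h1 => by
  rwa [abs_of_nonneg h0]⟩

theorem _root_.BddOnIcc.sub {φ ψ : ℝ → ℝ} (hφ : BddOnIcc c φ) (hψ : BddOnIcc c ψ) :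
    BddOnIcc c (fun u => φ u - ψ u) := by
  obtain ⟨a, ha⟩ := hφ
  obtain ⟨b, hb⟩ := hψ
  exact ⟨a + b, fun u h0 h1 => (abs_sub _ _).trans (add_le_add (ha u h0 h1) (hb u h0 h1))⟩

theorem _root_.BddOnIcc.rpow {s : ℝ} (hs : 0 ≤ s) : BddOnIcc c (fun u => u ^ s) :=
  ⟨c ^ s, fun u h0 h1 => by
    rw [abs_of_nonneg (Real.rpow_nonneg h0 s)]
    exact Real.rpow_le_rpow h0 h1 hs⟩

theorem _root_.BddOnIcc.add_rpow {a : ℝ} (ha : 0 < a) (s : ℝ) :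
    BddOnIcc c (fun u => (u + a) ^ s) := by
  refine ⟨max (a ^ s) ((c + a) ^ s), fun u h0 h1 => ?_⟩
  rw [abs_of_nonneg (Real.rpow_nonneg (by linarith) s)]
  rcases le_total 0 s with hs | hs
  · exact (Real.rpow_le_rpow (by linarith) (by linarith) hs).trans (le_max_right _ _)
  · exact (Real.rpow_le_rpow_of_nonpos ha (by linarith) hs).trans (le_max_left _ _)

variable (S : EigenSystem T c ι)

theorem inner_fn {φ : ℝ → ℝ} (h : BddOnIcc c φ) (i : ι) (v : E) :
    inner ℝ (S.basis i) (S.fn φ v) = φ (S.val i) * inner ℝ (S.basis i) v := by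
  obtain ⟨C, hC⟩ := h
  exact S.basis.inner_diag (fun i => hC _ (S.val_nonneg i) (S.val_le i)) i v

theorem inner_fn_left {φ : ℝ → ℝ} (h : BddOnIcc c φ) (v w : E) :
    inner ℝ (S.fn φ v) w = inner ℝ v (S.fn φ w) := by
  have h1 := S.basis.hasSum_inner_mul_inner (S.fn φ v) w
  have h2 := S.basis.hasSum_inner_mul_inner v (S.fn φ w)
  refine h1.unique ?_
  convert h2 using 2 with i
  rw [real_inner_comm, S.inner_fn h, S.inner_fn h, real_inner_comm]
  ring

theorem fn_fn {φ ψ : ℝ → ℝ} (hφ : BddOnIcc c φ) (hψ : BddOnIcc c ψ) (v : E) :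
    S.fn φ (S.fn ψ v) = S.fn (fun u => φ u * ψ u) v := by
  refine S.basis.ext_inner fun i => ?_
  rw [S.inner_fn hφ, S.inner_fn hψ, S.inner_fn (hφ.mul hψ), mul_assoc]

theorem fn_id : S.fn (fun u => u) = T := by
  ext v
  refine S.basis.ext_inner fun i => ?_
  rw [S.inner_fn BddOnIcc.id, S.inner_apply]

theorem fn_one (v : E) : S.fn (fun _ => 1) v = v := by
  refine S.basis.ext_inner fun i => ?_
  rw [S.inner_fn (BddOnIcc.const 1), one_mul]

theorem norm_fn_le {φ ψ : ℝ → ℝ} (hφ : BddOnIcc c φ) (hψ : BddOnIcc c ψ) {C : ℝ} (hC : 0 ≤ C)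
    (h : ∀ u, 0 ≤ u → u ≤ c → |φ u| ≤ C * |ψ u|) (v : E) : ‖S.fn φ v‖ ≤ C * ‖S.fn ψ v‖ := by
  refine S.basis.norm_le_of_abs_inner_le hC fun i => ?_
  rw [S.inner_fn hφ, S.inner_fn hψ, abs_mul, abs_mul, ← mul_assoc]
  gcongr
  exact h _ (S.val_nonneg i) (S.val_le i)

theorem norm_fn_le' {φ : ℝ → ℝ} {C : ℝ} (hC : 0 ≤ C)
    (h : ∀ u, 0 ≤ u → u ≤ c → |φ u| ≤ C) (v : E) : ‖S.fn φ v‖ ≤ C * ‖v‖ := by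
  have := S.norm_fn_le (φ := φ) (ψ := fun _ => 1) ⟨C, h⟩ (BddOnIcc.const 1) hC (by simpa using h) v
  rwa [S.fn_one] at this

theorem inner_apply_left (S : EigenSystem T c ι) (v w : E) : inner ℝ (T v) w = inner ℝ v (T w) := by
  have := S.inner_fn_left BddOnIcc.id v w
  rwa [S.fn_id] at this

end EigenSystem

theorem hasEigenvalue_mem_Icc (hpos : T.IsPositive) (hc : ‖T‖ ≤ c) {l : ℝ}
    (hl : Module.End.HasEigenvalue (T : E →ₗ[ℝ] E) l) : 0 ≤ l ∧ l ≤ c := by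
  obtain ⟨e, he⟩ := hl.exists_hasEigenvector
  have h1 : T e = l • e := he.apply_eq_smul
  have h2 : inner ℝ (T e) e = l * ‖e‖ ^ 2 := by
    rw [h1, inner_smul_left, real_inner_self_eq_norm_sq, conj_trivial]
  have hpe : 0 < ‖e‖ ^ 2 := by have := norm_pos_iff.2 he.2; positivity
  constructor
  · have h3 := hpos.inner_nonneg_left e
    rw [h2] at h3
    exact nonneg_of_mul_nonneg_left h3 hpe
  · have h3 : inner ℝ (T e) e ≤ c * ‖e‖ ^ 2 := by
      calc inner ℝ (T e) e ≤ ‖T e‖ * ‖e‖ := real_inner_le_norm _ _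
        _ ≤ c * ‖e‖ * ‖e‖ := by gcongr; exact T.le_of_opNorm_le hc e
        _ = c * ‖e‖ ^ 2 := by ring
    rw [h2] at h3
    exact le_of_mul_le_mul_right h3 hpe

/-- A compact positive operator has a Hilbert basis of eigenvectors. -/
theorem exists_eigenSystem {E : Type u} [NormedAddCommGroup E] [InnerProductSpace ℝ E]
    [CompleteSpace E] {T : E →L[ℝ] E} {c : ℝ} (hT : IsCompactOperator T)
    (hpos : T.IsPositive) (hc : ‖T‖ ≤ c) : ∃ ι : Type u, Nonempty (EigenSystem T c ι) := by
  have hsymm : (T : E →ₗ[ℝ] E).IsSymmetric := hpos.isSymmetric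
  let V : ℝ → Submodule ℝ E := fun μ => Module.End.eigenspace (T : E →ₗ[ℝ] E) μ
  have hV : OrthogonalFamily ℝ (fun μ => V μ) fun μ => (V μ).subtypeₗᵢ :=
    hsymm.orthogonalFamily_eigenspaces
  have hcl : ∀ μ, CompleteSpace (V μ) := fun μ => by infer_instance
  choose w b hb using fun μ : ℝ => exists_hilbertBasis ℝ (V μ)
  have hon := hV.orthonormal_sigma_orthonormal (fun μ => (b μ).orthonormal)
  let t := HilbertBasis.mkOfOrthogonalEqBot hon (by
    rw [Submodule.eq_bot_iff]
    intro x hx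
    have hbot := ContinuousLinearMap.orthogonalComplement_iSup_eigenspaces_eq_bot hT hsymm
    rw [Submodule.eq_bot_iff] at hbot
    refine hbot x ?_
    rw [← Submodule.iInf_orthogonal, Submodule.mem_iInf]
    intro μ
    rw [Submodule.mem_orthogonal]
    intro y hy
    have h1 : inner ℝ y x = inner ℝ (⟨y, hy⟩ : V μ) ((V μ).orthogonalProjectionOnto x) := by
      rw [Submodule.inner_orthogonalProjectionOnto_eq_of_mem_left]
    rw [h1]
    have h2 : (V μ).orthogonalProjectionOnto x = 0 := by
      refine (b μ).ext_inner fun i => ?_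
      have h3 := Submodule.inner_orthogonalProjectionOnto_eq_of_mem_left (b μ i) x
      rw [inner_zero_right]
      refine h3.trans ?_
      exact (Submodule.mem_orthogonal _ _).1 hx _ (Submodule.subset_span ⟨⟨μ, i⟩, rfl⟩)
    rw [h2, inner_zero_right])
  have happ : ∀ i : Σ μ, w μ, T (t i) = i.1 • t i := by
    intro i
    have : t i = ((b i.1 i.2 : V i.1) : E) := by
      simp only [t, HilbertBasis.coe_mkOfOrthogonalEqBot]
      rfl
    rw [this]
    exact Module.End.mem_eigenspace_iff.1 (b i.1 i.2).2
  have hval : ∀ i : Σ μ, w μ, i.fst = inner ℝ (T (t i)) (t i) := by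
    intro i
    rw [happ, inner_smul_left, real_inner_self_eq_norm_sq, t.orthonormal.1 i]
    simp
  refine ⟨(Σ μ, w μ), ⟨⟨t, fun i : Σ μ, w μ => i.1, happ, fun i => ?_, fun i => ?_⟩⟩⟩
  · rw [hval]
    exact hpos.inner_nonneg_left _
  · rw [hval]
    refine (real_inner_le_norm _ _).trans ?_
    have := T.le_opNorm (t i)
    rw [t.orthonormal.1 i] at *
    linarith

end EigenSystem

section SpectralFun

theorem eigenspace_eq_bot_of_not_hasEigenvalue {E : Type*} [AddCommGroup E] [Module ℝ E]
    {T : E →ₗ[ℝ] E} {μ : ℝ} (h : ¬ Module.End.HasEigenvalue T μ) :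
    Module.End.eigenspace T μ = ⊥ := by
  rwa [Module.End.hasEigenvalue_iff, not_not] at h

variable {E : Type*} [NormedAddCommGroup E] [InnerProductSpace ℝ E] [CompleteSpace E]

theorem summable_spectralFun {T : E →L[ℝ] E} (hT : (T : E →ₗ[ℝ] E).IsSymmetric) {φ : ℝ → ℝ} {C : ℝ}
    (hφ : ∀ μ, Module.End.HasEigenvalue (T : E →ₗ[ℝ] E) μ → |φ μ| ≤ C) (v : E) :
    Summable fun μ : ℝ =>
      φ μ • (Module.End.eigenspace (T : E →ₗ[ℝ] E) μ).starProjection v := by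
  set V : ℝ → Submodule ℝ E := fun μ => Module.End.eigenspace (T : E →ₗ[ℝ] E) μ with hVdef
  have hV : OrthogonalFamily ℝ (fun μ => V μ) fun μ => (V μ).subtypeₗᵢ :=
    hT.orthogonalFamily_eigenspaces
  have hcl : ∀ μ, CompleteSpace (V μ) := fun μ => by infer_instance
  have hbes : ∀ s : Finset ℝ, ∑ μ ∈ s, ‖(V μ).orthogonalProjectionOnto v‖ ^ 2 ≤ ‖v‖ ^ 2 := by
    intro s
    have h1 := hV.norm_sum (fun μ => (V μ).orthogonalProjectionOnto v) s
    set P := ∑ μ ∈ s, (V μ).subtypeₗᵢ ((V μ).orthogonalProjectionOnto v) with hP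
    have h2 : inner ℝ P v = ‖P‖ ^ 2 := by
      rw [h1, hP, sum_inner]
      refine Finset.sum_congr rfl fun μ _ => ?_
      rw [← real_inner_self_eq_norm_sq]
      exact (Submodule.inner_orthogonalProjectionOnto_eq_of_mem_left
        ((V μ).orthogonalProjectionOnto v) v).symm
    have h3 := real_inner_le_norm P v
    rw [h2] at h3
    rw [← h1]
    nlinarith [norm_nonneg P, norm_nonneg v, sq_nonneg (‖P‖ - ‖v‖)]
  have hsum : Summable fun μ => ‖(V μ).orthogonalProjectionOnto v‖ ^ 2 :=
    summable_of_sum_le (fun _ => by positivity) hbes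
  have := (hV.summable_iff_norm_sq_summable
    (fun μ => φ μ • (V μ).orthogonalProjectionOnto v)).2 ?_
  · exact this
  · refine (hsum.mul_left (C ^ 2)).of_nonneg_of_le (fun _ => by positivity) fun μ => ?_
    by_cases hμ : Module.End.HasEigenvalue (T : E →ₗ[ℝ] E) μ
    · rw [norm_smul, mul_pow]
      gcongr
      exact hφ μ hμ
    · have : (V μ).orthogonalProjectionOnto v = 0 := by
        have hb : V μ = ⊥ := eigenspace_eq_bot_of_not_hasEigenvalue hμ
        have hle : V μ ≤ ⊥ := hb.le
        exact Subtype.ext ((Submodule.mem_bot ℝ).1 (hle ((V μ).orthogonalProjectionOnto v).2))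
      simp [this]

/-- `φ(T)` acts on the eigenvectors of `T` with eigenvalue `l` as multiplication by `φ l`. -/
theorem inner_spectralFun {T : E →L[ℝ] E} (hT : (T : E →ₗ[ℝ] E).IsSymmetric) {φ : ℝ → ℝ} {C : ℝ}
    (hφ : ∀ μ, Module.End.HasEigenvalue (T : E →ₗ[ℝ] E) μ → |φ μ| ≤ C) {e : E} {l : ℝ}
    (he : T e = l • e) (v : E) :
    inner ℝ e (spectralFun T φ v) = φ l * inner ℝ e v := by
  have hs := (summable_spectralFun hT hφ v).hasSum.mapL (innerSL ℝ e)
  have he' : e ∈ Module.End.eigenspace (T : E →ₗ[ℝ] E) l := Module.End.mem_eigenspace_iff.2 he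
  have h2 : HasSum (fun μ : ℝ => innerSL ℝ e
      (φ μ • (Module.End.eigenspace (T : E →ₗ[ℝ] E) μ).starProjection v))
      (φ l * inner ℝ e v) := by
    convert hasSum_single l ?_ using 1
    · rw [innerSL_apply_apply, inner_smul_right, ← Submodule.inner_starProjection_left_eq_right,
        Submodule.starProjection_eq_self_iff.2 he']
    · intro μ hμ
      rw [innerSL_apply_apply, inner_smul_right]
      have := hT.orthogonalFamily_eigenspaces hμ.symm ⟨e, he'⟩
        ((Module.End.eigenspace (T : E →ₗ[ℝ] E) μ).orthogonalProjectionOnto v)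
      have h3 : inner ℝ e ((Module.End.eigenspace (T : E →ₗ[ℝ] E) μ).starProjection v) = 0 := this
      rw [h3, mul_zero]
  exact hs.unique h2

end SpectralFun

/-! ### Heinz inequality for regularized powers -/

section Heinz

theorem lintegral_Ioi_comp_mul_left {h : ℝ → ℝ≥0∞} (hh : Measurable h) {c : ℝ} (hc : 0 < c) :
    ENNReal.ofReal c * ∫⁻ x in Set.Ioi 0, h (c * x) = ∫⁻ x in Set.Ioi 0, h x := by
  rw [← lintegral_indicator measurableSet_Ioi, ← lintegral_indicator measurableSet_Ioi]
  conv_rhs => rw [← Real.smul_map_volume_mul_left hc.ne', lintegral_smul_measure,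
    lintegral_map (hh.indicator measurableSet_Ioi) (measurable_const_mul c), abs_of_pos hc]
  rw [smul_eq_mul]
  congr 1
  refine lintegral_congr fun x => ?_
  by_cases hx : 0 < x
  · simp [Set.indicator, hx, hc]
  · simp [Set.indicator, hx, hc]

theorem lintegral_Ioi_rpow_mul_div {s : ℝ} {a : ℝ} (ha : 0 < a) :
    ∫⁻ τ in Set.Ioi 0, ENNReal.ofReal (τ ^ (s - 1) * (a / (a + τ))) =
      ENNReal.ofReal (a ^ s) * ∫⁻ τ in Set.Ioi 0, ENNReal.ofReal (τ ^ (s - 1) * (1 / (1 + τ))) := by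
  have hm : Measurable fun τ : ℝ => ENNReal.ofReal (τ ^ (s - 1) * (a / (a + τ))) := by fun_prop
  rw [← lintegral_Ioi_comp_mul_left hm ha,
    show a ^ s = a * a ^ (s - 1) by rw [Real.rpow_sub_one ha.ne']; field_simp,
    ENNReal.ofReal_mul ha.le, mul_assoc]
  congr 1
  rw [← lintegral_const_mul _ (by fun_prop)]
  refine setLIntegral_congr_fun measurableSet_Ioi fun τ hτ => ?_
  have hτ : 0 < τ := hτ
  rw [← ENNReal.ofReal_mul (Real.rpow_nonneg ha.le _), Real.mul_rpow ha.le hτ.le, ← mul_assoc]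
  congr 2
  field_simp

theorem lintegral_Ioi_rpow_div_ne_top {s : ℝ} (h0 : 0 < s) (h1 : s < 1) :
    ∫⁻ τ in Set.Ioi (0 : ℝ), ENNReal.ofReal (τ ^ (s - 1) * (1 / (1 + τ))) ≠ ⊤ := by
  rw [← Set.Ioc_union_Ioi_eq_Ioi zero_le_one]
  refine ((lintegral_union_le _ _ _).trans_lt (ENNReal.add_lt_top.2 ⟨?_, ?_⟩)).ne
  · have hi : IntegrableOn (fun τ : ℝ => τ ^ (s - 1)) (Set.Ioc 0 1) :=
      (intervalIntegrable_iff_integrableOn_Ioc_of_le zero_le_one).1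
        (intervalIntegral.intervalIntegrable_rpow' (by linarith))
    refine (setLIntegral_mono' measurableSet_Ioc fun τ hτ => ?_).trans_lt
      hi.lintegral_lt_top
    refine ENNReal.ofReal_le_ofReal ?_
    have : 1 / (1 + τ) ≤ 1 := by rw [div_le_one (by linarith [hτ.1])]; linarith [hτ.1]
    exact mul_le_of_le_one_right (Real.rpow_nonneg hτ.1.le _) this
  · have hi : IntegrableOn (fun τ : ℝ => τ ^ (s - 2)) (Set.Ioi 1) :=
      integrableOn_Ioi_rpow_of_lt (by linarith) one_pos
    refine (setLIntegral_mono' measurableSet_Ioi fun τ hτ => ?_).trans_lt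
      hi.lintegral_lt_top
    have hτ : 1 < τ := hτ
    refine ENNReal.ofReal_le_ofReal ?_
    have hτ0 : 0 < τ := by linarith
    have h2 : τ ^ (s - 2) = τ ^ (s - 1) * (1 / τ) := by
      rw [show s - 2 = s - 1 - 1 by ring, Real.rpow_sub_one hτ0.ne' (s - 1)]
      ring
    rw [h2]
    gcongr
    linarith

theorem lintegral_Ioi_rpow_div_ne_zero {s : ℝ} :
    ∫⁻ τ in Set.Ioi (0 : ℝ), ENNReal.ofReal (τ ^ (s - 1) * (1 / (1 + τ))) ≠ 0 := by
  have hm : Measurable fun τ : ℝ => ENNReal.ofReal (τ ^ (s - 1) * (1 / (1 + τ))) := by fun_prop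
  refine ((setLIntegral_pos_iff hm).2 ?_).ne'
  have hsub : Set.Ioi (0 : ℝ) ⊆
      (Function.support fun τ : ℝ => ENNReal.ofReal (τ ^ (s - 1) * (1 / (1 + τ)))) ∩ Set.Ioi 0 := by
    intro τ hτ
    have hτ' : 0 < τ := hτ
    refine ⟨?_, hτ⟩
    simp only [Function.mem_support, ne_eq, ENNReal.ofReal_eq_zero, not_le]
    positivity
  refine lt_of_lt_of_le ?_ (measure_mono hsub)
  simp

theorem mul_tsum_rpow_eq_lintegral {ι : Type*} [Countable ι] {w : ι → ℝ} (hw : ∀ i, 0 < w i)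
    (Z : ι → ℝ≥0∞) (s : ℝ) :
    (∫⁻ τ in Set.Ioi (0 : ℝ), ENNReal.ofReal (τ ^ (s - 1) * (1 / (1 + τ)))) *
        ∑' i, ENNReal.ofReal (w i ^ s) * Z i =
      ∫⁻ τ in Set.Ioi (0 : ℝ), ENNReal.ofReal (τ ^ (s - 2)) *
        ∑' i, ENNReal.ofReal (w i * τ / (w i + τ)) * Z i := by
  simp_rw [← ENNReal.tsum_mul_left]
  rw [lintegral_tsum fun i => by fun_prop]
  refine tsum_congr fun i => ?_
  rw [← mul_assoc, mul_comm _ (ENNReal.ofReal _), ← lintegral_Ioi_rpow_mul_div (hw i),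
    ← lintegral_mul_const _ (by fun_prop)]
  refine setLIntegral_congr_fun measurableSet_Ioi fun τ hτ => ?_
  have hτ : 0 < τ := hτ
  rw [← mul_assoc, ← ENNReal.ofReal_mul (Real.rpow_nonneg hτ.le _)]
  congr 2
  rw [show s - 1 = s - 2 + 1 by ring, Real.rpow_add_one hτ.ne']
  ring

/-- If two weighted sums compare after the weights `a` are replaced by the harmonic sums
`a τ / (a + τ)` for all `τ > 0`, then they compare after the weights are replaced by `a ^ s`:
`a ^ s` is, up to a constant, the integral of `τ ^ (s - 2) * (a τ / (a + τ))` over `τ > 0`. -/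
theorem tsum_rpow_le_of_forall_tsum_harmonic_le {ι ι' : Type*} [Countable ι] [Countable ι']
    {a : ι → ℝ} {b : ι' → ℝ} (ha : ∀ i, 0 < a i) (hb : ∀ j, 0 < b j) {X : ι → ℝ≥0∞}
    {Y : ι' → ℝ≥0∞} {s : ℝ} (h0 : 0 < s) (h1 : s < 1)
    (h : ∀ τ, 0 < τ → ∑' i, ENNReal.ofReal (a i * τ / (a i + τ)) * X i ≤
      ∑' j, ENNReal.ofReal (b j * τ / (b j + τ)) * Y j) :
    ∑' i, ENNReal.ofReal (a i ^ s) * X i ≤ ∑' j, ENNReal.ofReal (b j ^ s) * Y j := by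
  set F := ∫⁻ τ in Set.Ioi (0 : ℝ), ENNReal.ofReal (τ ^ (s - 1) * (1 / (1 + τ))) with hF
  have key2 : F * ∑' i, ENNReal.ofReal (a i ^ s) * X i ≤
      F * ∑' j, ENNReal.ofReal (b j ^ s) * Y j := by
    rw [mul_tsum_rpow_eq_lintegral ha, mul_tsum_rpow_eq_lintegral hb]
    refine setLIntegral_mono' measurableSet_Ioi fun τ hτ => ?_
    gcongr
    exact h τ hτ
  exact (ENNReal.mul_le_mul_iff_right lintegral_Ioi_rpow_div_ne_zero
    (lintegral_Ioi_rpow_div_ne_top h0 h1)).1 key2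

end Heinz

section Comparison

variable {E : Type*} [NormedAddCommGroup E] [InnerProductSpace ℝ E]
  {T T' : E →L[ℝ] E} {c c' : ℝ} {ι ι' : Type*}

namespace EigenSystem

/-- The power `(T + a) ^ s` of the regularized operator. -/
def regPow (S : EigenSystem T c ι) (a s : ℝ) : E →L[ℝ] E := S.fn fun u => (u + a) ^ s

theorem inner_regPow (S : EigenSystem T c ι) {a : ℝ} (ha : 0 < a) (s : ℝ) (i : ι) (v : E) :
    inner ℝ (S.basis i) (S.regPow a s v) = (S.val i + a) ^ s * inner ℝ (S.basis i) v :=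
  S.inner_fn (BddOnIcc.add_rpow ha s) i v

theorem inner_regPow_left (S : EigenSystem T c ι) {a : ℝ} (ha : 0 < a) (s : ℝ) (v w : E) :
    inner ℝ (S.regPow a s v) w = inner ℝ v (S.regPow a s w) :=
  S.inner_fn_left (BddOnIcc.add_rpow ha s) v w

theorem val_add_pos (S : EigenSystem T c ι) {a : ℝ} (ha : 0 < a) (i : ι) : 0 < S.val i + a :=
  add_pos_of_nonneg_of_pos (S.val_nonneg i) ha

theorem regPow_regPow (S : EigenSystem T c ι) {a : ℝ} (ha : 0 < a) (s t : ℝ) (v : E) :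
    S.regPow a s (S.regPow a t v) = S.regPow a (s + t) v := by
  refine S.basis.ext_inner fun i => ?_
  rw [S.inner_regPow ha, S.inner_regPow ha, S.inner_regPow ha, Real.rpow_add (S.val_add_pos ha i),
    mul_assoc]

theorem regPow_zero (S : EigenSystem T c ι) {a : ℝ} (ha : 0 < a) (v : E) :
    S.regPow a 0 v = v := by
  refine S.basis.ext_inner fun i => ?_
  rw [S.inner_regPow ha, Real.rpow_zero, one_mul]

theorem regPow_one (S : EigenSystem T c ι) {a : ℝ} (ha : 0 < a) (v : E) :
    S.regPow a 1 v = T v + a • v := by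
  refine S.basis.ext_inner fun i => ?_
  rw [S.inner_regPow ha, Real.rpow_one, inner_add_right, S.inner_apply, inner_smul_right, add_mul]

theorem norm_regPow_sq (S : EigenSystem T c ι) {a : ℝ} (ha : 0 < a) (s : ℝ) (v : E) :
    ‖S.regPow a (s / 2) v‖ ^ 2 = inner ℝ v (S.regPow a s v) := by
  rw [← real_inner_self_eq_norm_sq, S.inner_regPow_left ha, S.regPow_regPow ha, add_halves]

theorem norm_regPow_le (S : EigenSystem T c ι) {a : ℝ} (ha : 0 < a) {s t : ℝ} (hst : s ≤ t)
    (v : E) : ‖S.regPow a s v‖ ≤ a ^ (s - t) * ‖S.regPow a t v‖ := by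
  refine S.norm_fn_le (BddOnIcc.add_rpow ha s) (BddOnIcc.add_rpow ha t) (by positivity) ?_ v
  intro u h0 _
  have hu : 0 < u + a := by linarith
  rw [abs_of_nonneg (by positivity), abs_of_nonneg (by positivity),
    show (u + a) ^ s = (u + a) ^ (s - t) * (u + a) ^ t by rw [← Real.rpow_add hu]; ring_nf]
  have := Real.rpow_le_rpow_of_nonpos ha (by linarith : a ≤ u + a) (by linarith : s - t ≤ 0)
  gcongr

theorem ofReal_norm_sq_fn (S : EigenSystem T c ι) {φ : ℝ → ℝ} (hφ : BddOnIcc c φ) (v : E) :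
    ENNReal.ofReal (‖S.fn φ v‖ ^ 2) =
      ∑' i, ENNReal.ofReal (φ (S.val i) ^ 2) * ENNReal.ofReal (inner ℝ (S.basis i) v ^ 2) := by
  rw [← (S.basis.hasSum_sq_inner (S.fn φ v)).tsum_eq, ENNReal.ofReal_tsum_of_nonneg
    (fun _ => by positivity) (S.basis.hasSum_sq_inner _).summable]
  refine tsum_congr fun i => ?_
  rw [S.inner_fn hφ, mul_pow, ENNReal.ofReal_mul (by positivity)]

/-- **Heinz inequality** for the regularized operators. -/
theorem norm_regPow_le_of_norm_regPow_one_le [Countable ι] [Countable ι']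
    (A : EigenSystem T c ι) (B : EigenSystem T' c' ι') {a Q : ℝ} (ha : 0 < a) (hQ : 0 < Q)
    (h : ∀ v, ‖A.regPow a 1 v‖ ≤ Q * ‖B.regPow a 1 v‖) {s : ℝ} (h0 : 0 ≤ s) (h1 : s ≤ 1) (v : E) :
    ‖A.regPow a s v‖ ≤ Q ^ s * ‖B.regPow a s v‖ := by
  rcases h0.eq_or_lt with rfl | h0
  · simp [A.regPow_zero ha, B.regPow_zero ha]
  rcases h1.eq_or_lt with rfl | h1
  · simpa using h v
  have hpA : ∀ i, 0 < A.val i + a := A.val_add_pos ha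
  have hpB : ∀ i, 0 < B.val i + a := B.val_add_pos ha
  have hmain := tsum_rpow_le_of_forall_tsum_harmonic_le (a := fun i => (A.val i + a) ^ 2)
    (b := fun j => (Q * (B.val j + a)) ^ 2) (fun i => by have := hpA i; positivity)
    (fun j => by have := hpB j; positivity)
    (X := fun i => ENNReal.ofReal (inner ℝ (A.basis i) v ^ 2))
    (Y := fun j => ENNReal.ofReal (inner ℝ (B.basis j) v ^ 2)) h0 h1 ?_
  · have e1 : ∀ (w : ℝ), 0 < w → (w ^ 2) ^ s = (w ^ s) ^ 2 := fun w hw => by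
      rw [← Real.rpow_natCast, ← Real.rpow_natCast, ← Real.rpow_mul hw.le, ← Real.rpow_mul hw.le,
        mul_comm]
    have hR : ∀ j, ENNReal.ofReal (((Q * (B.val j + a)) ^ 2) ^ s) =
        ENNReal.ofReal ((Q ^ s) ^ 2) * ENNReal.ofReal (((B.val j + a) ^ s) ^ 2) := fun j => by
      rw [← ENNReal.ofReal_mul (by positivity), e1 _ (mul_pos hQ (hpB j)),
        Real.mul_rpow hQ.le (hpB j).le, mul_pow]
    simp_rw [hR, fun i => e1 _ (hpA i), mul_assoc] at hmain
    rw [ENNReal.tsum_mul_left, ← A.ofReal_norm_sq_fn (BddOnIcc.add_rpow ha s) v,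
      ← B.ofReal_norm_sq_fn (BddOnIcc.add_rpow ha s) v, ← ENNReal.ofReal_mul (by positivity),
      ENNReal.ofReal_le_ofReal_iff (by positivity), ← mul_pow] at hmain
    exact le_of_sq_le_sq hmain (by positivity)
  · intro τ hτ
    -- The infimum of `‖(T + a) y‖ ^ 2 + τ ‖v - y‖ ^ 2` over `y` is the left hand side; the
    -- point `y` where the corresponding expression for `Q (T' + a)` is minimal is used here.
    have hden : ∀ u, 0 ≤ u → 0 < (Q * (u + a)) ^ 2 + τ := fun u hu => by positivity
    have hbd1 : BddOnIcc c' fun u => τ / ((Q * (u + a)) ^ 2 + τ) := ⟨1, fun u h0 _ => by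
      rw [abs_of_nonneg (div_nonneg hτ.le (hden u h0).le), div_le_one (hden u h0)]
      linarith [sq_nonneg (Q * (u + a))]⟩
    set y := B.fn (fun u => τ / ((Q * (u + a)) ^ 2 + τ)) v with hy
    have step1 : ∑' i, ENNReal.ofReal ((A.val i + a) ^ 2 * τ / ((A.val i + a) ^ 2 + τ)) *
        ENNReal.ofReal (inner ℝ (A.basis i) v ^ 2) ≤
        ENNReal.ofReal (‖A.regPow a 1 y‖ ^ 2 + τ * ‖v - y‖ ^ 2) := by
      have hs := (A.basis.hasSum_sq_inner (A.regPow a 1 y)).add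
        ((A.basis.hasSum_sq_inner (v - y)).mul_left τ)
      rw [← hs.tsum_eq, ENNReal.ofReal_tsum_of_nonneg (fun _ => by positivity) hs.summable]
      refine ENNReal.tsum_le_tsum fun i => ?_
      rw [← ENNReal.ofReal_mul (by positivity)]
      refine ENNReal.ofReal_le_ofReal ?_
      rw [A.inner_regPow ha, Real.rpow_one, inner_sub_right]
      have hA := hpA i
      generalize A.val i + a = w at *
      generalize inner ℝ (A.basis i) v = p
      generalize inner ℝ (A.basis i) y = q
      rw [div_mul_eq_mul_div, div_le_iff₀ (by positivity)]
      nlinarith [sq_nonneg (w ^ 2 * q - τ * (p - q))]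
    refine step1.trans ?_
    have step2 : ‖A.regPow a 1 y‖ ^ 2 + τ * ‖v - y‖ ^ 2 ≤
        (Q * ‖B.regPow a 1 y‖) ^ 2 + τ * ‖v - y‖ ^ 2 := by
      gcongr
      exact h y
    refine (ENNReal.ofReal_le_ofReal step2).trans (le_of_eq ?_)
    have hs := ((B.basis.hasSum_sq_inner (B.regPow a 1 y)).mul_left (Q ^ 2)).add
      ((B.basis.hasSum_sq_inner (v - y)).mul_left τ)
    rw [mul_pow, ← hs.tsum_eq, ENNReal.ofReal_tsum_of_nonneg (fun _ => by positivity) hs.summable]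
    refine tsum_congr fun i => ?_
    rw [← ENNReal.ofReal_mul (by have := hden _ (B.val_nonneg i); positivity)]
    congr 1
    rw [B.inner_regPow ha, Real.rpow_one, inner_sub_right, hy, B.inner_fn hbd1]
    have hd := hden _ (B.val_nonneg i)
    have hB := hpB i
    generalize B.val i + a = w at *
    generalize inner ℝ (B.basis i) v = p
    field_simp
    ring

/-- The perturbation `T - T'` controls the square root of `T + a` by that of `T' + a`. -/
theorem norm_regPow_half_le (A : EigenSystem T c ι) (B : EigenSystem T' c' ι') {a Ψ : ℝ}
    (ha : 0 < a) (hΨ : 0 ≤ Ψ) (h : ∀ v, ‖A.regPow a (-(1 / 2)) (T v - T' v)‖ ≤ Ψ * ‖v‖) (v : E) :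
    ‖A.regPow a (1 / 2) v‖ ≤ (1 + a ^ (-(1 / 2) : ℝ) * Ψ) * ‖B.regPow a (1 / 2) v‖ := by
  set x := ‖A.regPow a (1 / 2) v‖ with hx
  set y := ‖B.regPow a (1 / 2) v‖ with hy
  set ψ := a ^ (-(1 / 2) : ℝ) * Ψ
  have hψ : 0 ≤ ψ := by positivity
  have h1 : x ^ 2 = y ^ 2 + inner ℝ v (T v - T' v) := by
    rw [hx, hy, A.norm_regPow_sq ha, B.norm_regPow_sq ha, A.regPow_one ha, B.regPow_one ha,
      ← inner_add_right]
    congr 1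
    abel
  have h2 : inner ℝ v (T v - T' v) ≤ x * (Ψ * ‖v‖) := by
    have : inner ℝ v (T v - T' v) =
        inner ℝ (A.regPow a (1 / 2) v) (A.regPow a (-(1 / 2)) (T v - T' v)) := by
      rw [A.inner_regPow_left ha, A.regPow_regPow ha, add_neg_cancel, A.regPow_zero ha]
    rw [this]
    exact (real_inner_le_norm _ _).trans (by gcongr; exact h v)
  have h3 : ‖v‖ ≤ a ^ (-(1 / 2) : ℝ) * y := by
    have := B.norm_regPow_le ha (s := 0) (t := 1 / 2) (by norm_num) v
    rwa [B.regPow_zero ha, zero_sub] at this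
  have h4 : x ^ 2 ≤ y ^ 2 + x * (ψ * y) := by
    have : Ψ * ‖v‖ ≤ ψ * y := by
      calc Ψ * ‖v‖ ≤ Ψ * (a ^ (-(1 / 2) : ℝ) * y) := by gcongr
        _ = ψ * y := by simp only [ψ]; ring
    nlinarith [norm_nonneg (A.regPow a (1 / 2) v)]
  have hx0 : 0 ≤ x := norm_nonneg _
  have hy0 : 0 ≤ y := norm_nonneg _
  by_contra hcon
  push Not at hcon
  have hxy : y ≤ x := by nlinarith
  have hxp : 0 < x := by nlinarith [mul_nonneg hψ hy0]
  nlinarith [mul_pos hxp (sub_pos.2 hcon), mul_nonneg hy0 (sub_nonneg.2 hxy)]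

/-- The perturbation `T - T'` controls `T + a` by `T' + a`: since
`‖(T - T') v‖ ≤ Ψ ‖(T + a) ^ (1/2) v‖` by duality, `norm_regPow_half_le` applies. -/
theorem norm_regPow_one_le (A : EigenSystem T c ι) (B : EigenSystem T' c' ι') {a Ψ : ℝ}
    (ha : 0 < a) (hΨ : 0 ≤ Ψ) (h : ∀ v, ‖A.regPow a (-(1 / 2)) (T v - T' v)‖ ≤ Ψ * ‖v‖) (v : E) :
    ‖A.regPow a 1 v‖ ≤ (1 + a ^ (-(1 / 2) : ℝ) * Ψ) ^ 2 * ‖B.regPow a 1 v‖ := by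
  have h1 : ‖T v - T' v‖ ≤ Ψ * ‖A.regPow a (1 / 2) v‖ := by
    set d := T v - T' v with hd
    have h2 : ‖d‖ ^ 2 ≤ (Ψ * ‖d‖) * ‖A.regPow a (1 / 2) v‖ := by
      have : ‖d‖ ^ 2 = inner ℝ (A.regPow a (-(1 / 2)) (T d - T' d)) (A.regPow a (1 / 2) v) := by
        rw [A.inner_regPow_left ha, A.regPow_regPow ha, neg_add_cancel, A.regPow_zero ha,
          inner_sub_left, A.inner_apply_left, B.inner_apply_left, ← inner_sub_right,
          real_inner_self_eq_norm_sq]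
      rw [this]
      exact (real_inner_le_norm _ _).trans (by gcongr; exact h d)
    rcases (norm_nonneg d).eq_or_lt with h0 | h0
    · rw [← h0]; positivity
    · nlinarith
  have h2 := A.norm_regPow_half_le B ha hΨ h v
  have h3 := B.norm_regPow_le ha (s := 1 / 2) (t := 1) (by norm_num) v
  rw [show (1 / 2 - 1 : ℝ) = -(1 / 2) by norm_num] at h3
  have h4 : ‖A.regPow a 1 v‖ ≤ ‖B.regPow a 1 v‖ + ‖T v - T' v‖ := by
    rw [A.regPow_one ha, B.regPow_one ha]
    calc ‖T v + a • v‖ = ‖(T' v + a • v) + (T v - T' v)‖ := by congr 1; abel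
      _ ≤ _ := norm_add_le _ _
  set k := a ^ (-(1 / 2) : ℝ)
  have hk : 0 ≤ k := by positivity
  set z := ‖B.regPow a 1 v‖
  have hz : 0 ≤ z := norm_nonneg _
  calc ‖A.regPow a 1 v‖ ≤ z + Ψ * ((1 + k * Ψ) * (k * z)) := by
        refine h4.trans ?_
        gcongr
        exact h1.trans (by gcongr; exact h2.trans (by gcongr))
    _ ≤ (1 + k * Ψ) ^ 2 * z := by
        have : 0 ≤ k * Ψ * z := by positivity
        nlinarith

end EigenSystem

end Comparison

/-! ### The deterministic error bound -/

section ErrorBound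

variable {E : Type*} [NormedAddCommGroup E] [InnerProductSpace ℝ E]
  {T T' : E →L[ℝ] E} {c c' : ℝ} {ι ι' : Type*}

theorem le_of_sq_le_mul_self {x y : ℝ} (hx : 0 ≤ x) (hy : 0 ≤ y) (h : x ^ 2 ≤ y * x) :
    x ≤ y := by
  rcases hx.eq_or_lt with h0 | h0
  · rwa [← h0]
  · nlinarith

namespace EigenSystem

/-- By duality, the bound of `norm_regPow_half_le` passes to the inverse square roots. -/
theorem norm_regPow_neg_half_le (A : EigenSystem T c ι) (B : EigenSystem T' c' ι') {a K : ℝ}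
    (ha : 0 < a) (hK : 0 ≤ K)
    (h : ∀ v, ‖A.regPow a (1 / 2) v‖ ≤ K * ‖B.regPow a (1 / 2) v‖) (v : E) :
    ‖B.regPow a (-(1 / 2)) v‖ ≤ K * ‖A.regPow a (-(1 / 2)) v‖ := by
  set z := B.regPow a (-(1 / 2)) v with hz
  refine le_of_sq_le_mul_self (norm_nonneg _) (by positivity) ?_
  have h1 : ‖z‖ ^ 2 = inner ℝ (A.regPow a (1 / 2) (B.regPow a (-(1 / 2)) z))
      (A.regPow a (-(1 / 2)) v) := by
    rw [A.inner_regPow_left ha, A.regPow_regPow ha, add_neg_cancel, A.regPow_zero ha,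
      B.inner_regPow_left ha, ← hz, real_inner_self_eq_norm_sq]
  have h2 := h (B.regPow a (-(1 / 2)) z)
  rw [B.regPow_regPow ha _ _ z, add_neg_cancel, B.regPow_zero ha] at h2
  rw [h1]
  refine (real_inner_le_norm _ _).trans ?_
  calc _ ≤ K * ‖z‖ * ‖A.regPow a (-(1 / 2)) v‖ := by gcongr
    _ = _ := by ring

/-- By duality, the Heinz inequality bounds `(T' + a) ^ (-s) T ^ s`. -/
theorem norm_regPow_neg_rpow_le (A : EigenSystem T c ι) (B : EigenSystem T' c' ι') {a K s : ℝ}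
    (ha : 0 < a) (hK : 0 ≤ K) (hs : 0 ≤ s)
    (h : ∀ v, ‖A.regPow a s v‖ ≤ K * ‖B.regPow a s v‖) (v : E) :
    ‖B.regPow a (-s) (A.fn (fun u => u ^ s) v)‖ ≤ K * ‖v‖ := by
  set z := B.regPow a (-s) (A.fn (fun u => u ^ s) v) with hz
  refine le_of_sq_le_mul_self (norm_nonneg _) (by positivity) ?_
  have h1 : ‖z‖ ^ 2 = inner ℝ (A.fn (fun u => u ^ s) (B.regPow a (-s) z)) v := by
    rw [A.inner_fn_left (BddOnIcc.rpow hs), B.inner_regPow_left ha, ← hz,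
      real_inner_self_eq_norm_sq]
  have h2 := h (B.regPow a (-s) z)
  rw [B.regPow_regPow ha _ _ z, add_neg_cancel, B.regPow_zero ha] at h2
  have h3 : ‖A.fn (fun u => u ^ s) (B.regPow a (-s) z)‖ ≤
      1 * ‖A.regPow a s (B.regPow a (-s) z)‖ := by
    refine A.norm_fn_le (BddOnIcc.rpow hs) (BddOnIcc.add_rpow ha s) zero_le_one ?_ _
    intro u h0 _
    rw [abs_of_nonneg (by positivity), abs_of_nonneg (by positivity), one_mul]
    gcongr
    linarith
  rw [h1]
  refine (real_inner_le_norm _ _).trans ?_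
  calc _ ≤ K * ‖z‖ * ‖v‖ := by gcongr; linarith
    _ = _ := by ring

/-- The deterministic error bound: `T` is the covariance operator, `T'` its empirical version,
`fH = T ^ s v` the target, `q` the empirical noise `g - T' fH` and `f` the estimator `φ(T') g`.
The error is controlled by the size of `(T + a) ^ (-1/2) (T - T')` and of `(T + a) ^ (-1/2) q`. -/
theorem norm_regPow_half_sub_le [Countable ι] [Countable ι']
    (A : EigenSystem T c ι) (B : EigenSystem T' c' ι') {a Ψ Θ b G s : ℝ}
    (ha : 0 < a) (hΨ0 : 0 ≤ Ψ) (hb : 0 ≤ b) (hG : 0 ≤ G) (hs0 : 0 ≤ s) (hs1 : s ≤ 1)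
    (hΨ : ∀ v, ‖A.regPow a (-(1 / 2)) (T v - T' v)‖ ≤ Ψ * ‖v‖)
    {φ : ℝ → ℝ} (hφ1 : ∀ u, 0 < u → u ≤ c' → |φ u| ≤ b / a)
    (hφ2 : ∀ u, 0 < u → u ≤ c' → |φ u * u| ≤ b)
    (hφ3 : ∀ u, 0 < u → u ≤ c' → |1 - φ u * u| * u ^ (s + 1 / 2) ≤ G * a ^ (s + 1 / 2))
    {f fH q v : E} (hfH : fH = A.fn (fun u => u ^ s) v)
    (hq : ∀ i, B.val i = 0 → inner ℝ (B.basis i) q = 0)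
    (hΘ : ‖A.regPow a (-(1 / 2)) q‖ ≤ Θ)
    (hf : ∀ i, inner ℝ (B.basis i) f = φ (B.val i) * inner ℝ (B.basis i) (q + T' fH)) :
    ‖A.regPow a (1 / 2) (f - fH)‖ ≤ 2 * b * (1 + a ^ (-(1 / 2) : ℝ) * Ψ) ^ 2 * Θ +
      4 * (G + 1 + b) * a ^ (s + 1 / 2) * (1 + a ^ (-(1 / 2) : ℝ) * Ψ) ^ 3 * ‖v‖ := by
  set K := 1 + a ^ (-(1 / 2) : ℝ) * Ψ with hK
  have hK1 : 1 ≤ K := le_add_of_nonneg_right (by positivity)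
  have hK0 : 0 ≤ K := by linarith
  have hhalf := A.norm_regPow_half_le B ha hΨ0 hΨ
  have hone := A.norm_regPow_one_le B ha hΨ0 hΨ
  rw [← hK] at hhalf hone
  -- The value of the filter function at `0` plays no role: it is replaced by `0`.
  let φ₀ : ℝ → ℝ := fun u => if u = 0 then 0 else φ u
  have hφ₀ : ∀ u, 0 ≤ u → u ≤ c' → |φ₀ u| ≤ b / a := by
    intro u h0 h1
    by_cases hu : u = 0
    · simp only [φ₀, hu, if_true, abs_zero]; positivity
    · simpa [φ₀, hu] using hφ1 u (lt_of_le_of_ne h0 (Ne.symm hu)) h1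
  have hbφ : BddOnIcc c' φ₀ := ⟨_, hφ₀⟩
  have hbφ2 : BddOnIcc c' fun u => φ₀ u * u := hbφ.mul BddOnIcc.id
  have hbρ : BddOnIcc c' fun u => 1 - φ₀ u * u := (BddOnIcc.const 1).sub hbφ2
  have hdec : f - fH = B.fn φ₀ q - B.fn (fun u => 1 - φ₀ u * u) fH := by
    refine B.basis.ext_inner fun i => ?_
    rw [inner_sub_right, inner_sub_right, B.inner_fn hbφ, B.inner_fn hbρ, hf, inner_add_right,
      B.inner_apply]
    by_cases hi : B.val i = 0
    · simp [hi, φ₀, hq i hi]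
    · simp only [φ₀, hi, if_false]
      ring
  have hterm1 : ‖A.regPow a (1 / 2) (B.fn φ₀ q)‖ ≤ 2 * b * K ^ 2 * Θ := by
    have h1 := hhalf (B.fn φ₀ q)
    have h2 : ‖B.regPow a (1 / 2) (B.fn φ₀ q)‖ ≤ 2 * b * ‖B.regPow a (-(1 / 2)) q‖ := by
      rw [regPow, B.fn_fn (BddOnIcc.add_rpow ha _) hbφ]
      refine B.norm_fn_le ((BddOnIcc.add_rpow ha _).mul hbφ) (BddOnIcc.add_rpow ha _)
        (by positivity) ?_ q
      intro u h0 h1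
      have hua : 0 < u + a := by linarith
      have hpow : (u + a) ^ (1 / 2 : ℝ) = (u + a) * (u + a) ^ (-(1 / 2) : ℝ) := by
        rw [← Real.rpow_one_add' hua.le (by norm_num)]
        norm_num
      have hbase : |(u + a) * φ₀ u| ≤ 2 * b := by
        by_cases hu : u = 0
        · simp only [φ₀, hu, if_true, mul_zero, abs_zero]; positivity
        · have hu' := lt_of_le_of_ne h0 (Ne.symm hu)
          simp only [φ₀, hu, if_false]
          have e1 := hφ1 u hu' h1
          have e2 := hφ2 u hu' h1
          rw [le_div_iff₀ ha] at e1
          rw [abs_mul, abs_of_pos hu'] at e2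
          rw [abs_mul, abs_of_pos hua]
          nlinarith
      calc |(u + a) ^ (1 / 2 : ℝ) * φ₀ u| = |(u + a) * φ₀ u| * |(u + a) ^ (-(1 / 2) : ℝ)| := by
            rw [hpow, ← abs_mul]; ring_nf
        _ ≤ _ := by gcongr
    have h3 := A.norm_regPow_neg_half_le B ha hK0 hhalf q
    calc _ ≤ K * (2 * b * (K * Θ)) := by
          refine h1.trans ?_
          gcongr
          refine h2.trans ?_
          gcongr
          exact h3.trans (by gcongr)
      _ = _ := by ring
  have hterm2 : ‖A.regPow a (1 / 2) (B.fn (fun u => 1 - φ₀ u * u) fH)‖ ≤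
      4 * (G + 1 + b) * a ^ (s + 1 / 2) * K ^ 3 * ‖v‖ := by
    have h1 := hhalf (B.fn (fun u => 1 - φ₀ u * u) fH)
    set z := B.regPow a (-s) fH with hz
    have hfz : fH = B.regPow a s z := by
      rw [hz, B.regPow_regPow ha, add_neg_cancel, B.regPow_zero ha]
    have hzn : ‖z‖ ≤ K ^ 2 * ‖v‖ := by
      have hH := A.norm_regPow_le_of_norm_regPow_one_le B ha (by positivity) hone hs0 hs1
      have h2 := A.norm_regPow_neg_rpow_le B ha (by positivity) hs0 hH v
      rw [hz, hfH]
      refine h2.trans ?_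
      gcongr
      calc (K ^ 2) ^ s ≤ (K ^ 2) ^ (1 : ℝ) :=
            Real.rpow_le_rpow_of_exponent_le (one_le_pow₀ hK1) hs1
        _ = K ^ 2 := Real.rpow_one _
    have h2 : ‖B.regPow a (1 / 2) (B.fn (fun u => 1 - φ₀ u * u) fH)‖ ≤
        4 * (G + 1 + b) * a ^ (s + 1 / 2) * ‖z‖ := by
      rw [hfz, regPow, regPow, B.fn_fn hbρ (BddOnIcc.add_rpow ha _),
        B.fn_fn (BddOnIcc.add_rpow ha _) (hbρ.mul (BddOnIcc.add_rpow ha _))]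
      refine B.norm_fn_le' (by positivity) ?_ z
      intro u h0 h1
      have hua : 0 < u + a := by linarith
      have e0 : |(u + a) ^ (1 / 2 : ℝ) * ((1 - φ₀ u * u) * (u + a) ^ s)| =
          |1 - φ₀ u * u| * (u + a) ^ (s + 1 / 2) := by
        rw [abs_mul, abs_mul, abs_of_nonneg (by positivity : 0 ≤ (u + a) ^ (1 / 2 : ℝ)),
          abs_of_nonneg (by positivity : 0 ≤ (u + a) ^ s), Real.rpow_add hua]
        ring
      rw [e0]
      have hap : 0 < a ^ (s + 1 / 2) := by positivity
      by_cases hu : u = 0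
      · simp only [φ₀, hu, if_true, mul_zero, sub_zero, abs_one, one_mul, zero_add]
        nlinarith
      · have hu' := lt_of_le_of_ne h0 (Ne.symm hu)
        simp only [φ₀, hu, if_false]
        have e1 := hφ3 u hu' h1
        have e2 : |1 - φ u * u| ≤ 1 + b := by
          refine (abs_sub _ _).trans ?_
          rw [abs_one]
          linarith [hφ2 u hu' h1]
        have e3 : (u + a) ^ (s + 1 / 2) ≤ 4 * (u ^ (s + 1 / 2) + a ^ (s + 1 / 2)) := by
          have hmax : u + a ≤ 2 * max u a := by
            linarith [le_max_left u a, le_max_right u a]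
          have hm0 : 0 < max u a := lt_max_of_lt_right ha
          calc (u + a) ^ (s + 1 / 2) ≤ (2 * max u a) ^ (s + 1 / 2) := by gcongr
            _ = 2 ^ (s + 1 / 2) * (max u a) ^ (s + 1 / 2) := by
                rw [Real.mul_rpow (by norm_num) hm0.le]
            _ ≤ 4 * (u ^ (s + 1 / 2) + a ^ (s + 1 / 2)) := by
                gcongr
                · calc (2 : ℝ) ^ (s + 1 / 2) ≤ 2 ^ (2 : ℝ) :=
                        Real.rpow_le_rpow_of_exponent_le (by norm_num) (by linarith)
                    _ = 4 := by norm_num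
                · have hu0 : 0 ≤ u ^ (s + 1 / 2) := by positivity
                  rcases max_choice u a with hm | hm <;> rw [hm] <;> linarith
        calc |1 - φ u * u| * (u + a) ^ (s + 1 / 2)
            ≤ |1 - φ u * u| * (4 * (u ^ (s + 1 / 2) + a ^ (s + 1 / 2))) := by gcongr
          _ = 4 * (|1 - φ u * u| * u ^ (s + 1 / 2) + |1 - φ u * u| * a ^ (s + 1 / 2)) := by ring
          _ ≤ 4 * (G * a ^ (s + 1 / 2) + (1 + b) * a ^ (s + 1 / 2)) := by gcongr
          _ = _ := by ring
    calc _ ≤ K * (4 * (G + 1 + b) * a ^ (s + 1 / 2) * (K ^ 2 * ‖v‖)) := by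
          refine h1.trans ?_
          gcongr
          exact h2.trans (by gcongr)
      _ = _ := by ring
  rw [hdec, map_sub]
  exact (norm_sub_le _ _).trans (add_le_add hterm1 hterm2)

end EigenSystem

end ErrorBound

/-! ### Bernstein's inequality in a Hilbert space -/

section Cosh

/-- `cosh (√q)` is a power series in `q` with nonnegative coefficients, hence convex in `q ≥ 0`. -/
theorem cosh_le_of_sq_eq {x p m θ : ℝ} (h0 : 0 ≤ θ) (h1 : θ ≤ 1)
    (h : x ^ 2 = θ * p ^ 2 + (1 - θ) * m ^ 2) :
    Real.cosh x ≤ θ * Real.cosh p + (1 - θ) * Real.cosh m := by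
  refine hasSum_le (fun n => ?_) (Real.hasSum_cosh x)
    (((Real.hasSum_cosh p).mul_left θ).add ((Real.hasSum_cosh m).mul_left (1 - θ)))
  have hc := (convexOn_pow (𝕜 := ℝ) n).2 (Set.mem_Ici.2 (sq_nonneg p)) (Set.mem_Ici.2 (sq_nonneg m))
    h0 (sub_nonneg.2 h1) (by ring)
  simp only [smul_eq_mul, ← h, ← pow_mul] at hc
  rw [← mul_div_assoc, ← mul_div_assoc, ← add_div]
  gcongr

variable {E : Type*} [NormedAddCommGroup E] [InnerProductSpace ℝ E]

/-- The one-step inequality behind the concentration of sums in a Hilbert space: up to a term that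
is linear in `y`, `cosh ‖x + y‖` is at most `cosh ‖x‖ (e ^ ‖y‖ - ‖y‖)`. -/
theorem cosh_norm_add_le (x y : E) :
    Real.cosh ‖x + y‖ ≤ Real.cosh ‖x‖ * (Real.exp ‖y‖ - ‖y‖) +
      Real.sinh ‖x‖ / ‖x‖ * inner ℝ x y := by
  set a := ‖x‖ with ha
  set h := ‖y‖ with hh
  set c := inner ℝ x y with hc
  have ha0 : 0 ≤ a := norm_nonneg _
  have hh0 : 0 ≤ h := norm_nonneg _
  have hsh : h ≤ Real.sinh h := Real.self_le_sinh_iff.2 hh0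
  have hexp : Real.exp h = Real.cosh h + Real.sinh h := (Real.cosh_add_sinh h).symm
  rcases ha0.eq_or_lt with h0 | hapos
  · have hx : x = 0 := norm_eq_zero.1 (ha ▸ h0.symm)
    rw [hx, zero_add, ← hh, ← h0]
    simp only [Real.cosh_zero, Real.sinh_zero, zero_div, zero_mul, one_mul, add_zero]
    linarith
  rcases hh0.eq_or_lt with h0 | hhpos
  · have hy : y = 0 := norm_eq_zero.1 (hh ▸ h0.symm)
    rw [hc, hy, add_zero, ← ha, ← h0]
    simp
  have hcabs : |c| ≤ a * h := abs_real_inner_le_norm x y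
  have hah : 0 < a * h := by positivity
  obtain ⟨hc1, hc2⟩ := abs_le.1 hcabs
  have hchord := cosh_le_of_sq_eq (x := ‖x + y‖) (p := a + h) (m := a - h)
    (θ := (1 + c / (a * h)) / 2)
    (by
      have : -1 ≤ c / (a * h) := by rw [le_div_iff₀ hah]; linarith
      linarith)
    (by
      have : c / (a * h) ≤ 1 := by rw [div_le_one hah]; exact hc2
      linarith)
    (by
      rw [norm_add_sq_real, ← ha, ← hh, ← hc]
      field_simp
      ring)
  rw [Real.cosh_add, Real.cosh_sub] at hchord
  have hs : Real.sinh a * Real.sinh h * (c / (a * h)) ≤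
      Real.sinh a / a * c + Real.cosh a * (Real.sinh h - h) := by
    have hsa : 0 ≤ Real.sinh a := Real.sinh_nonneg_iff.2 ha0
    have e1 : Real.sinh a * Real.sinh h * (c / (a * h)) =
        Real.sinh a / a * c + Real.sinh a * (c / (a * h)) * (Real.sinh h - h) := by
      field_simp
      ring
    have e2 : c / (a * h) ≤ 1 := by rw [div_le_one hah]; exact hc2
    have e3 : Real.sinh a * (c / (a * h)) ≤ Real.cosh a :=
      (mul_le_of_le_one_right hsa e2).trans (Real.sinh_lt_cosh a).le
    rw [e1]
    have := mul_le_mul_of_nonneg_right e3 (sub_nonneg.2 hsh)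
    linarith
  calc Real.cosh ‖x + y‖ ≤ _ := hchord
    _ = Real.cosh a * Real.cosh h + Real.sinh a * Real.sinh h * (c / (a * h)) := by ring
    _ ≤ _ := by rw [hexp]; linarith

end Cosh

section Concentration

variable {Ω : Type*} [MeasurableSpace Ω] {P : Measure Ω} [IsProbabilityMeasure P]

/-- Bernstein's moment condition bounds `E (e ^ (t h) - t h)`; stated for `t B ≤ 1/2`. -/
theorem lintegral_exp_sub_le {h : Ω → ℝ} (hm : Measurable h) (h0 : ∀ ω, 0 ≤ h ω) {B V t : ℝ}
    (hB : 0 ≤ B) (ht : 0 ≤ t) (htB : t * B ≤ 1 / 2)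
    (hmom : ∀ p : ℕ, 2 ≤ p → ∫⁻ ω, ENNReal.ofReal (h ω ^ p) ∂P ≤
      ENNReal.ofReal (1 / 2 * p.factorial * B ^ (p - 2) * V ^ 2)) :
    ∫⁻ ω, ENNReal.ofReal (Real.exp (t * h ω) - t * h ω) ∂P ≤
      ENNReal.ofReal (1 + (t * V) ^ 2) := by
  have hser : ∀ ω, ENNReal.ofReal (Real.exp (t * h ω) - t * h ω) =
      1 + ∑' p : ℕ, ENNReal.ofReal (t ^ (p + 2) / (p + 2).factorial) *
        ENNReal.ofReal (h ω ^ (p + 2)) := by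
    intro ω
    have hth : 0 ≤ t * h ω := mul_nonneg ht (h0 ω)
    have hs : HasSum (fun n : ℕ => (t * h ω) ^ n / n.factorial) (Real.exp (t * h ω)) := by
      rw [Real.exp_eq_exp_ℝ]
      exact NormedSpace.expSeries_div_hasSum_exp (t * h ω)
    have hs2 := (hasSum_nat_add_iff' 2).2 hs
    have e : Real.exp (t * h ω) - t * h ω =
        1 + ∑' p : ℕ, (t * h ω) ^ (p + 2) / (p + 2).factorial := by
      rw [hs2.tsum_eq]
      simp [Finset.sum_range_succ]
      ring
    rw [e, ENNReal.ofReal_add zero_le_one (tsum_nonneg fun p => by positivity), ENNReal.ofReal_one,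
      ENNReal.ofReal_tsum_of_nonneg (fun p => by positivity) hs2.summable]
    congr 1
    refine tsum_congr fun p => ?_
    rw [← ENNReal.ofReal_mul (by positivity), mul_pow]
    congr 1
    ring
  simp_rw [hser]
  rw [lintegral_add_left measurable_const, lintegral_const, measure_univ, mul_one,
    lintegral_tsum fun p => by fun_prop, ENNReal.ofReal_add zero_le_one (by positivity),
    ENNReal.ofReal_one]
  gcongr
  calc ∑' p : ℕ, ∫⁻ ω, ENNReal.ofReal (t ^ (p + 2) / (p + 2).factorial) *
        ENNReal.ofReal (h ω ^ (p + 2)) ∂P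
      ≤ ∑' p : ℕ, ENNReal.ofReal ((t * V) ^ 2 / 2 * (1 / 2) ^ p) := by
        refine ENNReal.tsum_le_tsum fun p => ?_
        rw [lintegral_const_mul _ (by fun_prop)]
        refine (mul_le_mul_right (hmom (p + 2) (by omega)) _).trans ?_
        rw [← ENNReal.ofReal_mul (by positivity)]
        refine ENNReal.ofReal_le_ofReal ?_
        have hf : (0 : ℝ) < (p + 2).factorial := by positivity
        have : t ^ (p + 2) / (p + 2).factorial *
            (1 / 2 * (p + 2).factorial * B ^ (p + 2 - 2) * V ^ 2) =
            (t * V) ^ 2 / 2 * (t * B) ^ p := by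
          rw [Nat.add_sub_cancel, pow_add, mul_pow, mul_pow]
          field_simp
        rw [this]
        gcongr
    _ = ENNReal.ofReal ((t * V) ^ 2) := by
        have hg : HasSum (fun p : ℕ => (t * V) ^ 2 / 2 * (1 / 2 : ℝ) ^ p)
            ((t * V) ^ 2 / 2 * 2) := by
          have := (hasSum_geometric_of_lt_one (r := (1 / 2 : ℝ)) (by norm_num)
            (by norm_num)).mul_left ((t * V) ^ 2 / 2)
          norm_num at this ⊢
          exact this
        rw [← ENNReal.ofReal_tsum_of_nonneg (fun p => by positivity) hg.summable, hg.tsum_eq]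
        congr 1
        ring

variable {E : Type*} [NormedAddCommGroup E] [InnerProductSpace ℝ E]

/-- Bernstein's moment condition for the vector `ξ` of mean zero; the mean is taken weakly. -/
structure IsBernstein (P : Measure Ω) (ξ : Ω → E) (B V : ℝ) : Prop where
  stronglyMeasurable : StronglyMeasurable ξ
  integrable_inner : ∀ x, Integrable (fun ω => inner ℝ x (ξ ω)) P
  integral_inner : ∀ x, ∫ ω, inner ℝ x (ξ ω) ∂P = 0
  B_nonneg : 0 ≤ B
  moment : ∀ p : ℕ, 2 ≤ p → ∫⁻ ω, ENNReal.ofReal (‖ξ ω‖ ^ p) ∂P ≤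
      ENNReal.ofReal (1 / 2 * p.factorial * B ^ (p - 2) * V ^ 2)

namespace IsBernstein

variable {ξ : Ω → E} {B V : ℝ}

/-- Adding one independent summand to a fixed vector; the linear term of `cosh_norm_add_le` has
mean zero. -/
theorem lintegral_cosh_add_le (hξ : IsBernstein P ξ B V) {t : ℝ} (ht : 0 ≤ t)
    (htB : t * B ≤ 1 / 2) (x : E) :
    ∫⁻ ω, ENNReal.ofReal (Real.cosh ‖x + t • ξ ω‖) ∂P ≤
      ENNReal.ofReal (Real.cosh ‖x‖) * ENNReal.ofReal (1 + (t * V) ^ 2) := by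
  have hmeas : Measurable fun ω => ‖ξ ω‖ := hξ.stronglyMeasurable.norm.measurable
  have hΦ := lintegral_exp_sub_le hmeas (fun _ => norm_nonneg _) hξ.B_nonneg ht htB hξ.moment
  have hnn : ∀ ω, 0 ≤ Real.exp (t * ‖ξ ω‖) - t * ‖ξ ω‖ := fun ω => by
    linarith [Real.add_one_le_exp (t * ‖ξ ω‖)]
  have hint : Integrable (fun ω => Real.exp (t * ‖ξ ω‖) - t * ‖ξ ω‖) P := by
    refine ⟨by fun_prop, ?_⟩
    rw [hasFiniteIntegral_iff_ofReal (Filter.Eventually.of_forall hnn)]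
    exact hΦ.trans_lt ENNReal.ofReal_lt_top
  have hint2 : Integrable (fun ω => Real.sinh ‖x‖ / ‖x‖ * inner ℝ x (t • ξ ω)) P := by
    simp_rw [inner_smul_right]
    exact ((hξ.integrable_inner x).const_mul t).const_mul _
  have hpt : ∀ ω, Real.cosh ‖x + t • ξ ω‖ ≤
      Real.cosh ‖x‖ * (Real.exp (t * ‖ξ ω‖) - t * ‖ξ ω‖) +
        Real.sinh ‖x‖ / ‖x‖ * inner ℝ x (t • ξ ω) := fun ω => by
    have := cosh_norm_add_le x (t • ξ ω)
    rwa [norm_smul, Real.norm_of_nonneg ht] at this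
  have hint3 := (hint.const_mul (Real.cosh ‖x‖)).add hint2
  calc ∫⁻ ω, ENNReal.ofReal (Real.cosh ‖x + t • ξ ω‖) ∂P
      ≤ ∫⁻ ω, ENNReal.ofReal (Real.cosh ‖x‖ * (Real.exp (t * ‖ξ ω‖) - t * ‖ξ ω‖) +
        Real.sinh ‖x‖ / ‖x‖ * inner ℝ x (t • ξ ω)) ∂P :=
        lintegral_mono fun ω => ENNReal.ofReal_le_ofReal (hpt ω)
    _ = ENNReal.ofReal (∫ ω, (Real.cosh ‖x‖ * (Real.exp (t * ‖ξ ω‖) - t * ‖ξ ω‖) +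
        Real.sinh ‖x‖ / ‖x‖ * inner ℝ x (t • ξ ω)) ∂P) :=
        (ofReal_integral_eq_lintegral_ofReal hint3
          (Filter.Eventually.of_forall fun ω => (Real.cosh_pos _).le.trans (hpt ω))).symm
    _ = ENNReal.ofReal (Real.cosh ‖x‖ * ∫ ω, (Real.exp (t * ‖ξ ω‖) - t * ‖ξ ω‖) ∂P) := by
        rw [integral_add (hint.const_mul _) hint2, integral_const_mul, integral_const_mul]
        simp_rw [inner_smul_right]
        rw [integral_const_mul, hξ.integral_inner]
        simp
    _ = ENNReal.ofReal (Real.cosh ‖x‖) *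
          ∫⁻ ω, ENNReal.ofReal (Real.exp (t * ‖ξ ω‖) - t * ‖ξ ω‖) ∂P := by
        rw [ENNReal.ofReal_mul (Real.cosh_pos _).le,
          ofReal_integral_eq_lintegral_ofReal hint (Filter.Eventually.of_forall hnn)]
    _ ≤ _ := by gcongr

theorem lintegral_cosh_sum_le (hξ : IsBernstein P ξ B V) {t : ℝ} (ht : 0 ≤ t)
    (htB : t * B ≤ 1 / 2) (n : ℕ) :
    ∫⁻ ω : Fin n → Ω, ENNReal.ofReal (Real.cosh ‖∑ i, t • ξ (ω i)‖) ∂Measure.pi (fun _ => P) ≤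
      ENNReal.ofReal (1 + (t * V) ^ 2) ^ n := by
  induction n with
  | zero => simp
  | succ n ih =>
    have hmp := (measurePreserving_piFinSuccAbove (fun _ : Fin (n + 1) => P) 0).symm
    have hsm : StronglyMeasurable fun z : Fin n → Ω => ∑ i, t • ξ (z i) :=
      Finset.stronglyMeasurable_fun_sum _ fun i _ =>
        (hξ.stronglyMeasurable.comp_measurable (measurable_pi_apply i)).const_smul t
    have hm2 : Measurable fun z : Ω × (Fin n → Ω) =>
        ENNReal.ofReal (Real.cosh ‖∑ i, t • ξ (z.2 i) + t • ξ z.1‖) := by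
      have : StronglyMeasurable fun z : Ω × (Fin n → Ω) => ∑ i, t • ξ (z.2 i) + t • ξ z.1 :=
        (hsm.comp_measurable measurable_snd).add
          ((hξ.stronglyMeasurable.comp_measurable measurable_fst).const_smul t)
      have := this.norm.measurable
      fun_prop
    rw [← hmp.lintegral_comp_emb (MeasurableEquiv.measurableEmbedding _)]
    calc _ = ∫⁻ z : Ω × (Fin n → Ω),
          ENNReal.ofReal (Real.cosh ‖∑ i, t • ξ (z.2 i) + t • ξ z.1‖)
            ∂(P.prod (Measure.pi fun _ => P)) := by
          refine lintegral_congr fun z => ?_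
          congr 3
          rw [Fin.sum_univ_succ, add_comm]
          rfl
      _ = ∫⁻ z' : Fin n → Ω, ∫⁻ ω, ENNReal.ofReal (Real.cosh ‖∑ i, t • ξ (z' i) + t • ξ ω‖) ∂P
            ∂(Measure.pi fun _ => P) := lintegral_prod_symm' _ hm2
      _ ≤ ∫⁻ z' : Fin n → Ω, ENNReal.ofReal (Real.cosh ‖∑ i, t • ξ (z' i)‖) *
            ENNReal.ofReal (1 + (t * V) ^ 2) ∂(Measure.pi fun _ => P) :=
          lintegral_mono fun z' => hξ.lintegral_cosh_add_le ht htB _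
      _ ≤ _ := by
          rw [lintegral_mul_const' _ _ ENNReal.ofReal_ne_top, pow_succ]
          exact mul_le_mul' ih le_rfl

/-- **Bernstein's inequality in a Hilbert space**, in the form in which the tail bound is at
most `δ / 3` for the deviation `2 log (12 / δ) (2 B / n + V / √n)`. -/
theorem measure_le (hξ : IsBernstein P ξ B V) (hB : 0 < B) (hV : 0 < V) {n : ℕ} (hn : 1 ≤ n)
    {δ : ℝ} (hδ0 : 0 < δ) (hδ1 : δ < 1) :
    Measure.pi (fun _ : Fin n => P) {ω | ¬ ‖(1 / (n : ℝ)) • ∑ i, ξ (ω i)‖ ≤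
      2 * Real.log (12 / δ) * (2 * B / n + V / √n)} ≤ ENNReal.ofReal (δ / 3) := by
  have hn0 : (0 : ℝ) < n := by exact_mod_cast hn
  have hsn : 0 < √(n : ℝ) := Real.sqrt_pos.2 hn0
  set ℓ := Real.log (12 / δ) with hℓ
  have hℓ0 : 0 < ℓ := Real.log_pos (by rw [lt_div_iff₀ hδ0]; linarith)
  set D := 2 * B + V * √n with hD
  have hD0 : 0 < D := by positivity
  set t := 1 / D with ht
  have ht0 : 0 < t := by positivity
  have htB : t * B ≤ 1 / 2 := by
    rw [ht, div_mul_eq_mul_div, one_mul, div_le_iff₀ hD0, hD]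
    nlinarith [mul_pos hV hsn]
  have htV : n * (t * V) ^ 2 ≤ 1 := by
    have h1 : t * (V * √n) ≤ 1 := by
      rw [ht, div_mul_eq_mul_div, one_mul, div_le_one hD0, hD]
      linarith
    have h2 : n * (t * V) ^ 2 = (t * (V * √n)) ^ 2 := by
      rw [mul_pow, mul_pow, mul_pow, Real.sq_sqrt hn0.le]; ring
    rw [h2]
    exact pow_le_one₀ (by positivity) h1
  have hmain := hξ.lintegral_cosh_sum_le ht0.le htB n
  have hbound : ENNReal.ofReal (1 + (t * V) ^ 2) ^ n ≤ ENNReal.ofReal (Real.exp 1) := by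
    rw [← ENNReal.ofReal_pow (by positivity)]
    refine ENNReal.ofReal_le_ofReal ?_
    calc (1 + (t * V) ^ 2) ^ n ≤ Real.exp ((t * V) ^ 2) ^ n := by
          gcongr
          linarith [Real.add_one_le_exp ((t * V) ^ 2)]
      _ = Real.exp (n * (t * V) ^ 2) := by rw [← Real.exp_nat_mul]
      _ ≤ Real.exp 1 := Real.exp_le_exp.2 htV
  have hmeas : Measurable fun ω : Fin n → Ω =>
      ENNReal.ofReal (Real.cosh ‖∑ i, t • ξ (ω i)‖) := by
    have : StronglyMeasurable fun z : Fin n → Ω => ∑ i, t • ξ (z i) :=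
      Finset.stronglyMeasurable_fun_sum _ fun i _ =>
        (hξ.stronglyMeasurable.comp_measurable (measurable_pi_apply i)).const_smul t
    have := this.norm.measurable
    fun_prop
  have hsub : {ω : Fin n → Ω | ¬ ‖(1 / (n : ℝ)) • ∑ i, ξ (ω i)‖ ≤ 2 * ℓ * (2 * B / n + V / √n)} ⊆
      {ω | ENNReal.ofReal (Real.exp (2 * ℓ) / 2) ≤
        ENNReal.ofReal (Real.cosh ‖∑ i, t • ξ (ω i)‖)} := by
    intro ω hω
    simp only [Set.mem_ofPred_eq, not_le] at hω ⊢
    refine ENNReal.ofReal_le_ofReal ?_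
    rw [← Finset.smul_sum]
    rw [norm_smul, Real.norm_of_nonneg (by positivity)] at hω ⊢
    have e : 2 * B / n + V / √n = D / n := by
      rw [hD, add_div, mul_div_assoc V, Real.sqrt_div_self']
      ring
    rw [e, ← mul_div_assoc, one_div, ← div_eq_inv_mul, div_lt_div_iff_of_pos_right hn0] at hω
    have h2 : 2 * ℓ ≤ t * ‖∑ i, ξ (ω i)‖ := by
      rw [ht, div_mul_eq_mul_div, one_mul, le_div_iff₀ hD0]
      exact hω.le
    rw [Real.cosh_eq]
    have := Real.exp_le_exp.2 h2
    have := Real.exp_pos (-(t * ‖∑ i, ξ (ω i)‖))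
    linarith
  refine (measure_mono hsub).trans ?_
  have hε : ENNReal.ofReal (Real.exp (2 * ℓ) / 2) ≠ 0 := by
    simp only [ne_eq, ENNReal.ofReal_eq_zero, not_le]
    positivity
  refine (meas_ge_le_lintegral_div hmeas.aemeasurable hε ENNReal.ofReal_ne_top).trans ?_
  refine (ENNReal.div_le_div_right (hmain.trans hbound) _).trans ?_
  rw [← ENNReal.ofReal_div_of_pos (by positivity)]
  refine ENNReal.ofReal_le_ofReal ?_
  have he : Real.exp (2 * ℓ) = (12 / δ) ^ 2 := by
    rw [two_mul, Real.exp_add, hℓ, Real.exp_log (by positivity)]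
    ring
  rw [he, div_div_eq_mul_div, div_le_iff₀ (by positivity)]
  have h3 := Real.exp_one_lt_d9
  have : δ / 3 * (12 / δ) ^ 2 = 48 / δ := by field_simp; norm_num
  rw [this, le_div_iff₀ hδ0]
  nlinarith

end IsBernstein

end Concentration

/-! ### The reproducing kernel Hilbert space -/

section Separable

theorem HilbertBasis.countable {E : Type*} [NormedAddCommGroup E] [InnerProductSpace ℝ E]
    [TopologicalSpace.SeparableSpace E] {ι : Type*} (t : HilbertBasis ι ℝ E) : Countable ι := by
  have hd : Pairwise (Function.onFun Disjoint fun i => Metric.ball (t i) (1 / 2)) := by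
    intro i j hij
    refine Metric.ball_disjoint_ball ?_
    have h : ‖t i - t j‖ ^ 2 = 2 := by
      rw [norm_sub_sq_real, t.orthonormal.1 i, t.orthonormal.1 j, t.orthonormal.2 hij]
      norm_num
    rw [dist_eq_norm]
    nlinarith [norm_nonneg (t i - t j)]
  exact hd.countable_of_isOpen_disjoint (fun i => Metric.isOpen_ball)
    (fun i => ⟨t i, Metric.mem_ball_self (by norm_num)⟩)

end Separable

section KernelVector

variable {X : Type*} (H : Type*) [NormedAddCommGroup H] [InnerProductSpace ℝ H]
  [CompleteSpace H] [RKHS ℝ H X ℝ]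

/-- The element `K_x` of the reproducing kernel Hilbert space `H`. -/
def kerVec (x : X) : H := RKHS.kerFun H x (1 : ℝ)

variable {H}

theorem inner_kerVec_left (x : X) (f : H) : inner ℝ (kerVec H x) f = f x := by
  rw [kerVec, RKHS.kerFun_inner]
  simp

theorem inner_kerVec_right (x : X) (f : H) : inner ℝ f (kerVec H x) = f x := by
  rw [real_inner_comm, inner_kerVec_left]

end KernelVector

namespace MercerKernel.IsKernelOf

variable {X : Type*} [MetricSpace X] {K : MercerKernel X}
  {H : Type*} [NormedAddCommGroup H] [InnerProductSpace ℝ H] [CompleteSpace H] [RKHS ℝ H X ℝ]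

theorem kerVec_apply (hK : K.IsKernelOf H) (x y : X) : kerVec H x y = K.toFun x y := by
  rw [kerVec, RKHS.kerFun_apply, hK, K.symm]

theorem inner_kerVec (hK : K.IsKernelOf H) (x y : X) :
    inner ℝ (kerVec H x) (kerVec H y) = K.toFun x y := by
  rw [inner_kerVec_right, hK.kerVec_apply]

theorem continuous_kerVec (hK : K.IsKernelOf H) : Continuous (kerVec H : X → H) := by
  have hc : ∀ {f g : X → X}, Continuous f → Continuous g →
      Continuous fun x => K.toFun (f x) (g x) :=
    fun hf hg => K.continuous_uncurry.comp (hf.prodMk hg)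
  rw [continuous_iff_continuousAt]
  intro x
  rw [ContinuousAt, tendsto_iff_norm_sub_tendsto_zero]
  have h : ∀ y, ‖kerVec H y - kerVec H x‖ =
      √(K.toFun y y - 2 * K.toFun y x + K.toFun x x) := fun y => by
    rw [← Real.sqrt_sq (norm_nonneg (kerVec H y - kerVec H x)), norm_sub_sq_real,
      ← real_inner_self_eq_norm_sq, ← real_inner_self_eq_norm_sq, hK.inner_kerVec, hK.inner_kerVec,
      hK.inner_kerVec]
  simp_rw [h]
  have hcont : Continuous fun y => √(K.toFun y y - 2 * K.toFun y x + K.toFun x x) :=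
    (((hc continuous_id continuous_id).sub ((hc continuous_id continuous_const).const_mul 2)).add
      continuous_const).sqrt
  have := hcont.tendsto x
  rwa [show K.toFun x x - 2 * K.toFun x x + K.toFun x x = 0 by ring, Real.sqrt_zero] at this

theorem norm_kerVec_le (hK : K.IsKernelOf H) {κ : ℝ} (hκ0 : 0 ≤ κ)
    (hκ : ∀ x, K.toFun x x ≤ κ ^ 2) (x : X) : ‖kerVec H x‖ ≤ κ := by
  refine le_of_sq_le_sq ?_ hκ0
  rw [← real_inner_self_eq_norm_sq, hK.inner_kerVec]
  exact hκ x

theorem separableSpace [CompactSpace X] (hK : K.IsKernelOf H) :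
    TopologicalSpace.SeparableSpace H := by
  have h1 : TopologicalSpace.IsSeparable (Set.range (kerVec H : X → H)) :=
    (isCompact_range hK.continuous_kerVec).isSeparable
  have h2 := (h1.span (R := ℝ)).closure
  have h3 : closure (Submodule.span ℝ (Set.range (kerVec H : X → H)) : Set H) = Set.univ := by
    rw [← Submodule.topologicalClosure_coe]
    have := RKHS.kerFun_dense (𝕜 := ℝ) (X := X) (V := ℝ) H
    have hle : Submodule.span ℝ {RKHS.kerFun H x v | (x : X) (v : ℝ)} ≤
        Submodule.span ℝ (Set.range (kerVec H : X → H)) := by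
      rw [Submodule.span_le]
      rintro _ ⟨x, v, rfl⟩
      have : RKHS.kerFun H x v = v • kerVec H x := by
        rw [kerVec, ← map_smul, smul_eq_mul, mul_one]
      rw [this]
      exact Submodule.smul_mem _ _ (Submodule.subset_span ⟨x, rfl⟩)
    have h4 := Submodule.topologicalClosure_mono hle
    rw [this, top_le_iff] at h4
    rw [h4]
    rfl
  rw [h3] at h2
  exact TopologicalSpace.isSeparable_univ_iff.1 h2

theorem continuous_apply (hK : K.IsKernelOf H) (f : H) : Continuous (f : X → ℝ) := by
  have h : (f : X → ℝ) = fun x => inner ℝ (kerVec H x) f :=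
    funext fun x => (inner_kerVec_left x f).symm
  rw [h]
  exact hK.continuous_kerVec.inner continuous_const

variable [CompactSpace X] [MeasurableSpace X] [BorelSpace X]

/-- The inclusion of the reproducing kernel Hilbert space into `L²(μ)`. -/
def inclusion (hK : K.IsKernelOf H) (μ : Measure X) [IsProbabilityMeasure μ] :
    H →L[ℝ] Lp ℝ 2 μ :=
  (ContinuousMap.toLp (E := ℝ) 2 μ ℝ : C(X, ℝ) →L[ℝ] Lp ℝ 2 μ).comp
    (σ₁₂ := RingHom.id ℝ) (LinearMap.mkContinuousOfExistsBound
      { toFun := fun f => (⟨f, hK.continuous_apply f⟩ : C(X, ℝ))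
        map_add' := fun f g => by ext x; exact congrFun (RKHS.coe_add f g) x
        map_smul' := fun a f => by ext x; exact congrFun (RKHS.coe_smul f a) x } (by
      obtain ⟨c, hc⟩ := isCompact_univ.exists_bound_of_continuousOn
        hK.continuous_kerVec.continuousOn
      refine ⟨max c 0, fun f => (ContinuousMap.norm_le _ (by positivity)).2 fun x => ?_⟩
      change ‖f x‖ ≤ _
      rw [← inner_kerVec_left]
      refine (norm_inner_le_norm _ _).trans ?_
      gcongr
      exact (hc x trivial).trans (le_max_left _ _)))

variable (hK : K.IsKernelOf H) (μ : Measure X) [IsProbabilityMeasure μ]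

theorem coeFn_inclusion (f : H) : hK.inclusion μ f =ᵐ[μ] f :=
  ContinuousMap.coeFn_toLp (p := 2) (𝕜 := ℝ) μ (⟨f, hK.continuous_apply f⟩ : C(X, ℝ))

theorem inner_inclusion (f : H) (g : Lp ℝ 2 μ) :
    inner ℝ (hK.inclusion μ f) g = ∫ x, f x * g x ∂μ := by
  rw [L2.inner_def]
  refine integral_congr_ae ?_
  filter_upwards [hK.coeFn_inclusion μ f] with x hx
  simp [hx, mul_comm]

theorem inclusion_kerVec (x : X) : hK.inclusion μ (kerVec H x) = K.secLp μ x := by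
  refine congrArg (ContinuousMap.toLp (E := ℝ) 2 μ ℝ) ?_
  ext y
  exact hK.kerVec_apply x y

theorem stronglyMeasurable_kerVec (hK : K.IsKernelOf H) : StronglyMeasurable (kerVec H : X → H) :=
  hK.continuous_kerVec.stronglyMeasurable_of_hasCompactSupport
    (HasCompactSupport.of_compactSpace _)

theorem integrable_smul_kerVec (hK : K.IsKernelOf H) (μ : Measure X) [IsProbabilityMeasure μ]
    {g : X → ℝ} (hg : Integrable g μ) :
    Integrable (fun x => g x • kerVec H x) μ := by
  obtain ⟨c, hc⟩ := isCompact_univ.exists_bound_of_continuousOn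
    hK.continuous_kerVec.continuousOn
  exact hg.smul_bdd c hK.stronglyMeasurable_kerVec.aestronglyMeasurable
    (Filter.Eventually.of_forall fun x => hc x trivial)

theorem adjoint_inclusion (g : Lp ℝ 2 μ) :
    (hK.inclusion μ).adjoint g = ∫ x, g x • kerVec H x ∂μ := by
  have hg : Integrable g μ := (Lp.memLp g).integrable (by norm_num)
  refine ext_inner_left ℝ fun f => ?_
  rw [ContinuousLinearMap.adjoint_inner_right, hK.inner_inclusion,
    ← integral_inner (hK.integrable_smul_kerVec μ hg)]
  refine integral_congr_ae (Filter.Eventually.of_forall fun x => ?_)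
  simp only
  rw [inner_smul_right, inner_kerVec_right, mul_comm]

theorem integralOp_eq : K.integralOp μ = hK.inclusion μ ∘L (hK.inclusion μ).adjoint := by
  ext1 g
  have hg : Integrable g μ := (Lp.memLp g).integrable (by norm_num)
  rw [ContinuousLinearMap.comp_apply, hK.adjoint_inclusion,
    ← ContinuousLinearMap.integral_comp_comm _ (hK.integrable_smul_kerVec μ hg)]
  simp_rw [map_smul, hK.inclusion_kerVec]
  rfl

/-- The covariance operator `f ↦ ∫ f(x) K_x dμ` on the reproducing kernel Hilbert space. -/
def covOp : H →L[ℝ] H := (hK.inclusion μ).adjoint ∘L hK.inclusion μ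

theorem norm_inclusion_sq (f : H) : ‖hK.inclusion μ f‖ ^ 2 = inner ℝ f (hK.covOp μ f) := by
  rw [covOp, ContinuousLinearMap.comp_apply, ContinuousLinearMap.adjoint_inner_right,
    real_inner_self_eq_norm_sq]

theorem inner_covOp (f h : H) : inner ℝ f (hK.covOp μ h) = ∫ x, f x * h x ∂μ := by
  rw [covOp, ContinuousLinearMap.comp_apply, ContinuousLinearMap.adjoint_inner_right,
    hK.inner_inclusion]
  refine integral_congr_ae ?_
  filter_upwards [hK.coeFn_inclusion μ h] with x hx
  rw [hx]

theorem isPositive_covOp : (hK.covOp μ).IsPositive :=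
  ContinuousLinearMap.isPositive_adjoint_comp_self _

/-- The covariance operator is an average of rank one operators, and the compact operators form a
closed convex set. -/
theorem isCompactOperator_covOp : IsCompactOperator (hK.covOp μ) := by
  let R : X → H →L[ℝ] H := fun x => (innerSL ℝ (kerVec H x)).smulRight (kerVec H x)
  have hcont : Continuous R := by
    have h1 : Continuous fun x => innerSL ℝ (kerVec H x) :=
      (innerSL ℝ).continuous.comp hK.continuous_kerVec
    exact ((ContinuousLinearMap.smulRightL ℝ H H).continuous₂).comp
      (h1.prodMk hK.continuous_kerVec)
  have hint : Integrable R μ :=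
    hcont.integrable_of_hasCompactSupport (HasCompactSupport.of_compactSpace _)
  have heq : hK.covOp μ = ∫ x, R x ∂μ := by
    ext1 f
    rw [ContinuousLinearMap.integral_apply hint]
    rw [covOp, ContinuousLinearMap.comp_apply, hK.adjoint_inclusion]
    refine integral_congr_ae ?_
    filter_upwards [hK.coeFn_inclusion μ f] with x hx
    simp only [R, ContinuousLinearMap.smulRight_apply, innerSL_apply_apply]
    rw [hx, inner_kerVec_left]
  rw [heq]
  refine Convex.integral_mem (s := {T : H →L[ℝ] H | IsCompactOperator T}) ?_
    isClosed_setOfPred_isCompactOperator (Filter.Eventually.of_forall fun x => ?_) hint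
  · exact (compactOperator (RingHom.id ℝ) H H).convex
  · have h1 : IsCompactOperator (innerSL ℝ (kerVec H x)) :=
      isCompactOperator_of_locallyCompactSpace_dom _
    exact h1.clm_comp (ContinuousLinearMap.toSpanSingleton ℝ (kerVec H x))

theorem norm_inclusion_le {κ : ℝ} (hκ0 : 0 ≤ κ) (hκ : ∀ x, K.toFun x x ≤ κ ^ 2) (f : H) :
    ‖hK.inclusion μ f‖ ≤ κ * ‖f‖ := by
  have h : ∀ x, ‖f x‖ ≤ κ * ‖f‖ := fun x => by
    rw [← inner_kerVec_left]
    refine (norm_inner_le_norm _ _).trans ?_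
    gcongr
    exact hK.norm_kerVec_le hκ0 hκ x
  have h2 := Lp.norm_le_of_ae_bound (f := hK.inclusion μ f) (C := κ * ‖f‖) (by positivity) (by
    filter_upwards [hK.coeFn_inclusion μ f] with x hx
    rw [hx]
    exact h x)
  simpa [measureUnivNNReal] using h2

theorem norm_covOp_le {κ : ℝ} (hκ0 : 0 ≤ κ) (hκ : ∀ x, K.toFun x x ≤ κ ^ 2) :
    ‖hK.covOp μ‖ ≤ κ ^ 2 := by
  have h : ‖hK.inclusion μ‖ ≤ κ :=
    ContinuousLinearMap.opNorm_le_bound _ hκ0 (hK.norm_inclusion_le μ hκ0 hκ)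
  rw [covOp, ContinuousLinearMap.norm_adjoint_comp_self, sq]
  gcongr

end MercerKernel.IsKernelOf

/-! ### Source condition, effective dimension and empirical operators -/

namespace MercerKernel.IsKernelOf

variable {X : Type*} [MetricSpace X] [CompactSpace X] [MeasurableSpace X] [BorelSpace X]
  {K : MercerKernel X}
  {H : Type*} [NormedAddCommGroup H] [InnerProductSpace ℝ H] [CompleteSpace H] [RKHS ℝ H X ℝ]
  (hK : K.IsKernelOf H) (μ : Measure X) [IsProbabilityMeasure μ]

theorem inner_integralOp (f g : Lp ℝ 2 μ) : inner ℝ f (K.integralOp μ g) =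
    inner ℝ ((hK.inclusion μ).adjoint f) ((hK.inclusion μ).adjoint g) := by
  rw [hK.integralOp_eq, ContinuousLinearMap.comp_apply, ContinuousLinearMap.adjoint_inner_left]

theorem isPositive_integralOp (hK : K.IsKernelOf H) : (K.integralOp μ).IsPositive := by
  rw [hK.integralOp_eq]
  exact ContinuousLinearMap.isPositive_self_comp_adjoint _

theorem norm_integralOp_le (hK : K.IsKernelOf H) {κ : ℝ} (hκ0 : 0 ≤ κ)
    (hκ : ∀ x, K.toFun x x ≤ κ ^ 2) : ‖K.integralOp μ‖ ≤ κ ^ 2 := by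
  have h : ‖hK.inclusion μ‖ ≤ κ :=
    ContinuousLinearMap.opNorm_le_bound _ hκ0 (hK.norm_inclusion_le μ hκ0 hκ)
  rw [hK.integralOp_eq]
  refine (ContinuousLinearMap.opNorm_comp_le _ _).trans ?_
  rw [LinearIsometryEquiv.norm_map, sq]
  gcongr

variable {μ} {ι : Type*} {c : ℝ} (A : EigenSystem (hK.covOp μ) c ι)

theorem inner_inclusion_basis (i j : ι) :
    inner ℝ (hK.inclusion μ (A.basis i)) (hK.inclusion μ (A.basis j)) =
      A.val j * inner ℝ (A.basis i) (A.basis j) := by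
  rw [← ContinuousLinearMap.adjoint_inner_right]
  change inner ℝ (A.basis i) (hK.covOp μ (A.basis j)) = _
  rw [A.apply_basis, inner_smul_right]

/-- The partial isometry of the polar decomposition of the inclusion: any `u ∈ L²(μ)` has
coordinates of square sum at most `‖u‖ ^ 2` in the orthonormal family of the normalized images of
the eigenvectors of the covariance operator. -/
theorem exists_polar (u : Lp ℝ 2 μ) : ∃ v : H, ‖v‖ ≤ ‖u‖ ∧
    ∀ i, A.val i ^ (1 / 2 : ℝ) * inner ℝ (A.basis i) v =
      inner ℝ (hK.inclusion μ (A.basis i)) u := by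
  let S : Set ι := {i | A.val i ≠ 0}
  have hpos : ∀ i : S, 0 < A.val i := fun i => lt_of_le_of_ne (A.val_nonneg i) (Ne.symm i.2)
  let e : S → Lp ℝ 2 μ := fun i => (√(A.val i))⁻¹ • hK.inclusion μ (A.basis i)
  have he : Orthonormal ℝ e := by
    constructor
    · intro i
      have h1 := hK.inner_inclusion_basis A i i
      rw [real_inner_self_eq_norm_sq, real_inner_self_eq_norm_sq, A.basis.orthonormal.1] at h1
      have h2 : ‖hK.inclusion μ (A.basis i)‖ = √(A.val i) := by
        rw [← Real.sqrt_sq (norm_nonneg (hK.inclusion μ (A.basis i))), h1]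
        simp
      have h3 : 0 < √(A.val i) := Real.sqrt_pos.2 (hpos i)
      simp only [e, norm_smul, h2, norm_inv, Real.norm_of_nonneg h3.le]
      exact inv_mul_cancel₀ h3.ne'
    · intro i j hij
      have hij' : (i : ι) ≠ j := fun h => hij (Subtype.ext h)
      simp only [e, inner_smul_left, inner_smul_right, hK.inner_inclusion_basis A,
        A.basis.orthonormal.2 hij', mul_zero]
  classical
  let z : ι → ℝ := S.indicator fun i => (√(A.val i))⁻¹ * inner ℝ (hK.inclusion μ (A.basis i)) u
  have hzS : ∀ i : S, z i = inner ℝ (e i) u := fun i => by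
    simp [z, e, inner_smul_left]
  have hz2 : (fun i => z i ^ 2) = S.indicator fun i => z i ^ 2 := by
    ext i
    by_cases hi : i ∈ S
    · simp [hi]
    · simp [hi, z]
  have hsumS : Summable fun i : S => z i ^ 2 := by
    simpa [hzS] using he.inner_products_summable u
  have hsum : Summable fun i => z i ^ 2 := by
    rw [hz2]
    exact summable_subtype_iff_indicator.1 hsumS
  have hle : ∑' i, z i ^ 2 ≤ ‖u‖ ^ 2 := by
    rw [hz2, ← tsum_subtype S (fun i => z i ^ 2)]
    simpa [hzS] using he.tsum_inner_products_le u
  let v : H := A.basis.repr.symm ⟨z, memℓp_gen (by simpa using hsum)⟩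
  have hv : ∀ i, inner ℝ (A.basis i) v = z i := fun i => by
    rw [← A.basis.repr_apply_apply]
    simp [v]
  refine ⟨v, ?_, fun i => ?_⟩
  · refine le_of_sq_le_sq ?_ (norm_nonneg _)
    rw [← (A.basis.hasSum_sq_inner v).tsum_eq]
    simpa only [hv] using hle
  · rw [hv, ← Real.sqrt_eq_rpow]
    by_cases hi : A.val i = 0
    · have h1 := hK.inner_inclusion_basis A i i
      rw [hi, zero_mul, real_inner_self_eq_norm_sq] at h1
      have h2 : hK.inclusion μ (A.basis i) = 0 := by
        rwa [sq_eq_zero_iff, norm_eq_zero] at h1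
      rw [h2, hi]
      simp
    · have hi' : i ∈ S := hi
      have h3 : 0 < √(A.val i) := Real.sqrt_pos.2 (hpos ⟨i, hi⟩)
      simp only [z, Set.indicator_of_mem hi']
      rw [mul_inv_cancel_left₀ h3.ne']

/-- The source condition in terms of the covariance operator: `L_K ^ r u` is the class of
`T ^ (p - 1/2) v` for some `v`, for any `1/2 ≤ p ≤ r`. -/
theorem exists_source {κ : ℝ} (hκ0 : 0 ≤ κ) (hκ : ∀ x, K.toFun x x ≤ κ ^ 2)
    (A : EigenSystem (hK.covOp μ) (κ ^ 2) ι) {r p : ℝ} (hp : 1 / 2 ≤ p) (hpr : p ≤ r)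
    (u : Lp ℝ 2 μ) : ∃ v : H, ‖v‖ ≤ (κ ^ 2) ^ (r - p) * ‖u‖ ∧
      spectralFun (K.integralOp μ) (fun s => s ^ r) u =
        hK.inclusion μ (A.fn (fun s => s ^ (p - 1 / 2)) v) := by
  obtain ⟨v₀, hv₀, hcoef⟩ := hK.exists_polar A u
  have hrp : 0 ≤ r - p := by linarith
  have hp2 : 0 ≤ p - 1 / 2 := by linarith
  have hr0 : 0 < r := by linarith
  refine ⟨A.fn (fun s => s ^ (r - p)) v₀, ?_, ?_⟩
  · refine (A.norm_fn_le' (C := (κ ^ 2) ^ (r - p)) (by positivity) (fun s h0 h1 => ?_) v₀).trans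
      (by gcongr)
    rw [abs_of_nonneg (by positivity)]
    gcongr
  set w := spectralFun (K.integralOp μ) (fun s => s ^ r) u with hw
  set y := A.fn (fun s => s ^ (p - 1 / 2)) (A.fn (fun s => s ^ (r - p)) v₀) with hy
  have hbd : ∀ l, Module.End.HasEigenvalue (K.integralOp μ : Lp ℝ 2 μ →ₗ[ℝ] Lp ℝ 2 μ) l →
      |l ^ r| ≤ (κ ^ 2) ^ r := fun l hl => by
    obtain ⟨h0, h1⟩ := hasEigenvalue_mem_Icc (hK.isPositive_integralOp μ)
      (hK.norm_integralOp_le μ hκ0 hκ) hl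
    rw [abs_of_nonneg (by positivity)]
    gcongr
  have hspec := fun {e : Lp ℝ 2 μ} {l : ℝ} (he : K.integralOp μ e = l • e) =>
    inner_spectralFun (hK.isPositive_integralOp μ).isSymmetric hbd he u
  rw [← hw] at hspec
  set d := w - hK.inclusion μ y with hd
  have horth : ∀ i, inner ℝ (hK.inclusion μ (A.basis i)) d = 0 := by
    intro i
    have h1 : K.integralOp μ (hK.inclusion μ (A.basis i)) =
        A.val i • hK.inclusion μ (A.basis i) := by
      rw [hK.integralOp_eq, ContinuousLinearMap.comp_apply]
      change hK.inclusion μ (hK.covOp μ (A.basis i)) = _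
      rw [A.apply_basis, map_smul]
    have h2 : inner ℝ (hK.inclusion μ (A.basis i)) (hK.inclusion μ y) =
        A.val i * inner ℝ (A.basis i) y := by
      rw [← ContinuousLinearMap.adjoint_inner_right]
      exact A.inner_apply i y
    rw [hd, inner_sub_right, hspec h1, h2, hy, A.inner_fn (BddOnIcc.rpow hp2),
      A.inner_fn (BddOnIcc.rpow hrp), ← hcoef i]
    rcases (A.val_nonneg i).eq_or_lt with h0 | h0
    · rw [← h0, Real.zero_rpow hr0.ne']
      ring
    · have e : A.val i ^ r * A.val i ^ (1 / 2 : ℝ) =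
          A.val i * (A.val i ^ (p - 1 / 2) * A.val i ^ (r - p)) := by
        rw [← Real.rpow_add h0, ← Real.rpow_add h0, ← Real.rpow_one_add' h0.le (by linarith)]
        congr 1
        ring
      linear_combination (inner ℝ (A.basis i) v₀) * e
  have hadj : (hK.inclusion μ).adjoint d = 0 := by
    refine A.basis.ext_inner fun i => ?_
    rw [ContinuousLinearMap.adjoint_inner_right, horth, inner_zero_right]
  have hd0 : K.integralOp μ d = (0 : ℝ) • d := by
    rw [hK.integralOp_eq, ContinuousLinearMap.comp_apply, hadj, map_zero, zero_smul]
  have h3 := hspec hd0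
  rw [Real.zero_rpow hr0.ne', zero_mul] at h3
  have h4 : inner ℝ d (hK.inclusion μ y) = 0 := by
    rw [← ContinuousLinearMap.adjoint_inner_left, hadj, inner_zero_left]
  have h5 : inner ℝ d d = 0 := by
    conv_lhs => rw [hd, inner_sub_right, ← hd]
    rw [h3, h4, sub_zero]
  exact sub_eq_zero.1 (inner_self_eq_zero.1 h5)

/-- The effective dimension is the mean of `‖(T + a) ^ (-1/2) K_x‖ ^ 2`. -/
theorem effectiveDimension_eq [Countable ι] {a : ℝ} (ha : 0 < a) :
    effectiveDimension K μ a =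
      ∫⁻ x, ENNReal.ofReal (‖A.regPow a (-(1 / 2)) (kerVec H x)‖ ^ 2) ∂μ := by
  set S := A.regPow a (-(1 / 2)) with hS
  set J := hK.inclusion μ with hJ
  have hsymm : ∀ f g, inner ℝ (S f) g = inner ℝ f (S g) := A.inner_regPow_left ha _
  have hunit : IsUnit (a • (1 : Lp ℝ 2 μ →L[ℝ] Lp ℝ 2 μ) + K.integralOp μ) := by
    refine ContinuousLinearMap.isUnit_of_forall_le_norm_inner_map _ (c := a.toNNReal)
      (Real.toNNReal_pos.2 ha) fun f => ?_
    have h1 : inner ℝ ((a • (1 : Lp ℝ 2 μ →L[ℝ] Lp ℝ 2 μ) + K.integralOp μ) f) f =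
        a * ‖f‖ ^ 2 + ‖J.adjoint f‖ ^ 2 := by
      rw [real_inner_comm]
      simp only [add_apply, smul_apply, one_apply_eq_self, inner_add_right, inner_smul_right]
      rw [hK.inner_integralOp, real_inner_self_eq_norm_sq, real_inner_self_eq_norm_sq]
    rw [h1, Real.norm_of_nonneg (by positivity)]
    rw [Real.coe_toNNReal a ha.le]
    nlinarith [sq_nonneg ‖J.adjoint f‖]
  have hinv : Ring.inverse (a • (1 : Lp ℝ 2 μ →L[ℝ] Lp ℝ 2 μ) + K.integralOp μ) * K.integralOp μ =
      J ∘L S ∘L S ∘L J.adjoint := by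
    have h1 : K.integralOp μ = (a • (1 : Lp ℝ 2 μ →L[ℝ] Lp ℝ 2 μ) + K.integralOp μ) *
        (J ∘L S ∘L S ∘L J.adjoint) := by
      ext1 g
      have h2 : hK.covOp μ (S (S (J.adjoint g))) + a • S (S (J.adjoint g)) = J.adjoint g := by
        rw [← A.regPow_one ha, hS, A.regPow_regPow ha, A.regPow_regPow ha]
        norm_num
        exact A.regPow_zero ha _
      have h3 := congrArg J h2
      rw [map_add, map_smul, add_comm] at h3
      have h4 : K.integralOp μ g = J (J.adjoint g) := by rw [hK.integralOp_eq]; rfl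
      have h5 : K.integralOp μ (J (S (S (J.adjoint g)))) =
          J (hK.covOp μ (S (S (J.adjoint g)))) := by rw [hK.integralOp_eq]; rfl
      change _ = a • J (S (S (J.adjoint g))) + K.integralOp μ (J (S (S (J.adjoint g))))
      rw [h4, h5, h3]
    calc _ = Ring.inverse (a • (1 : Lp ℝ 2 μ →L[ℝ] Lp ℝ 2 μ) + K.integralOp μ) *
          ((a • (1 : Lp ℝ 2 μ →L[ℝ] Lp ℝ 2 μ) + K.integralOp μ) *
            (J ∘L S ∘L S ∘L J.adjoint)) := by rw [← h1]
      _ = _ := Ring.inverse_mul_cancel_left _ _ hunit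
  unfold effectiveDimension positiveTrace
  rw [hinv]
  obtain ⟨b, hb⟩ := (exists_hilbertBasis ℝ (Lp ℝ 2 μ)).choose_spec
  have hterm : ∀ e : (exists_hilbertBasis ℝ (Lp ℝ 2 μ)).choose,
      ENNReal.ofReal (inner ℝ (e : Lp ℝ 2 μ) ((J ∘L S ∘L S ∘L J.adjoint) e)) =
        ∑' i, ENNReal.ofReal (inner ℝ (b e) (J (S (A.basis i))) ^ 2) := by
    intro e
    have h1 : inner ℝ (e : Lp ℝ 2 μ) ((J ∘L S ∘L S ∘L J.adjoint) e) =
        ‖S (J.adjoint (e : Lp ℝ 2 μ))‖ ^ 2 := by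
      simp only [ContinuousLinearMap.comp_apply]
      rw [← ContinuousLinearMap.adjoint_inner_left, ← hsymm, real_inner_self_eq_norm_sq]
    have hs := A.basis.hasSum_sq_inner (S (J.adjoint (e : Lp ℝ 2 μ)))
    rw [h1, ← hs.tsum_eq, ENNReal.ofReal_tsum_of_nonneg (fun _ => by positivity) hs.summable]
    refine tsum_congr fun i => ?_
    rw [← hsymm, ContinuousLinearMap.adjoint_inner_right, hb, real_inner_comm]
  simp_rw [hterm]
  rw [ENNReal.tsum_comm]
  have hterm2 : ∀ i, ∑' e, ENNReal.ofReal (inner ℝ (b e) (J (S (A.basis i))) ^ 2) =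
      ∫⁻ x, ENNReal.ofReal (inner ℝ (A.basis i) (S (kerVec H x)) ^ 2) ∂μ := by
    intro i
    have hs := b.hasSum_sq_inner (J (S (A.basis i)))
    rw [← ENNReal.ofReal_tsum_of_nonneg (fun _ => by positivity) hs.summable, hs.tsum_eq,
      hJ, hK.norm_inclusion_sq, hK.inner_covOp, ofReal_integral_eq_lintegral_ofReal]
    · refine lintegral_congr fun x => ?_
      rw [← hsymm, inner_kerVec_right, sq]
    · exact (((hK.continuous_apply _).mul (hK.continuous_apply _))).integrable_of_hasCompactSupport
        (HasCompactSupport.of_compactSpace _)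
    · exact Filter.Eventually.of_forall fun x => mul_self_nonneg _
  simp_rw [hterm2]
  have hSc : Continuous fun x => S (kerVec H x) := S.continuous.comp hK.continuous_kerVec
  rw [← lintegral_tsum fun i => by
    have : Continuous fun x => inner ℝ (A.basis i) (S (kerVec H x)) :=
      continuous_const.inner hSc
    exact (this.pow 2).measurable.ennreal_ofReal.aemeasurable]
  refine lintegral_congr fun x => ?_
  have hs := A.basis.hasSum_sq_inner (S (kerVec H x))
  rw [← ENNReal.ofReal_tsum_of_nonneg (fun _ => by positivity) hs.summable, hs.tsum_eq]

end MercerKernel.IsKernelOf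

section Empirical

variable {X : Type*} {H : Type*} [NormedAddCommGroup H] [InnerProductSpace ℝ H]
  [CompleteSpace H] [RKHS ℝ H X ℝ] {n : ℕ}

theorem inner_samplingOpT_diagOp (x : Fin n → X) (v y : Fin n → ℝ) (f : H) :
    inner ℝ f (samplingOpT H x (diagOp v y)) = 1 / (n : ℝ) * ∑ i, v i * y i * f (x i) := by
  have h1 : ∀ i, diagOp v y i = v i * y i := fun i => by
    simp [diagOp, Matrix.mulVec_diagonal]
  have h2 : samplingOpT H x (diagOp v y) = (1 / (n : ℝ)) • ∑ i, (v i * y i) • kerVec H (x i) := by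
    simp only [samplingOpT, smul_apply, sum_apply,
      ContinuousLinearMap.smulRight_apply, ContinuousLinearMap.proj_apply, h1]
    rfl
  rw [h2, inner_smul_right, inner_sum]
  simp_rw [inner_smul_right, inner_kerVec_right]

/-- The empirical covariance operator `S_Xᵀ diag(v) S_X`. -/
def empOp (H : Type*) [NormedAddCommGroup H] [InnerProductSpace ℝ H]
    [CompleteSpace H] [RKHS ℝ H X ℝ] (x : Fin n → X) (v : Fin n → ℝ) : H →L[ℝ] H :=
  samplingOpT H x ∘L diagOp v ∘L samplingOp H x

theorem empOp_apply (x : Fin n → X) (v : Fin n → ℝ) (f : H) :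
    empOp H x v f = samplingOpT H x (diagOp v fun i => f (x i)) := rfl

theorem inner_empOp (x : Fin n → X) (v : Fin n → ℝ) (f h : H) :
    inner ℝ f (empOp H x v h) = 1 / (n : ℝ) * ∑ i, v i * h (x i) * f (x i) := by
  rw [empOp_apply, inner_samplingOpT_diagOp]

theorem isCompactOperator_empOp (x : Fin n → X) (v : Fin n → ℝ) :
    IsCompactOperator (empOp H x v) := by
  have h1 : IsCompactOperator (diagOp v ∘L samplingOp H x) :=
    isCompactOperator_of_locallyCompactSpace_dom _
  exact h1.clm_comp (samplingOpT H x)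

theorem isPositive_empOp (x : Fin n → X) {v : Fin n → ℝ} (hv : ∀ i, 0 ≤ v i) :
    (empOp H x v).IsPositive := by
  refine (ContinuousLinearMap.isPositive_def' ).2 ⟨?_, fun f => ?_⟩
  · rw [ContinuousLinearMap.isSelfAdjoint_iff_isSymmetric]
    intro f g
    change inner ℝ (empOp H x v f) g = inner ℝ f (empOp H x v g)
    rw [real_inner_comm, inner_empOp, inner_empOp]
    congr 1
    exact Finset.sum_congr rfl fun i _ => by ring
  · rw [ContinuousLinearMap.reApplyInnerSelf_apply, real_inner_comm, inner_empOp]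
    refine mul_nonneg (by positivity) (Finset.sum_nonneg fun i _ => ?_)
    rw [mul_assoc]
    exact mul_nonneg (hv i) (mul_self_nonneg _)

/-- A bound that uses nothing about the weights but that their mean is at most `1`. -/
theorem norm_samplingOpT_diagOp_le (x : Fin n → X) {v y : Fin n → ℝ} (hv : ∀ i, 0 ≤ v i)
    (hv1 : 1 / (n : ℝ) * ∑ i, v i ≤ 1) {κ D : ℝ} (hκ0 : 0 ≤ κ)
    (hκ : ∀ x, ‖kerVec H x‖ ≤ κ) (hD0 : 0 ≤ D) (hy : ∀ i, |y i| ≤ D) :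
    ‖samplingOpT H x (diagOp v y)‖ ≤ D * κ := by
  set q := samplingOpT H x (diagOp v y) with hq
  refine le_of_sq_le_mul_self (norm_nonneg _) (by positivity) ?_
  have hqx : ∀ i, |q (x i)| ≤ κ * ‖q‖ := fun i => by
    rw [← inner_kerVec_left]
    exact (abs_real_inner_le_norm _ _).trans (by gcongr; exact hκ _)
  calc ‖q‖ ^ 2 = 1 / (n : ℝ) * ∑ i, v i * y i * q (x i) := by
        rw [← inner_samplingOpT_diagOp, ← hq, real_inner_self_eq_norm_sq]
    _ ≤ 1 / (n : ℝ) * ∑ i, v i * (D * (κ * ‖q‖)) := by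
        refine mul_le_mul_of_nonneg_left (Finset.sum_le_sum fun i _ => ?_) (by positivity)
        rw [mul_assoc]
        refine mul_le_mul_of_nonneg_left ?_ (hv i)
        refine (le_abs_self _).trans ?_
        rw [abs_mul]
        exact mul_le_mul (hy i) (hqx i) (abs_nonneg _) hD0
    _ = (1 / (n : ℝ) * ∑ i, v i) * (D * (κ * ‖q‖)) := by rw [← Finset.sum_mul, mul_assoc]
    _ ≤ 1 * (D * (κ * ‖q‖)) := by gcongr
    _ = D * κ * ‖q‖ := by ring

theorem norm_empOp_le (x : Fin n → X) {v : Fin n → ℝ} (hv : ∀ i, 0 ≤ v i)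
    (hv1 : 1 / (n : ℝ) * ∑ i, v i ≤ 1) {κ : ℝ} (hκ0 : 0 ≤ κ)
    (hκ : ∀ x, ‖kerVec H x‖ ≤ κ) : ‖empOp H x v‖ ≤ κ ^ 2 := by
  refine ContinuousLinearMap.opNorm_le_bound _ (by positivity) fun f => ?_
  rw [empOp_apply]
  refine (norm_samplingOpT_diagOp_le x hv hv1 hκ0 hκ (D := κ * ‖f‖) (by positivity)
    fun i => ?_).trans (le_of_eq (by ring))
  rw [← inner_kerVec_left]
  exact (abs_real_inner_le_norm _ _).trans (by gcongr; exact hκ _)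

/-- The vectors `S_Xᵀ diag(v) y` are orthogonal to the kernel of the empirical operator. -/
theorem inner_samplingOpT_diagOp_eq_zero (x : Fin n → X) {v : Fin n → ℝ} (hv : ∀ i, 0 ≤ v i)
    (y : Fin n → ℝ) {e : H} (he : empOp H x v e = 0) :
    inner ℝ e (samplingOpT H x (diagOp v y)) = 0 := by
  rcases Nat.eq_zero_or_pos n with rfl | hn
  · rw [inner_samplingOpT_diagOp]; simp
  have h1 : 1 / (n : ℝ) * ∑ i, v i * e (x i) * e (x i) = 0 := by
    rw [← inner_empOp, he, inner_zero_right]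
  have hn0 : (0 : ℝ) < 1 / n := by positivity
  have h2 := (mul_eq_zero.1 h1).resolve_left hn0.ne'
  have h3 := (Finset.sum_eq_zero_iff_of_nonneg fun i _ => by
    rw [mul_assoc]
    exact mul_nonneg (hv i) (mul_self_nonneg _)).1 h2
  rw [inner_samplingOpT_diagOp, Finset.sum_eq_zero, mul_zero]
  intro i hi
  have h4 := h3 i hi
  rcases mul_eq_zero.1 h4 with h5 | h5
  · calc v i * y i * e (x i) = y i * (v i * e (x i)) := by ring
      _ = 0 := by rw [h5, mul_zero]
  · rw [h5, mul_zero]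

theorem normalizedWeight_nonneg {w : X → ℝ} (hw : ∀ x, 0 ≤ w x) (x : Fin n → X) (i : Fin n) :
    0 ≤ normalizedWeight w x i :=
  div_nonneg (hw _) (mul_nonneg (by positivity) (Finset.sum_nonneg fun _ _ => hw _))

/-- The mean is `1`, unless all weights vanish. -/
theorem mean_normalizedWeight_le (w : X → ℝ) (x : Fin n → X) :
    1 / (n : ℝ) * ∑ i, normalizedWeight w x i ≤ 1 := by
  unfold normalizedWeight
  rw [← Finset.sum_div, ← mul_div_assoc]
  exact div_self_le_one _

end Empirical

/-! ### Moment bounds -/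

section Centering

variable {Ω : Type*} [MeasurableSpace Ω] {P : Measure Ω} [IsProbabilityMeasure P]
  {E : Type*} [NormedAddCommGroup E]

theorem integrable_of_moment {ξ : Ω → E} (hm : StronglyMeasurable ξ) {B V : ℝ}
    (hmom : ∀ p : ℕ, 2 ≤ p → ∫⁻ ω, ENNReal.ofReal (‖ξ ω‖ ^ p) ∂P ≤
      ENNReal.ofReal (1 / 2 * p.factorial * B ^ (p - 2) * V ^ 2)) : Integrable ξ P := by
  have h2 : Integrable (fun ω => ‖ξ ω‖ ^ 2) P := by
    refine ⟨(hm.norm.pow 2).aestronglyMeasurable, ?_⟩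
    rw [hasFiniteIntegral_iff_ofReal (Filter.Eventually.of_forall fun ω => by positivity)]
    exact (hmom 2 le_rfl).trans_lt ENNReal.ofReal_lt_top
  refine ((integrable_const (1 : ℝ)).add h2).mono' hm.aestronglyMeasurable
    (Filter.Eventually.of_forall fun ω => ?_)
  simp only [Pi.add_apply]
  nlinarith [sq_nonneg (‖ξ ω‖ - 1)]

variable [InnerProductSpace ℝ E]

theorem ofReal_norm_integral_pow_le {ξ : Ω → E} (hm : StronglyMeasurable ξ) {p : ℕ} (hp : 1 ≤ p) :
    ENNReal.ofReal (‖∫ ω, ξ ω ∂P‖ ^ p) ≤ ∫⁻ ω, ENNReal.ofReal (‖ξ ω‖ ^ p) ∂P := by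
  have hp0 : (0 : ℝ) < p := by exact_mod_cast hp
  have hp1 : (1 : ℝ) / p ≤ 1 := by rw [div_le_one hp0]; exact_mod_cast hp
  have h1 : ‖∫ ω, ξ ω ∂P‖ₑ ≤ (∫⁻ ω, ‖ξ ω‖ₑ ^ p ∂P) ^ (1 / p : ℝ) := by
    refine (enorm_integral_le_lintegral_enorm _).trans ?_
    have h2 := ENNReal.lintegral_mul_norm_pow_le (μ := P) (f := fun ω => ‖ξ ω‖ₑ ^ p)
      (g := fun _ => 1) (hm.enorm.pow_const p).aemeasurable aemeasurable_const
      (p := 1 / p) (q := 1 - 1 / p) (by positivity) (by linarith) (by ring)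
    simp only [ENNReal.one_rpow, mul_one, lintegral_const, measure_univ] at h2
    refine le_trans (le_of_eq (lintegral_congr fun ω => ?_)) h2
    rw [← ENNReal.rpow_natCast, ← ENNReal.rpow_mul, mul_one_div_cancel hp0.ne', ENNReal.rpow_one]
  have h3 : ‖∫ ω, ξ ω ∂P‖ₑ ^ p ≤ ∫⁻ ω, ‖ξ ω‖ₑ ^ p ∂P := by
    calc _ ≤ ((∫⁻ ω, ‖ξ ω‖ₑ ^ p ∂P) ^ (1 / p : ℝ)) ^ p := by gcongr
      _ = _ := by
        rw [← ENNReal.rpow_natCast, ← ENNReal.rpow_mul, one_div_mul_cancel hp0.ne',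
          ENNReal.rpow_one]
  simpa only [ENNReal.ofReal_pow (norm_nonneg _), ofReal_norm] using h3

/-- Centering a vector at most doubles the constants of its moment bounds. -/
theorem IsBernstein.of_moment [CompleteSpace E] {ξ : Ω → E} (hm : StronglyMeasurable ξ) {B V : ℝ}
    (hB : 0 ≤ B) (hmom : ∀ p : ℕ, 2 ≤ p → ∫⁻ ω, ENNReal.ofReal (‖ξ ω‖ ^ p) ∂P ≤
      ENNReal.ofReal (1 / 2 * p.factorial * B ^ (p - 2) * V ^ 2)) :
    IsBernstein P (fun ω => ξ ω - ∫ ω', ξ ω' ∂P) (2 * B) (2 * V) := by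
  have hint := integrable_of_moment hm hmom
  have hint2 : Integrable (fun ω => ξ ω - ∫ ω', ξ ω' ∂P) P := hint.sub (integrable_const _)
  refine ⟨hm.sub stronglyMeasurable_const, fun x => hint2.const_inner x, fun x => ?_,
    by positivity, fun p hp => ?_⟩
  · rw [_root_.integral_inner hint2, integral_sub hint (integrable_const _), integral_const]
    simp
  · set c := ∫ ω', ξ ω' ∂P
    have hpt : ∀ ω, ENNReal.ofReal (‖ξ ω - c‖ ^ p) ≤
        ENNReal.ofReal (2 ^ (p - 1)) * (ENNReal.ofReal (‖ξ ω‖ ^ p) + ENNReal.ofReal (‖c‖ ^ p)) := by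
      intro ω
      rw [← ENNReal.ofReal_add (by positivity) (by positivity),
        ← ENNReal.ofReal_mul (by positivity)]
      refine ENNReal.ofReal_le_ofReal ?_
      exact (pow_le_pow_left₀ (norm_nonneg _) (norm_sub_le _ _) p).trans
        (add_pow_le (norm_nonneg _) (norm_nonneg _) p)
    calc ∫⁻ ω, ENNReal.ofReal (‖ξ ω - c‖ ^ p) ∂P
        ≤ ∫⁻ ω, ENNReal.ofReal (2 ^ (p - 1)) *
          (ENNReal.ofReal (‖ξ ω‖ ^ p) + ENNReal.ofReal (‖c‖ ^ p)) ∂P := lintegral_mono hpt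
      _ = ENNReal.ofReal (2 ^ (p - 1)) *
          (∫⁻ ω, ENNReal.ofReal (‖ξ ω‖ ^ p) ∂P + ENNReal.ofReal (‖c‖ ^ p)) := by
          rw [lintegral_const_mul' _ _ ENNReal.ofReal_ne_top,
            lintegral_add_right _ measurable_const, lintegral_const, measure_univ, mul_one]
      _ ≤ ENNReal.ofReal (2 ^ (p - 1)) *
          (ENNReal.ofReal (1 / 2 * p.factorial * B ^ (p - 2) * V ^ 2) +
            ENNReal.ofReal (1 / 2 * p.factorial * B ^ (p - 2) * V ^ 2)) := by
          exact mul_le_mul' le_rfl (add_le_add (hmom p hp)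
            ((ofReal_norm_integral_pow_le hm (by omega)).trans (hmom p hp)))
      _ = _ := by
          rw [← ENNReal.ofReal_add (by positivity) (by positivity),
            ← ENNReal.ofReal_mul (by positivity)]
          congr 1
          obtain ⟨k, rfl⟩ := Nat.exists_eq_add_of_le hp
          rw [show 2 + k - 2 = k by omega, show 2 + k - 1 = k + 1 by omega]
          ring

end Centering

section Weights

variable {X : Type*} [MeasurableSpace X] {μte μtr : Measure X}

theorem measurable_densityRatio : Measurable (densityRatio μte μtr) :=
  (Measure.measurable_rnDeriv μte μtr).ennreal_toReal

theorem densityRatio_nonneg (x : X) : 0 ≤ densityRatio μte μtr x := ENNReal.toReal_nonneg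

variable [IsProbabilityMeasure μtr] [IsProbabilityMeasure μte]

theorem integral_densityRatio_mul (h : μte ≪ μtr) (φ : X → ℝ) :
    ∫ x, densityRatio μte μtr x * φ x ∂μtr = ∫ x, φ x ∂μte :=
  integral_rnDeriv_smul h

/-- The moment condition on the density ratio `w` bounds the moments of `w h` under the training
distribution, for bounded `h`, by Hölder's inequality with exponents `1/α` and `1/(1-α)`. -/
theorem lintegral_densityRatio_mul_pow_le {α C σ : ℝ} (hα0 : 0 < α) (hα1 : α ≤ 1)
    (hC : 0 ≤ C) (habs : μte ≪ μtr) (hw : WeightMomentCondition μte μtr α C σ)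
    {h : X → ℝ} (hm : Measurable h) (h0 : ∀ x, 0 ≤ h x) {m N : ℝ} (hm0 : 0 < m)
    (hmle : ∀ x, h x ≤ m) (hN0 : 0 ≤ N)
    (hN : ∫⁻ x, ENNReal.ofReal (h x ^ 2) ∂μte ≤ ENNReal.ofReal N) {p : ℕ} (hp : 2 ≤ p) :
    ∫⁻ x, ENNReal.ofReal ((densityRatio μte μtr x * h x) ^ p) ∂μtr ≤
      ENNReal.ofReal (1 / 2 * p.factorial * (C * m) ^ (p - 2) *
        (σ * m ^ α * N ^ ((1 - α) / 2)) ^ 2) := by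
  set w := densityRatio μte μtr with hwdef
  have hwm : Measurable w := measurable_densityRatio
  have hw0 : ∀ x, 0 ≤ w x := densityRatio_nonneg
  have hp1 : (1 : ℝ) ≤ p := by exact_mod_cast (by omega : 1 ≤ p)
  have step1 : ∫⁻ x, ENNReal.ofReal ((w x * h x) ^ p) ∂μtr =
      ∫⁻ x, ENNReal.ofReal (w x) ^ ((p : ℝ) - 1) * ENNReal.ofReal (h x ^ p) ∂μte := by
    rw [← lintegral_rnDeriv_mul habs (by fun_prop)]
    refine lintegral_congr_ae ?_
    filter_upwards [Measure.rnDeriv_lt_top μte μtr] with x hx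
    have hx2 : μte.rnDeriv μtr x = ENNReal.ofReal (w x) := (ENNReal.ofReal_toReal hx.ne).symm
    rw [hx2, mul_pow, ENNReal.ofReal_mul (pow_nonneg (hw0 x) p), ← mul_assoc,
      ENNReal.ofReal_pow (hw0 x)]
    congr 1
    obtain ⟨k, rfl⟩ := Nat.exists_eq_add_of_le' (by omega : 1 ≤ p)
    rw [pow_succ', Nat.cast_add, Nat.cast_one, add_sub_cancel_right, ENNReal.rpow_natCast]
  have hexp : (0 : ℝ) ≤ p - 2 + 2 * α := by
    have : (2 : ℝ) ≤ p := by exact_mod_cast hp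
    linarith
  have step2 : ∀ x, ENNReal.ofReal (w x) ^ ((p : ℝ) - 1) * ENNReal.ofReal (h x ^ p) ≤
      ENNReal.ofReal (m ^ ((p : ℝ) - 2 + 2 * α)) *
        ((ENNReal.ofReal (w x) ^ (((p : ℝ) - 1) / α)) ^ α *
          ENNReal.ofReal (h x ^ 2) ^ (1 - α)) := by
    intro x
    have hx0 := h0 x
    have hxm := hmle x
    rw [← ENNReal.rpow_mul, div_mul_cancel₀ _ hα0.ne', mul_left_comm,
      ENNReal.ofReal_rpow_of_nonneg (by positivity : (0 : ℝ) ≤ h x ^ 2) (by linarith),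
      ← ENNReal.ofReal_mul (by positivity)]
    refine mul_le_mul' le_rfl (ENNReal.ofReal_le_ofReal ?_)
    have e : h x ^ p = h x ^ ((p : ℝ) - 2 + 2 * α) * (h x ^ 2) ^ (1 - α) := by
      rw [← Real.rpow_natCast (h x) 2, ← Real.rpow_mul (h0 x), ← Real.rpow_add' (h0 x)]
      · rw [← Real.rpow_natCast]
        congr 1
        push_cast
        ring
      · push_cast
        ring_nf
        linarith
    rw [e]
    gcongr
  rw [step1]
  calc _ ≤ ∫⁻ x, ENNReal.ofReal (m ^ ((p : ℝ) - 2 + 2 * α)) *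
        ((ENNReal.ofReal (w x) ^ (((p : ℝ) - 1) / α)) ^ α *
          ENNReal.ofReal (h x ^ 2) ^ (1 - α)) ∂μte := lintegral_mono step2
    _ = ENNReal.ofReal (m ^ ((p : ℝ) - 2 + 2 * α)) *
        ∫⁻ x, (ENNReal.ofReal (w x) ^ (((p : ℝ) - 1) / α)) ^ α *
          ENNReal.ofReal (h x ^ 2) ^ (1 - α) ∂μte :=
        lintegral_const_mul' _ _ ENNReal.ofReal_ne_top
    _ ≤ ENNReal.ofReal (m ^ ((p : ℝ) - 2 + 2 * α)) *
        ((∫⁻ x, ENNReal.ofReal (w x) ^ (((p : ℝ) - 1) / α) ∂μte) ^ α *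
          (∫⁻ x, ENNReal.ofReal (h x ^ 2) ∂μte) ^ (1 - α)) := by
        gcongr
        exact ENNReal.lintegral_mul_norm_pow_le (by fun_prop) (by fun_prop) hα0.le
          (by linarith) (by ring)
    _ ≤ ENNReal.ofReal (m ^ ((p : ℝ) - 2 + 2 * α)) *
        (ENNReal.ofReal (1 / 2 * (p.factorial : ℝ) * C ^ (p - 2) * σ ^ 2) *
          ENNReal.ofReal N ^ (1 - α)) := by
        gcongr
        · exact hw p hp
    _ = _ := by
        rw [ENNReal.ofReal_rpow_of_nonneg hN0 (by linarith), ← ENNReal.ofReal_mul (by positivity),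
          ← ENNReal.ofReal_mul (by positivity)]
        congr 1
        have e1 : m ^ ((p : ℝ) - 2 + 2 * α) = m ^ (p - 2) * (m ^ α) ^ 2 := by
          rw [Real.rpow_add hm0, mul_comm 2 α, Real.rpow_mul hm0.le, Real.rpow_ofNat,
            show (p : ℝ) - 2 = ((p - 2 : ℕ) : ℝ) by push_cast [Nat.cast_sub hp]; ring,
            Real.rpow_natCast]
        have e2 : N ^ (1 - α) = (N ^ ((1 - α) / 2)) ^ 2 := by
          rw [← Real.rpow_mul_natCast hN0]
          congr 1
          push_cast
          ring
        rw [e1, e2]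
        ring

end Weights

section TensorSquare

variable {H : Type*} [NormedAddCommGroup H] [InnerProductSpace ℝ H]

/-- The pure tensor `u ⊗ v` in the completed tensor product of `H` with itself. This Hilbert space
plays the role of the Hilbert–Schmidt operators on `H`. -/
def completedTmul (u v : H) : UniformSpace.Completion (TensorProduct ℝ H H) :=
  ((TensorProduct.tmul ℝ u v : TensorProduct ℝ H H) : UniformSpace.Completion _)

theorem inner_completedTmul (u v u' v' : H) :
    inner ℝ (completedTmul u v) (completedTmul u' v') = inner ℝ u u' * inner ℝ v v' := by
  rw [completedTmul, completedTmul, UniformSpace.Completion.inner_coe, TensorProduct.inner_tmul]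

theorem norm_completedTmul (u v : H) : ‖completedTmul u v‖ = ‖u‖ * ‖v‖ := by
  rw [completedTmul, UniformSpace.Completion.norm_coe, TensorProduct.norm_tmul]

theorem continuous_completedTmul : Continuous fun z : H × H => completedTmul z.1 z.2 :=
  (UniformSpace.Completion.continuous_coe _).comp TensorProduct.continuous_tmul

end TensorSquare

section Samples

variable {X : Type*} [MetricSpace X] [CompactSpace X] [MeasurableSpace X] [BorelSpace X]
  {K : MercerKernel X}
  {H : Type*} [NormedAddCommGroup H] [InnerProductSpace ℝ H] [CompleteSpace H] [RKHS ℝ H X ℝ]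
  {μte μtr : Measure X} [IsProbabilityMeasure μtr] [IsProbabilityMeasure μte]
  {ρ : Kernel X ℝ} [IsMarkovKernel ρ] {α C σ : ℝ}

theorem lintegral_compProd_fst {φ : X → ℝ≥0∞} (hφ : Measurable φ) :
    ∫⁻ z, φ z.1 ∂(μtr ⊗ₘ ρ) = ∫⁻ x, φ x ∂μtr := by
  rw [Measure.lintegral_compProd (f := fun z : X × ℝ => φ z.1) (hφ.comp measurable_fst)]
  simp

theorem integral_compProd_fst {φ : X → ℝ} (hφ : StronglyMeasurable φ) :
    ∫ z, φ z.1 ∂(μtr ⊗ₘ ρ) = ∫ x, φ x ∂μtr := by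
  conv_rhs => rw [← Measure.fst_compProd μtr ρ]
  rw [Measure.fst, integral_map measurable_fst.aemeasurable hφ.aestronglyMeasurable]

/-- Moment bound for a vector dominated by `k w h`. -/
theorem lintegral_norm_pow_le {E : Type*} [NormedAddCommGroup E]
    (hα0 : 0 < α) (hα1 : α ≤ 1) (hC : 0 ≤ C) (habs : μte ≪ μtr)
    (hw : WeightMomentCondition μte μtr α C σ)
    {h : X → ℝ} (hm : Measurable h) (h0 : ∀ x, 0 ≤ h x) {m N : ℝ} (hm0 : 0 < m)
    (hmle : ∀ x, h x ≤ m) (hN0 : 0 ≤ N)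
    (hN : ∫⁻ x, ENNReal.ofReal (h x ^ 2) ∂μte ≤ ENNReal.ofReal N)
    {ξ : X × ℝ → E} {k : ℝ} (hk : 0 ≤ k)
    (hξ : ∀ᵐ z ∂(μtr ⊗ₘ ρ), ‖ξ z‖ ≤ k * (densityRatio μte μtr z.1 * h z.1))
    (p : ℕ) (hp : 2 ≤ p) :
    ∫⁻ z, ENNReal.ofReal (‖ξ z‖ ^ p) ∂(μtr ⊗ₘ ρ) ≤
      ENNReal.ofReal (1 / 2 * p.factorial * (k * (C * m)) ^ (p - 2) *
        (k * (σ * m ^ α * N ^ ((1 - α) / 2))) ^ 2) := by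
  have hwm : Measurable (densityRatio μte μtr) := measurable_densityRatio
  calc _ ≤ ∫⁻ z, ENNReal.ofReal (k ^ p) *
        ENNReal.ofReal ((densityRatio μte μtr z.1 * h z.1) ^ p) ∂(μtr ⊗ₘ ρ) := by
        refine lintegral_mono_ae ?_
        filter_upwards [hξ] with z hz
        rw [← ENNReal.ofReal_mul (by positivity), ← mul_pow]
        gcongr
    _ = ENNReal.ofReal (k ^ p) *
        ∫⁻ x, ENNReal.ofReal ((densityRatio μte μtr x * h x) ^ p) ∂μtr := by
        rw [lintegral_const_mul' _ _ ENNReal.ofReal_ne_top]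
        congr 1
        exact lintegral_compProd_fst
          (φ := fun x => ENNReal.ofReal ((densityRatio μte μtr x * h x) ^ p)) (by fun_prop)
    _ ≤ ENNReal.ofReal (k ^ p) * ENNReal.ofReal (1 / 2 * p.factorial * (C * m) ^ (p - 2) *
        (σ * m ^ α * N ^ ((1 - α) / 2)) ^ 2) := by
        gcongr
        exact lintegral_densityRatio_mul_pow_le hα0 hα1 hC habs hw hm h0 hm0 hmle hN0 hN hp
    _ = _ := by
        rw [← ENNReal.ofReal_mul (by positivity)]
        congr 1
        obtain ⟨j, rfl⟩ := Nat.exists_eq_add_of_le hp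
        rw [show 2 + j - 2 = j by omega]
        ring

/-- The noise vectors `w(x) (y - f(x)) S K_x` satisfy Bernstein's condition; they have mean zero
because `f` agrees with the regression function on the support of the weight `w`. -/
theorem isBernstein_noise (hK : K.IsKernelOf H)
    (hα0 : 0 < α) (hα1 : α ≤ 1) (hC : 0 ≤ C) (habs : μte ≪ μtr)
    (hw : WeightMomentCondition μte μtr α C σ) (S : H →L[ℝ] H) {m N : ℝ} (hm0 : 0 < m)
    (hmle : ∀ x, ‖S (kerVec H x)‖ ≤ m) (hN0 : 0 ≤ N)
    (hN : ∫⁻ x, ENNReal.ofReal (‖S (kerVec H x)‖ ^ 2) ∂μte ≤ ENNReal.ofReal N)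
    {M : ℝ} (hM : ∀ᵐ z ∂(μtr ⊗ₘ ρ), |z.2| ≤ M) {f : H} (hf : regressionFun ρ =ᵐ[μte] f)
    {D : ℝ} (hD : 0 ≤ D) (hfD : ∀ x, M + |f x| ≤ D) :
    IsBernstein (μtr ⊗ₘ ρ)
      (fun z => (densityRatio μte μtr z.1 * (z.2 - f z.1)) • S (kerVec H z.1))
      (D * (C * m)) (D * (σ * m ^ α * N ^ ((1 - α) / 2))) := by
  set w := densityRatio μte μtr with hwdef
  have hwm : Measurable w := measurable_densityRatio
  have hSc : Continuous fun x : X => S (kerVec H x) := S.continuous.comp hK.continuous_kerVec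
  have hSm : StronglyMeasurable fun x : X => S (kerVec H x) :=
    hSc.stronglyMeasurable_of_hasCompactSupport (HasCompactSupport.of_compactSpace _)
  have hfm : Measurable (f : X → ℝ) := (hK.continuous_apply f).measurable
  have hsc : Measurable fun z : X × ℝ => w z.1 * (z.2 - f z.1) := by fun_prop
  have hsm : StronglyMeasurable fun z : X × ℝ => (w z.1 * (z.2 - f z.1)) • S (kerVec H z.1) :=
    hsc.stronglyMeasurable.smul (hSm.comp_measurable measurable_fst)
  have hbound : ∀ᵐ z ∂(μtr ⊗ₘ ρ), ‖(w z.1 * (z.2 - f z.1)) • S (kerVec H z.1)‖ ≤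
      D * (w z.1 * ‖S (kerVec H z.1)‖) := by
    filter_upwards [hM] with z hz
    have h1 : |z.2 - f z.1| ≤ D := (abs_sub _ _).trans ((add_le_add hz le_rfl).trans (hfD z.1))
    rw [norm_smul, norm_mul, Real.norm_of_nonneg (densityRatio_nonneg z.1), Real.norm_eq_abs]
    calc _ ≤ w z.1 * D * ‖S (kerVec H z.1)‖ := by
          gcongr
          exact densityRatio_nonneg z.1
      _ = _ := by ring
  have hmom := lintegral_norm_pow_le hα0 hα1 hC habs hw hSm.norm.measurable
    (fun x => norm_nonneg _) hm0 hmle hN0 hN hD hbound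
  have hint := integrable_of_moment hsm hmom
  refine ⟨hsm, fun v => hint.const_inner v, fun v => ?_, by positivity, hmom⟩
  have hf2 : ∀ᵐ x ∂μtr, w x * (regressionFun ρ x - f x) = 0 := by
    have h1 : ∀ᵐ x ∂μtr.withDensity (μte.rnDeriv μtr), regressionFun ρ x = f x := by
      rwa [Measure.withDensity_rnDeriv_eq _ _ habs]
    rw [ae_withDensity_iff (Measure.measurable_rnDeriv _ _)] at h1
    filter_upwards [h1] with x hx
    by_cases h0 : μte.rnDeriv μtr x = 0
    · simp [hwdef, densityRatio, h0]
    · rw [hx h0, sub_self, mul_zero]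
  rw [Measure.integral_compProd (hint.const_inner v)]
  have hzero : ∀ᵐ x ∂μtr, ∫ y, inner ℝ v ((w x * (y - f x)) • S (kerVec H x)) ∂(ρ x) = 0 := by
    filter_upwards [hf2, Measure.ae_ae_of_ae_compProd hM] with x hx hMx
    have hy : Integrable (fun y : ℝ => y) (ρ x) :=
      (integrable_const M).mono' (by fun_prop) (by simpa using hMx)
    simp_rw [inner_smul_right]
    rw [integral_mul_const, integral_const_mul, integral_sub hy (integrable_const _)]
    simp only [integral_const, probReal_univ, one_smul]
    change w x * (regressionFun ρ x - f x) * _ = 0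
    rw [hx, zero_mul]
  rw [integral_congr_ae hzero]
  simp

/-- The centered weights satisfy Bernstein's condition. -/
theorem isBernstein_weight (hα0 : 0 < α) (hα1 : α ≤ 1) (hC : 0 ≤ C) (habs : μte ≪ μtr)
    (hw : WeightMomentCondition μte μtr α C σ) :
    IsBernstein (μtr ⊗ₘ ρ) (fun z => densityRatio μte μtr z.1 - 1) (2 * C) (2 * σ) := by
  have hwm : Measurable (densityRatio μte μtr) := measurable_densityRatio
  have hmom := lintegral_norm_pow_le (ρ := ρ) hα0 hα1 hC habs hw (h := fun _ => 1)
    measurable_const (fun _ => zero_le_one) one_pos (fun _ => le_rfl) zero_le_one (by simp)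
    (ξ := fun z => densityRatio μte μtr z.1) zero_le_one
    (Filter.Eventually.of_forall fun z => by
      rw [Real.norm_of_nonneg (densityRatio_nonneg z.1)]; simp)
  simp only [mul_one, one_mul, Real.one_rpow] at hmom
  have hsm : StronglyMeasurable fun z : X × ℝ => densityRatio μte μtr z.1 :=
    (hwm.comp measurable_fst).stronglyMeasurable
  have := IsBernstein.of_moment hsm hC hmom
  have hmean : ∫ z, densityRatio μte μtr z.1 ∂(μtr ⊗ₘ ρ) = 1 := by
    rw [integral_compProd_fst hwm.stronglyMeasurable]
    have := integral_densityRatio_mul habs fun _ => 1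
    simpa using this
  rwa [hmean] at this

/-- The weighted rank one operators `w(x) K_x ⊗ S K_x`, centered, satisfy Bernstein's condition.
Here `τ` maps a pair of vectors to their tensor product in a Hilbert space `E`. -/
theorem isBernstein_rankOne {E : Type*} [NormedAddCommGroup E] [InnerProductSpace ℝ E]
    [CompleteSpace E] {τ : H → H → E}
    (hτ : ∀ u v u' v', inner ℝ (τ u v) (τ u' v') = inner ℝ u u' * inner ℝ v v')
    (hτn : ∀ u v, ‖τ u v‖ = ‖u‖ * ‖v‖) (hτc : Continuous fun z : H × H => τ z.1 z.2)
    (hK : K.IsKernelOf H)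
    (hα0 : 0 < α) (hα1 : α ≤ 1) (hC : 0 ≤ C) (habs : μte ≪ μtr)
    (hw : WeightMomentCondition μte μtr α C σ) (S : H →L[ℝ] H) {m N : ℝ} (hm0 : 0 < m)
    (hmle : ∀ x, ‖S (kerVec H x)‖ ≤ m) (hN0 : 0 ≤ N)
    (hN : ∫⁻ x, ENNReal.ofReal (‖S (kerVec H x)‖ ^ 2) ∂μte ≤ ENNReal.ofReal N)
    {κ : ℝ} (hκ0 : 0 ≤ κ) (hκ : ∀ x, ‖kerVec H x‖ ≤ κ) :
    ∃ c : E,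
      (∀ v v', inner ℝ (τ v v') c =
        ∫ x, inner ℝ v (kerVec H x) * inner ℝ v' (S (kerVec H x)) ∂μte) ∧
      IsBernstein (μtr ⊗ₘ ρ)
        (fun z => densityRatio μte μtr z.1 • τ (kerVec H z.1) (S (kerVec H z.1)) - c)
        (2 * (κ * (C * m))) (2 * (κ * (σ * m ^ α * N ^ ((1 - α) / 2)))) := by
  set w := densityRatio μte μtr with hwdef
  have hwm : Measurable w := measurable_densityRatio
  have hSc : Continuous fun x : X => S (kerVec H x) := S.continuous.comp hK.continuous_kerVec
  have hSm : StronglyMeasurable fun x : X => S (kerVec H x) :=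
    hSc.stronglyMeasurable_of_hasCompactSupport (HasCompactSupport.of_compactSpace _)
  have htc : Continuous fun x : X => τ (kerVec H x) (S (kerVec H x)) :=
    hτc.comp (hK.continuous_kerVec.prodMk hSc)
  have htm : StronglyMeasurable fun x : X => τ (kerVec H x) (S (kerVec H x)) :=
    htc.stronglyMeasurable_of_hasCompactSupport (HasCompactSupport.of_compactSpace _)
  have hw1 : StronglyMeasurable fun z : X × ℝ => w z.1 :=
    (hwm.comp measurable_fst).stronglyMeasurable
  have hsm : StronglyMeasurable fun z : X × ℝ => w z.1 • τ (kerVec H z.1) (S (kerVec H z.1)) :=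
    hw1.smul (htm.comp_measurable measurable_fst)
  have hbound : ∀ᵐ z ∂(μtr ⊗ₘ ρ), ‖w z.1 • τ (kerVec H z.1) (S (kerVec H z.1))‖ ≤
      κ * (w z.1 * ‖S (kerVec H z.1)‖) := Filter.Eventually.of_forall fun z => by
    have hw0 : 0 ≤ w z.1 := densityRatio_nonneg z.1
    rw [norm_smul, Real.norm_of_nonneg hw0, hτn]
    calc _ ≤ w z.1 * (κ * ‖S (kerVec H z.1)‖) := by
          gcongr
          exact hκ z.1
      _ = _ := by ring
  have hmom := lintegral_norm_pow_le hα0 hα1 hC habs hw hSm.norm.measurable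
    (fun x => norm_nonneg _) hm0 hmle hN0 hN hκ0 hbound
  have hint := integrable_of_moment hsm hmom
  refine ⟨_, fun v v' => ?_, IsBernstein.of_moment hsm (by positivity) hmom⟩
  rw [← _root_.integral_inner hint]
  simp_rw [inner_smul_right, hτ]
  have hφ : Measurable fun x : X => inner ℝ v (kerVec H x) * inner ℝ v' (S (kerVec H x)) :=
    ((continuous_const.inner hK.continuous_kerVec).mul (continuous_const.inner hSc)).measurable
  rw [← integral_densityRatio_mul habs]
  exact integral_compProd_fst (φ := fun x => w x * (inner ℝ v (kerVec H x) *
    inner ℝ v' (S (kerVec H x)))) (hwm.mul hφ).stronglyMeasurable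

end Samples

/-! ### Error of the estimator on a good sample -/

section Estimator

namespace EigenSystem

variable {E : Type*} [NormedAddCommGroup E] [InnerProductSpace ℝ E] {T : E →L[ℝ] E} {ι : Type*}

theorem norm_regPow_neg_half_apply_le {κ : ℝ} (hκ0 : 0 ≤ κ) (A : EigenSystem T (κ ^ 2) ι) {a : ℝ}
    (ha : 0 < a) (v : E) : ‖A.regPow a (-(1 / 2)) (T v)‖ ≤ κ * ‖v‖ := by
  have h1 : A.regPow a (-(1 / 2)) (T v) = A.fn (fun t => (t + a) ^ (-(1 / 2) : ℝ) * t) v := by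
    rw [← A.fn_fn (BddOnIcc.add_rpow ha _) BddOnIcc.id, A.fn_id]
    rfl
  rw [h1]
  refine A.norm_fn_le' hκ0 (fun t h0 h1 => ?_) v
  have hta : 0 < t + a := by linarith
  rw [abs_of_nonneg (by positivity), Real.rpow_neg hta.le, ← Real.sqrt_eq_rpow, inv_mul_eq_div,
    div_le_iff₀ (Real.sqrt_pos.2 hta)]
  have h2 : √t ≤ κ := by
    rw [← Real.sqrt_sq hκ0]
    exact Real.sqrt_le_sqrt h1
  calc t = √t * √t := (Real.mul_self_sqrt h0).symm
    _ ≤ κ * √(t + a) := by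
      gcongr
      linarith

end EigenSystem

variable {X : Type*} [MetricSpace X] [CompactSpace X] [MeasurableSpace X] [BorelSpace X]
  {K : MercerKernel X} {H : Type u} [NormedAddCommGroup H] [InnerProductSpace ℝ H]
  [CompleteSpace H] [RKHS ℝ H X ℝ]

theorem MercerKernel.IsKernelOf.norm_inclusion_le_norm_regPow (hK : K.IsKernelOf H)
    {μ : Measure X} [IsProbabilityMeasure μ] {c : ℝ} {ι : Type*}
    (A : EigenSystem (hK.covOp μ) c ι) {a : ℝ} (ha : 0 < a) (h : H) :
    ‖hK.inclusion μ h‖ ≤ ‖A.regPow a (1 / 2) h‖ := by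
  refine le_of_sq_le_sq ?_ (norm_nonneg _)
  rw [A.norm_regPow_sq ha, A.regPow_one ha, inner_add_right, hK.norm_inclusion_sq,
    inner_smul_right, real_inner_self_eq_norm_sq]
  exact le_add_of_nonneg_right (by positivity)

end Estimator

section Sample

variable {X : Type*} {H : Type u} [NormedAddCommGroup H] [InnerProductSpace ℝ H]
  [CompleteSpace H] [RKHS ℝ H X ℝ] {n : ℕ}

theorem inner_spectralFun_empOp {c : ℝ} {x : Fin n → X} {v : Fin n → ℝ} (hv : ∀ i, 0 ≤ v i)
    (hc : ‖empOp H x v‖ ≤ c) {φ : ℝ → ℝ} {C : ℝ}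
    (hφ : ∀ t, 0 < t → t ≤ c → |φ t| ≤ C) {e : H} {l : ℝ} (he : empOp H x v e = l • e) (q : H) :
    inner ℝ e (spectralFun (empOp H x v) φ q) = φ l * inner ℝ e q := by
  -- The value `φ 0` is not controlled by the hypotheses on the filter function.
  refine inner_spectralFun (isPositive_empOp x hv).isSymmetric (C := max C |φ 0|)
    (fun t ht => ?_) he q
  obtain ⟨h0, h1⟩ := hasEigenvalue_mem_Icc (isPositive_empOp x hv) hc ht
  rcases h0.eq_or_lt with h | h
  · rw [← h]
    exact le_max_right _ _
  · exact (hφ t h h1).trans (le_max_left _ _)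

theorem norm_spectralFun_empOp_le {c : ℝ} {x : Fin n → X} {v : Fin n → ℝ} (hv : ∀ i, 0 ≤ v i)
    (hc : ‖empOp H x v‖ ≤ c) {φ : ℝ → ℝ} {C : ℝ} (hC : 0 ≤ C)
    (hφ : ∀ t, 0 < t → t ≤ c → |φ t| ≤ C) (y : Fin n → ℝ) :
    ‖spectralFun (empOp H x v) φ (samplingOpT H x (diagOp v y))‖ ≤
      C * ‖samplingOpT H x (diagOp v y)‖ := by
  obtain ⟨ι, ⟨B⟩⟩ := exists_eigenSystem (isCompactOperator_empOp x v) (isPositive_empOp x hv) hc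
  refine B.basis.norm_le_of_abs_inner_le hC fun i => ?_
  rw [inner_spectralFun_empOp hv hc hφ (B.apply_basis i), abs_mul]
  rcases (B.val_nonneg i).eq_or_lt with h | h
  · rw [inner_samplingOpT_diagOp_eq_zero x hv y (by rw [B.apply_basis i, ← h, zero_smul])]
    simp
  · gcongr
    exact hφ _ h (B.val_le i)

theorem samplingOpT_diagOp_normalizedWeight (w : X → ℝ) (x : Fin n → X) (y : Fin n → ℝ) :
    samplingOpT H x (diagOp (normalizedWeight w x) y) =
      (1 / (n : ℝ) * ∑ j, w (x j))⁻¹ • samplingOpT H x (diagOp (fun i => w (x i)) y) := by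
  refine ext_inner_left ℝ fun f => ?_
  rw [inner_smul_right, inner_samplingOpT_diagOp, inner_samplingOpT_diagOp, mul_left_comm]
  refine congrArg _ ?_
  rw [Finset.mul_sum]
  refine Finset.sum_congr rfl fun i _ => ?_
  rw [normalizedWeight]
  ring

theorem samplingOpT_diagOp_sub_add_empOp (x : Fin n → X) (v y : Fin n → ℝ) (f : H) :
    samplingOpT H x (diagOp v fun i => y i - f (x i)) + empOp H x v f =
      samplingOpT H x (diagOp v y) := by
  rw [empOp_apply, ← ContinuousLinearMap.map_add, ← ContinuousLinearMap.map_add]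
  congr 2
  ext i
  simp

end Sample

section Error

variable {X : Type*} {H : Type u} [NormedAddCommGroup H] [InnerProductSpace ℝ H]
  [CompleteSpace H] [RKHS ℝ H X ℝ] {n : ℕ}

/-- Error of the estimator with normalized weights, for a sample on which the empirical mean of the
weights is close to `1` and the empirical operator and the empirical noise built from the
unnormalized weights `w` are close to their means. -/
theorem norm_regPow_half_estimator_sub_le [TopologicalSpace.SeparableSpace H]
    {T : H →L[ℝ] H} {κ : ℝ} (hκ0 : 0 ≤ κ) {ι : Type*} (A : EigenSystem T (κ ^ 2) ι)
    (hκ : ∀ x : X, ‖kerVec H x‖ ≤ κ) {w : X → ℝ} (hw : ∀ x, 0 ≤ w x) {x : Fin n → X}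
    {y : Fin n → ℝ} {a b G s ε E₁ E₂ : ℝ} (ha : 0 < a) (hb : 0 ≤ b) (hG : 0 ≤ G) (hs0 : 0 ≤ s)
    (hs1 : s ≤ 1) {φ : ℝ → ℝ} (hφ1 : ∀ t, 0 < t → t ≤ κ ^ 2 → |φ t| ≤ b / a)
    (hφ2 : ∀ t, 0 < t → t ≤ κ ^ 2 → |φ t * t| ≤ b)
    (hφ3 : ∀ t, 0 < t → t ≤ κ ^ 2 → |1 - φ t * t| * t ^ (s + 1 / 2) ≤ G * a ^ (s + 1 / 2))
    {fH v : H} (hfH : fH = A.fn (fun t => t ^ s) v)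
    (hd : 1 / 2 ≤ 1 / (n : ℝ) * ∑ j, w (x j)) (hε : |1 / (n : ℝ) * ∑ j, w (x j) - 1| ≤ ε)
    (hE1 : 0 ≤ E₁)
    (h1 : ∀ f, ‖A.regPow a (-(1 / 2)) (T f - empOp H x (fun i => w (x i)) f)‖ ≤ E₁ * ‖f‖)
    (h2 : ‖A.regPow a (-(1 / 2))
      (samplingOpT H x (diagOp (fun i => w (x i)) fun i => y i - fH (x i)))‖ ≤ E₂) :
    ‖A.regPow a (1 / 2) (spectralFun (empOp H x (normalizedWeight w x)) φ
        (samplingOpT H x (diagOp (normalizedWeight w x) y)) - fH)‖ ≤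
      2 * b * (1 + a ^ (-(1 / 2) : ℝ) * (2 * E₁ + 2 * ε * κ)) ^ 2 * (2 * E₂) +
        4 * (G + 1 + b) * a ^ (s + 1 / 2) *
          (1 + a ^ (-(1 / 2) : ℝ) * (2 * E₁ + 2 * ε * κ)) ^ 3 * ‖v‖ := by
  set d := 1 / (n : ℝ) * ∑ j, w (x j) with hddef
  have hε0 : 0 ≤ ε := (abs_nonneg _).trans hε
  have hd0 : 0 < d := by linarith
  have hdinv : d⁻¹ ≤ 2 := by
    rw [inv_le_comm₀ hd0 two_pos]
    linarith
  have hdinv0 : 0 < d⁻¹ := inv_pos.2 hd0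
  have hv := normalizedWeight_nonneg hw x
  have hc := norm_empOp_le (H := H) x hv (mean_normalizedWeight_le w x) hκ0 hκ
  obtain ⟨ι', ⟨B⟩⟩ := exists_eigenSystem (isCompactOperator_empOp x (normalizedWeight w x))
    (isPositive_empOp x hv) hc
  have : Countable ι := A.basis.countable
  have : Countable ι' := B.basis.countable
  refine A.norm_regPow_half_sub_le B ha (by positivity) hb hG hs0 hs1 (fun f => ?_) hφ1 hφ2 hφ3 hfH
    (q := samplingOpT H x (diagOp (normalizedWeight w x) fun i => y i - fH (x i)))
    (fun i hi => ?_) ?_ (fun i => ?_)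
  · -- `T - B = d⁻¹ (T - B_w) + (1 - d⁻¹) T`, where `B = d⁻¹ B_w`.
    have e1 : T f - empOp H x (normalizedWeight w x) f =
        d⁻¹ • (T f - empOp H x (fun i => w (x i)) f) + (1 - d⁻¹) • T f := by
      rw [empOp_apply, samplingOpT_diagOp_normalizedWeight, ← empOp_apply, ← hddef]
      module
    have e2 : |1 - d⁻¹| ≤ 2 * ε := by
      rw [show 1 - d⁻¹ = d⁻¹ * (d - 1) by rw [mul_sub, inv_mul_cancel₀ hd0.ne']; ring, abs_mul,
        abs_of_pos hdinv0]
      gcongr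
    rw [e1, map_add, map_smul, map_smul]
    refine (norm_add_le _ _).trans ?_
    rw [norm_smul, norm_smul, Real.norm_of_nonneg hdinv0.le, Real.norm_eq_abs]
    calc _ ≤ 2 * (E₁ * ‖f‖) + 2 * ε * (κ * ‖f‖) := by
          gcongr
          · exact h1 f
          · exact A.norm_regPow_neg_half_apply_le hκ0 ha f
      _ = _ := by ring
  · exact inner_samplingOpT_diagOp_eq_zero x hv _ (by rw [B.apply_basis i, hi, zero_smul])
  · rw [samplingOpT_diagOp_normalizedWeight, map_smul, norm_smul, ← hddef,
      Real.norm_of_nonneg hdinv0.le]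
    gcongr
  · rw [samplingOpT_diagOp_sub_add_empOp]
    exact inner_spectralFun_empOp hv hc hφ1 (B.apply_basis i) _

end Error

/-! ### Rates and good samples -/

section Rates

/-- The Bernstein bounds with `B = k C m`, `V = k σ m ^ α N ^ ((1 - α) / 2)`, `m = κ a ^ (-1/2)` and
`N = C₀ a ^ (-β)` are of order `a ^ p` when `1 / n = a ^ (2 p + β + α (1 - β))`. -/
theorem bernstein_rate_le {κ C σ C₀ α β p a k : ℝ} {n : ℕ} (hκ : 0 ≤ κ) (hC : 0 ≤ C)
    (hC₀ : 0 ≤ C₀) (hα0 : 0 < α) (hα1 : α ≤ 1) (hβ : 0 ≤ β)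
    (hp : 1 / 2 ≤ p) (hk : 0 ≤ k) (ha0 : 0 < a) (ha1 : a ≤ 1)
    (hn : (n : ℝ)⁻¹ = a ^ (2 * p + β + α * (1 - β))) :
    2 * (2 * (k * (C * (κ * a ^ (-(1 / 2) : ℝ)))) / n +
        k * (σ * (κ * a ^ (-(1 / 2) : ℝ)) ^ α * (C₀ * a ^ (-β)) ^ ((1 - α) / 2)) / √n) ≤
      k * (2 * (2 * C * κ + σ * κ ^ α * C₀ ^ ((1 - α) / 2))) * a ^ p := by
  have hsq : (√(n : ℝ))⁻¹ = a ^ (p + (β + α * (1 - β)) / 2) := by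
    rw [← Real.sqrt_inv, hn, Real.sqrt_eq_rpow, ← Real.rpow_mul ha0.le]
    congr 1
    ring
  have h1 : a ^ (-(1 / 2) : ℝ) * (n : ℝ)⁻¹ ≤ a ^ p := by
    rw [hn, ← Real.rpow_add ha0]
    refine Real.rpow_le_rpow_of_exponent_ge ha0 ha1 ?_
    nlinarith
  have h2 : (a ^ (-(1 / 2) : ℝ)) ^ α * (a ^ (-β)) ^ ((1 - α) / 2) * (√(n : ℝ))⁻¹ = a ^ p := by
    rw [hsq, ← Real.rpow_mul ha0.le, ← Real.rpow_mul ha0.le, ← Real.rpow_add ha0,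
      ← Real.rpow_add ha0]
    congr 1
    ring
  rw [Real.mul_rpow hκ (by positivity), Real.mul_rpow hC₀ (by positivity), div_eq_mul_inv,
    div_eq_mul_inv]
  calc _ = k * (2 * (2 * C * κ)) * (a ^ (-(1 / 2) : ℝ) * (n : ℝ)⁻¹) +
        k * (2 * (σ * κ ^ α * C₀ ^ ((1 - α) / 2))) *
          ((a ^ (-(1 / 2) : ℝ)) ^ α * (a ^ (-β)) ^ ((1 - α) / 2) * (√(n : ℝ))⁻¹) := by ring_nf
    _ ≤ k * (2 * (2 * C * κ)) * a ^ p +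
        k * (2 * (σ * κ ^ α * C₀ ^ ((1 - α) / 2))) * a ^ p := by
        rw [h2]
        gcongr
    _ = _ := by ring

/-- The deterministic error bound is of order `a ^ p l ^ 3` when the deviations `E₁`, `E₂` and `ε`
of the operator, of the noise and of the weights are of order `a ^ p l`. -/
theorem error_rate_le {b G V D c₁ c₂ κ a p l ε E₁ E₂ : ℝ} (hb : 0 ≤ b) (hG : 0 ≤ G) (hV : 0 ≤ V)
    (hc1 : 0 ≤ c₁) (hκ : 0 ≤ κ) (ha0 : 0 < a) (ha1 : a ≤ 1)
    (hp : 1 / 2 ≤ p) (hl : 1 ≤ l) (hE10 : 0 ≤ E₁) (hε0 : 0 ≤ ε) (hE20 : 0 ≤ E₂) (hc2 : 0 ≤ c₂)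
    (hE1 : E₁ ≤ l * (2 * κ * c₁ * a ^ p)) (hε : ε ≤ l * (c₂ * a ^ p))
    (hE2 : E₂ ≤ l * (D * c₁ * a ^ p)) :
    2 * b * (1 + a ^ (-(1 / 2) : ℝ) * (2 * E₁ + 2 * ε * κ)) ^ 2 * (2 * E₂) +
        4 * (G + 1 + b) * a ^ p * (1 + a ^ (-(1 / 2) : ℝ) * (2 * E₁ + 2 * ε * κ)) ^ 3 * V ≤
      (4 * b * (1 + (4 * κ * c₁ + 2 * κ * c₂)) ^ 2 * (D * c₁) +
        4 * (G + 1 + b) * (1 + (4 * κ * c₁ + 2 * κ * c₂)) ^ 3 * V) * a ^ p * l ^ 3 := by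
  set c := 4 * κ * c₁ + 2 * κ * c₂ with hc
  have hc0 : 0 ≤ c := by positivity
  have hap : a ^ (-(1 / 2) : ℝ) * a ^ p ≤ 1 := by
    rw [← Real.rpow_add ha0]
    exact Real.rpow_le_one ha0.le ha1 (by linarith)
  have hk : 1 + a ^ (-(1 / 2) : ℝ) * (2 * E₁ + 2 * ε * κ) ≤ l * (1 + c) := by
    calc _ ≤ 1 + a ^ (-(1 / 2) : ℝ) *
          (2 * (l * (2 * κ * c₁ * a ^ p)) + 2 * (l * (c₂ * a ^ p)) * κ) := by gcongr
      _ = 1 + l * c * (a ^ (-(1 / 2) : ℝ) * a ^ p) := by rw [hc]; ring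
      _ ≤ l + l * c * 1 := by gcongr
      _ = _ := by ring
  have hk0 : 0 ≤ 1 + a ^ (-(1 / 2) : ℝ) * (2 * E₁ + 2 * ε * κ) := by positivity
  calc _ ≤ 2 * b * (l * (1 + c)) ^ 2 * (2 * (l * (D * c₁ * a ^ p))) +
        4 * (G + 1 + b) * a ^ p * (l * (1 + c)) ^ 3 * V := by gcongr
    _ = _ := by ring

/-- When `n` is small compared with a power of `log (1 / δ)`, the a priori bound `L / a` of the
error is already of the required order. -/
theorem small_sample_rate_le {L a p e c l : ℝ} {n : ℕ} (hL : 0 ≤ L) (ha0 : 0 < a) (ha1 : a ≤ 1)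
    (he1 : 2 * p ≤ e) (he2 : 1 ≤ e) (hn : (n : ℝ)⁻¹ = a ^ e)
    (h : 1 / 2 < l * c / √n) : L / a ≤ 8 * c ^ 3 * L * a ^ p * l ^ 3 := by
  have hsq : (√(n : ℝ))⁻¹ = a ^ (e / 2) := by
    rw [← Real.sqrt_inv, hn, Real.sqrt_eq_rpow, ← Real.rpow_mul ha0.le]
    congr 1
    ring
  rw [div_eq_mul_inv (l * c), hsq] at h
  have h1 : 1 ≤ (2 * (l * c * a ^ (e / 2))) ^ 3 := one_le_pow₀ (by linarith)
  have hlc : 0 < l * c := by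
    by_contra hcon
    have : l * c * a ^ (e / 2) ≤ 0 :=
      mul_nonpos_of_nonpos_of_nonneg (not_lt.1 hcon) (by positivity)
    linarith
  have h2 : a ^ (e / 2 * 3 - 1) ≤ a ^ p :=
    Real.rpow_le_rpow_of_exponent_ge ha0 ha1 (by linarith)
  have h3 : (a ^ (e / 2)) ^ 3 * a⁻¹ = a ^ (e / 2 * 3 - 1) := by
    rw [Real.rpow_sub ha0, Real.rpow_one, Real.rpow_mul ha0.le, Real.rpow_ofNat]
    rfl
  calc L / a = L / a * 1 := (mul_one _).symm
    _ ≤ L / a * (2 * (l * c * a ^ (e / 2))) ^ 3 := by gcongr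
    _ = 8 * (l * c) ^ 3 * L * ((a ^ (e / 2)) ^ 3 * a⁻¹) := by ring
    _ ≤ 8 * (l * c) ^ 3 * L * a ^ p := by
      rw [h3]
      gcongr
    _ = _ := by ring

end Rates

section GoodSet

theorem smul_sum_noise_eq {X : Type*} {H : Type*} [NormedAddCommGroup H] [InnerProductSpace ℝ H]
    [CompleteSpace H] [RKHS ℝ H X ℝ] {n : ℕ} (S : H →L[ℝ] H) (x : Fin n → X) (v y : Fin n → ℝ) :
    (1 / (n : ℝ)) • ∑ i, (v i * y i) • S (kerVec H (x i)) =
      S (samplingOpT H x (diagOp v y)) := by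
  have h : samplingOpT H x (diagOp v y) = (1 / (n : ℝ)) • ∑ i, (v i * y i) • kerVec H (x i) := by
    refine ext_inner_left ℝ fun f => ?_
    rw [inner_samplingOpT_diagOp, inner_smul_right, inner_sum]
    simp_rw [inner_smul_right, inner_kerVec_right]
  rw [h]
  simp only [map_smul, map_sum]

theorem exists_measurableSet_of_measure_le {Ω : Type*} [MeasurableSpace Ω] {P : Measure Ω}
    [IsProbabilityMeasure P] {s t u : Set Ω} {A : Ω → Prop} {δ : ℝ} (hδ : 0 ≤ δ)
    (hs : P s ≤ ENNReal.ofReal (δ / 3)) (ht : P t ≤ ENNReal.ofReal (δ / 3))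
    (hu : P u ≤ ENNReal.ofReal (δ / 3)) (hA : ∀ᵐ ω ∂P, A ω) :
    ∃ G : Set Ω, MeasurableSet G ∧ ENNReal.ofReal (1 - δ) ≤ P G ∧
      ∀ ω ∈ G, ω ∉ s ∧ ω ∉ t ∧ ω ∉ u ∧ A ω := by
  set Z := s ∪ t ∪ u ∪ {ω | ¬ A ω} with hZ
  have h : P Z ≤ ENNReal.ofReal δ := by
    have hA0 : P {ω | ¬ A ω} = 0 := hA
    calc P Z ≤ P s + P t + P u + 0 := by
          refine (measure_union_le _ _).trans (add_le_add ?_ hA0.le)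
          exact (measure_union_le _ _).trans (add_le_add (measure_union_le _ _) le_rfl)
      _ ≤ ENNReal.ofReal (δ / 3) + ENNReal.ofReal (δ / 3) + ENNReal.ofReal (δ / 3) + 0 := by gcongr
      _ = ENNReal.ofReal δ := by
          rw [add_zero, ← ENNReal.ofReal_add (by positivity) (by positivity),
            ← ENNReal.ofReal_add (by positivity) (by positivity)]
          congr 1
          ring
  refine ⟨(toMeasurable P Z)ᶜ, (measurableSet_toMeasurable _ _).compl, ?_, fun ω hω => ?_⟩
  · rw [prob_compl_eq_one_sub (measurableSet_toMeasurable _ _), measure_toMeasurable,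
      ENNReal.ofReal_sub _ hδ, ENNReal.ofReal_one]
    exact tsub_le_tsub_left h 1
  · have hω' : ω ∉ Z := fun hcon => hω (subset_toMeasurable P Z hcon)
    simp only [hZ, Set.mem_union, Set.mem_ofPred_eq, not_or, not_not] at hω'
    exact ⟨hω'.1.1.1, hω'.1.1.2, hω'.1.2, hω'.2⟩

end GoodSet

section GoodSample

variable {X : Type*} [MetricSpace X] [CompactSpace X] [MeasurableSpace X] [BorelSpace X]
  {K : MercerKernel X} {H : Type u} [NormedAddCommGroup H] [InnerProductSpace ℝ H]
  [CompleteSpace H] [RKHS ℝ H X ℝ]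
  {μte μtr : Measure X} [IsProbabilityMeasure μtr] [IsProbabilityMeasure μte]
  {ρ : Kernel X ℝ} [IsMarkovKernel ρ] {α C σ : ℝ} {n : ℕ}

/-- A deviation bound for averages of rank one operators, seen as tensors, bounds the deviation of
the operators. -/
theorem norm_covOp_sub_empOp_le (hK : K.IsKernelOf H) (hn : 1 ≤ n) (S : H →L[ℝ] H)
    (hS : ∀ v w, inner ℝ (S v) w = inner ℝ v (S w)) {w : X → ℝ} {x : Fin n → X}
    {c : UniformSpace.Completion (TensorProduct ℝ H H)}
    (hc : ∀ v v', inner ℝ (completedTmul v v') c =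
      ∫ x, inner ℝ v (kerVec H x) * inner ℝ v' (S (kerVec H x)) ∂μte) {E : ℝ}
    (hE : ‖(1 / (n : ℝ)) • ∑ i, (w (x i) • completedTmul (kerVec H (x i)) (S (kerVec H (x i))) - c)‖
      ≤ E) (f : H) :
    ‖S (hK.covOp μte f - empOp H x (fun i => w (x i)) f)‖ ≤ E * ‖f‖ := by
  set g := S (hK.covOp μte f - empOp H x (fun i => w (x i)) f) with hg
  set t := (1 / (n : ℝ)) •
    ∑ i, (w (x i) • completedTmul (kerVec H (x i)) (S (kerVec H (x i))) - c) with ht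
  have hn0 : (n : ℝ) ≠ 0 := by positivity
  have hE0 : 0 ≤ E := (norm_nonneg _).trans hE
  have hSk : ∀ z : X, inner ℝ g (S (kerVec H z)) = S g z := fun z => by
    rw [← hS, inner_kerVec_right]
  have h1 : inner ℝ (completedTmul f g) t =
      1 / (n : ℝ) * ∑ i, w (x i) * f (x i) * S g (x i) - ∫ z, S g z * f z ∂μte := by
    rw [ht, inner_smul_right, inner_sum]
    simp_rw [inner_sub_right, inner_smul_right, inner_completedTmul, hc, hSk, inner_kerVec_right]
    rw [Finset.sum_sub_distrib, Finset.sum_const, Finset.card_univ, Fintype.card_fin, mul_sub,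
      nsmul_eq_mul, ← mul_assoc (1 / (n : ℝ)) (n : ℝ), one_div_mul_cancel hn0, one_mul]
    simp_rw [mul_assoc, mul_comm (S g _)]
  have h2 : ‖g‖ ^ 2 = -inner ℝ (completedTmul f g) t := by
    rw [h1, ← real_inner_self_eq_norm_sq]
    conv_lhs => rw [hg, ← hg, ← hS, inner_sub_right, hK.inner_covOp, inner_empOp]
    ring
  refine le_of_sq_le_mul_self (norm_nonneg _) (by positivity) ?_
  rw [h2]
  calc _ ≤ |inner ℝ (completedTmul f g) t| := neg_le_abs _
    _ ≤ ‖completedTmul f g‖ * ‖t‖ := abs_real_inner_le_norm _ _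
    _ ≤ ‖f‖ * ‖g‖ * E := by
      rw [norm_completedTmul]
      gcongr
    _ = _ := by ring

/-- With probability at least `1 - δ` the outputs are bounded and the empirical operator, the
empirical noise and the mean of the weights satisfy their Bernstein bounds. -/
theorem exists_good_sample (hK : K.IsKernelOf H)
    (hα0 : 0 < α) (hα1 : α ≤ 1) (hC : 0 < C) (hσ : 0 < σ) (habs : μte ≪ μtr)
    (hw : WeightMomentCondition μte μtr α C σ) (S : H →L[ℝ] H)
    (hS : ∀ v w, inner ℝ (S v) w = inner ℝ v (S w)) {m N : ℝ} (hm0 : 0 < m)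
    (hmle : ∀ x, ‖S (kerVec H x)‖ ≤ m) (hN0 : 0 < N)
    (hN : ∫⁻ x, ENNReal.ofReal (‖S (kerVec H x)‖ ^ 2) ∂μte ≤ ENNReal.ofReal N)
    {κ : ℝ} (hκ0 : 0 < κ) (hκ : ∀ x, ‖kerVec H x‖ ≤ κ)
    {M : ℝ} (hM : ∀ᵐ z ∂(μtr ⊗ₘ ρ), |z.2| ≤ M) {f : H} (hf : regressionFun ρ =ᵐ[μte] f)
    {D : ℝ} (hD : 0 < D) (hfD : ∀ x, M + |f x| ≤ D) (hn : 1 ≤ n) {δ : ℝ} (hδ0 : 0 < δ)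
    (hδ1 : δ < 1) :
    ∃ G : Set (Fin n → X × ℝ), MeasurableSet G ∧
      ENNReal.ofReal (1 - δ) ≤ Measure.pi (fun _ : Fin n => μtr ⊗ₘ ρ) G ∧
      ∀ z ∈ G, (∀ i, |(z i).2| ≤ M) ∧
        (∀ h, ‖S (hK.covOp μte h -
            empOp H (fun i => (z i).1) (fun i => densityRatio μte μtr (z i).1) h)‖ ≤
          2 * Real.log (12 / δ) * (2 * (2 * κ * (C * m)) / n +
            2 * κ * (σ * m ^ α * N ^ ((1 - α) / 2)) / √n) * ‖h‖) ∧
        ‖S (samplingOpT H (fun i => (z i).1) (diagOp (fun i => densityRatio μte μtr (z i).1)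
            fun i => (z i).2 - f (z i).1))‖ ≤
          2 * Real.log (12 / δ) * (2 * (D * (C * m)) / n +
            D * (σ * m ^ α * N ^ ((1 - α) / 2)) / √n) ∧
        |1 / (n : ℝ) * ∑ i, densityRatio μte μtr (z i).1 - 1| ≤
          2 * Real.log (12 / δ) * (2 * (2 * C) / n + 2 * σ / √n) := by
  set P := Measure.pi (fun _ : Fin n => μtr ⊗ₘ ρ) with hP
  obtain ⟨c, hc, hB1⟩ := isBernstein_rankOne (ρ := ρ) (τ := completedTmul (H := H))
    inner_completedTmul norm_completedTmul continuous_completedTmul hK hα0 hα1 hC.le habs hw S hm0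
    hmle hN0.le hN hκ0.le hκ
  have hB2 := isBernstein_noise hK hα0 hα1 hC.le habs hw S hm0 hmle hN0.le hN hM hf hD.le hfD
  have hB3 := isBernstein_weight (ρ := ρ) hα0 hα1 hC.le habs hw
  have hP1 := hB1.measure_le (by positivity) (by positivity) hn hδ0 hδ1
  have hP2 := hB2.measure_le (by positivity) (by positivity) hn hδ0 hδ1
  have hP3 := hB3.measure_le (by positivity) (by positivity) hn hδ0 hδ1
  have hae : ∀ᵐ z ∂P, ∀ i, |(z i).2| ≤ M := ae_all_iff.2 fun i =>
    (Measure.tendsto_eval_ae_ae (μ := fun _ : Fin n => μtr ⊗ₘ ρ) (i := i)).eventually hM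
  obtain ⟨G, hGm, hG, hGz⟩ := exists_measurableSet_of_measure_le hδ0.le hP1 hP2 hP3 hae
  refine ⟨G, hGm, hG, fun z hz => ?_⟩
  obtain ⟨h1, h2, h3, h4⟩ := hGz z hz
  simp only [Set.mem_ofPred_eq, not_not] at h1 h2 h3
  refine ⟨h4, fun h => ?_, ?_, ?_⟩
  · refine norm_covOp_sub_empOp_le hK hn S hS hc (h1.trans (le_of_eq ?_)) h
    ring
  · rwa [← smul_sum_noise_eq]
  · have hn0 : (n : ℝ) ≠ 0 := by positivity
    rwa [Finset.sum_sub_distrib, Finset.sum_const, Finset.card_univ, Fintype.card_fin,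
      nsmul_eq_mul, mul_one, smul_eq_mul, mul_sub, one_div_mul_cancel hn0, Real.norm_eq_abs] at h3

end GoodSample

/-! ### The learning rate -/

section ErrorBound

variable {X : Type*} [MetricSpace X] [CompactSpace X] [MeasurableSpace X] [BorelSpace X]
  {K : MercerKernel X} {H : Type u} [NormedAddCommGroup H] [InnerProductSpace ℝ H]
  [CompleteSpace H] [RKHS ℝ H X ℝ]

theorem MercerKernel.IsKernelOf.eLpNorm_sub_eq (hK : K.IsKernelOf H) (μ : Measure X)
    [IsProbabilityMeasure μ] {φ : X → ℝ} {fH : H} (hφ : φ =ᵐ[μ] hK.inclusion μ fH) (f : H) :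
    eLpNorm (fun x => f x - φ x) 2 μ = ENNReal.ofReal ‖hK.inclusion μ (f - fH)‖ := by
  rw [Lp.norm_def, ENNReal.ofReal_toReal (Lp.eLpNorm_ne_top _)]
  refine eLpNorm_congr_ae ?_
  filter_upwards [hφ, hK.coeFn_inclusion μ (f - fH), hK.coeFn_inclusion μ fH] with x h1 h2 h3
  rw [h1, h2, h3, RKHS.coe_sub, Pi.sub_apply]

/-- A priori bound of the error, valid for every sample. -/
theorem norm_inclusion_estimator_sub_le (hK : K.IsKernelOf H) (μ : Measure X)
    [IsProbabilityMeasure μ] {κ : ℝ} (hκ0 : 0 ≤ κ) (hκ : ∀ x, K.toFun x x ≤ κ ^ 2) {n : ℕ}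
    {w : X → ℝ} (hw : ∀ x, 0 ≤ w x) {x : Fin n → X} {y : Fin n → ℝ} {a b M F : ℝ} (ha0 : 0 < a)
    (ha1 : a ≤ 1) (hb : 0 ≤ b) (hM : 0 ≤ M) (hy : ∀ i, |y i| ≤ M) {φ : ℝ → ℝ}
    (hφ1 : ∀ t, 0 < t → t ≤ κ ^ 2 → |φ t| ≤ b / a) {fH : H} (hF : ‖fH‖ ≤ F) :
    ‖hK.inclusion μ (spectralFun (empOp H x (normalizedWeight w x)) φ
        (samplingOpT H x (diagOp (normalizedWeight w x) y)) - fH)‖ ≤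
      κ * (b * (M * κ) + F) / a := by
  have hv := normalizedWeight_nonneg hw x
  have hv1 := mean_normalizedWeight_le w x
  have hκ' := hK.norm_kerVec_le hκ0 hκ
  have hF0 : 0 ≤ F := (norm_nonneg _).trans hF
  have h1 := norm_spectralFun_empOp_le hv (norm_empOp_le x hv hv1 hκ0 hκ')
    (by positivity : 0 ≤ b / a) hφ1 y
  have h2 := norm_samplingOpT_diagOp_le x hv hv1 hκ0 hκ' hM hy
  calc _ ≤ κ * ‖_‖ := hK.norm_inclusion_le μ hκ0 hκ _
    _ ≤ κ * (b / a * (M * κ) + F / a) := by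
      gcongr
      refine (norm_sub_le _ _).trans (add_le_add (h1.trans (by gcongr)) (hF.trans ?_))
      rw [le_div_iff₀ ha0]
      exact mul_le_of_le_one_right hF0 ha1
    _ = _ := by ring

end ErrorBound

theorem one_le_log_div {δ : ℝ} (hδ0 : 0 < δ) (hδ1 : δ < 1) : 1 ≤ Real.log (12 / δ) := by
  rw [Real.le_log_iff_exp_le (by positivity), le_div_iff₀ hδ0]
  nlinarith [Real.exp_one_lt_d9, Real.exp_pos 1]

set_option maxHeartbeats 1000000 in
theorem theorem1 (α β r ν b C σ C₀ M κ R : ℝ) (γ : ℝ → ℝ)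
    (hα0 : 0 < α) (hα1 : α ≤ 1) (hβ0 : 0 < β) (hβ1 : β ≤ 1)
    (hαβ : 1 ≤ β + α * (1 - β)) (hr : 1 / 2 ≤ r) (hrν : r ≤ ν)
    (hC : 0 < C) (hσ : 0 < σ) (hC₀ : 0 < C₀) (hκ : 1 ≤ κ) :
    ∃ C' : ℝ, 0 < C' ∧
      ∀ (X : Type*) [MetricSpace X] [CompactSpace X] [MeasurableSpace X] [BorelSpace X]
        (K : MercerKernel X)
        (H : Type*) [NormedAddCommGroup H] [InnerProductSpace ℝ H] [CompleteSpace H]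
        [RKHS ℝ H X ℝ]
        (μtr μte : Measure X) [IsProbabilityMeasure μtr] [IsProbabilityMeasure μte]
        (ρ : Kernel X ℝ) [IsMarkovKernel ρ]
        (g : ℝ → ℝ → ℝ) (U : ℝ) (u : Lp ℝ 2 μte),
        K.IsKernelOf H →
        (∀ x, K.toFun x x ≤ κ ^ 2) →
        (∀ᵐ z ∂(μtr ⊗ₘ ρ), |z.2| ≤ M) →
        μte ≪ μtr →
        WeightMomentCondition μte μtr α C σ →
        regressionFun ρ =ᵐ[μte] (spectralFun (K.integralOp μte) (fun s => s ^ r) u : Lp ℝ 2 μte) →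
        ‖u‖ ≤ R →
        (∀ t : ℝ, 0 < t → effectiveDimension K μte t ≤ ENNReal.ofReal (C₀ * t ^ (-β))) →
        IsFilterFunction g U ν b γ →
        κ ^ 2 ≤ U →
        ∀ (n : ℕ), 1 ≤ n → ∀ (δ : ℝ), 0 < δ → δ < 1 →
          ∃ G : Set (Fin n → X × ℝ), MeasurableSet G ∧
            ENNReal.ofReal (1 - δ) ≤ Measure.pi (fun _ : Fin n => μtr ⊗ₘ ρ) G ∧
            ∀ z ∈ G,
              eLpNorm (fun x => normalizedSpectralEstimator H (densityRatio μte μtr)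
                  (g ((n : ℝ) ^ (-(1 / (min (2 * r) 3 + β + α * (1 - β)))))) z x
                  - regressionFun ρ x) 2 μte
                ≤ ENNReal.ofReal (C'
                    * (n : ℝ) ^ (-(min r (3 / 2) / (min (2 * r) 3 + β + α * (1 - β))))
                    * Real.log (12 / δ) ^ 3) := by
  -- Smoothness beyond `3 / 2` is not exploited: `p` is the smoothness that is used.
  set p := min r (3 / 2) with hpdef
  have hp1 : 1 / 2 ≤ p := le_min hr (by norm_num)
  have hpr : p ≤ r := min_le_left _ _
  have hp2 : p ≤ 3 / 2 := min_le_right _ _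
  have hmin : min (2 * r) 3 = 2 * p := by
    rw [hpdef, mul_min_of_nonneg _ _ zero_le_two]
    norm_num
  rw [hmin]
  set e := 2 * p + β + α * (1 - β) with hedef
  have he1 : 2 * p ≤ e := by linarith
  have he2 : 1 ≤ e := by linarith
  have hκ0 : 0 < κ := by linarith
  have hpow0 : ∀ s : ℝ, 0 ≤ (κ ^ 2) ^ s := fun s => by positivity
  set V := (κ ^ 2) ^ (r - p) * |R| with hV
  set F := (κ ^ 2) ^ (p - 1 / 2) * V with hF
  set D := |M| + κ * F + 1 with hD
  set c₁ := 2 * (2 * C * κ + σ * κ ^ α * C₀ ^ ((1 - α) / 2)) with hc₁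
  set c₂ := 8 * C + 4 * σ with hc₂
  have hV0 : 0 ≤ V := by positivity
  have hF0 : 0 ≤ F := by positivity
  have hD0 : 0 < D := by positivity
  have hc₁0 : 0 ≤ c₁ := by positivity
  have hc₂0 : 0 ≤ c₂ := by positivity
  set Q₁ := 4 * |b| * (1 + (4 * κ * c₁ + 2 * κ * c₂)) ^ 2 * (D * c₁) +
    4 * (|γ p| + 1 + |b|) * (1 + (4 * κ * c₁ + 2 * κ * c₂)) ^ 3 * V with hQ₁
  set Q₂ := 8 * c₂ ^ 3 * (κ * (|b| * (|M| * κ) + F)) with hQ₂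
  have hQ₁0 : 0 ≤ Q₁ := by positivity
  have hQ₂0 : 0 ≤ Q₂ := by positivity
  refine ⟨Q₁ + Q₂ + 1, by positivity, ?_⟩
  intro X _ _ _ _ K H _ _ _ _ μtr μte _ _ ρ _ g U u hK hKκ hM habs hw hreg hu hN
    hg hU n hn δ hδ0 hδ1
  have hb : |b| = b := abs_of_pos hg.b_pos
  have hγ : |γ p| = γ p := abs_of_pos (hg.γ_pos p (by linarith) (hpr.trans hrν))
  rw [hb, hγ] at hQ₁
  rw [hb] at hQ₂
  have hγ0 := (hg.γ_pos p (by linarith) (hpr.trans hrν)).le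
  have hn0 : (0 : ℝ) < n := by exact_mod_cast hn
  have hn1 : (1 : ℝ) ≤ n := by exact_mod_cast hn
  set a := (n : ℝ) ^ (-(1 / e)) with ha
  have ha0 : 0 < a := by positivity
  have ha1 : a ≤ 1 := Real.rpow_le_one_of_one_le_of_nonpos hn1 (by
    rw [neg_nonpos]; positivity)
  have hae : (n : ℝ)⁻¹ = a ^ e := by
    rw [ha, ← Real.rpow_mul hn0.le, neg_mul, one_div_mul_cancel (by linarith), Real.rpow_neg_one]
  have hrate : (n : ℝ) ^ (-(p / e)) = a ^ p := by
    rw [ha, ← Real.rpow_mul hn0.le]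
    congr 1
    ring
  rw [hrate]
  have haU : a ≤ U := ha1.trans ((one_le_pow₀ hκ).trans hU)
  have hφ1 : ∀ t, 0 < t → t ≤ κ ^ 2 → |g a t| ≤ b / a := fun t h0 h1 =>
    hg.abs_le a t ha0 haU h0 (h1.trans hU)
  have hφ2 : ∀ t, 0 < t → t ≤ κ ^ 2 → |g a t * t| ≤ b := fun t h0 h1 =>
    hg.abs_mul_le a t ha0 haU h0 (h1.trans hU)
  have hφ3 : ∀ t, 0 < t → t ≤ κ ^ 2 →
      |1 - g a t * t| * t ^ (p - 1 / 2 + 1 / 2) ≤ γ p * a ^ (p - 1 / 2 + 1 / 2) := fun t h0 h1 => by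
    rw [sub_add_cancel]
    exact hg.residual_le p (by linarith) (hpr.trans hrν) a t ha0 haU h0 (h1.trans hU)
  set l := Real.log (12 / δ) with hl
  have hl1 : 1 ≤ l := one_le_log_div hδ0 hδ1
  have hkκ := hK.norm_kerVec_le hκ0.le hKκ
  have := hK.separableSpace
  obtain ⟨ι, ⟨A⟩⟩ := exists_eigenSystem (hK.isCompactOperator_covOp μte) (hK.isPositive_covOp μte)
    (hK.norm_covOp_le μte hκ0.le hKκ)
  have : Countable ι := A.basis.countable
  obtain ⟨v, hv, hsrc⟩ := hK.exists_source hκ0.le hKκ A hp1 hpr u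
  have hvV : ‖v‖ ≤ V := hv.trans
    (mul_le_mul_of_nonneg_left (hu.trans (le_abs_self R)) (hpow0 _))
  set fH := A.fn (fun s => s ^ (p - 1 / 2)) v with hfH
  have hfHF : ‖fH‖ ≤ F := by
    refine (A.norm_fn_le' (hpow0 (p - 1 / 2)) (fun t h0 h1 => ?_) v).trans
      (mul_le_mul_of_nonneg_left hvV (hpow0 _))
    rw [abs_of_nonneg (by positivity)]
    exact Real.rpow_le_rpow h0 h1 (by linarith)
  rw [hsrc] at hreg
  have hregf : regressionFun ρ =ᵐ[μte] fH := hreg.trans (hK.coeFn_inclusion μte fH)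
  have hfD : ∀ x, M + |fH x| ≤ D := fun x => by
    have h1 : |fH x| ≤ κ * F := by
      rw [← inner_kerVec_left]
      exact (abs_real_inner_le_norm _ _).trans (mul_le_mul (hkκ x) hfHF (norm_nonneg _) hκ0.le)
    linarith [le_abs_self M]
  have hSm : ∀ x, ‖A.regPow a (-(1 / 2)) (kerVec H x)‖ ≤ κ * a ^ (-(1 / 2) : ℝ) := fun x => by
    have h1 := A.norm_regPow_le ha0 (by norm_num : (-(1 / 2) : ℝ) ≤ 0) (kerVec H x)
    rw [A.regPow_zero ha0, sub_zero] at h1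
    rw [mul_comm]
    exact h1.trans (by gcongr; exact hkκ x)
  have hm0 : 0 < κ * a ^ (-(1 / 2) : ℝ) := by positivity
  have hN0 : 0 < C₀ * a ^ (-β) := by positivity
  have hNa := hN a ha0
  rw [hK.effectiveDimension_eq A ha0] at hNa
  obtain ⟨G, hGm, hGδ, hG⟩ := exists_good_sample (m := κ * a ^ (-(1 / 2) : ℝ))
    (N := C₀ * a ^ (-β)) (κ := κ) (M := M) (f := fH) (D := D) (n := n) (δ := δ) hK hα0 hα1 hC hσ
    habs hw (A.regPow a (-(1 / 2))) (A.inner_regPow_left ha0 _) hm0 hSm hN0 hNa hκ0 hkκ hM hregf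
    hD0 hfD hn hδ0 hδ1
  refine ⟨G, hGm, hGδ, fun z hz => ?_⟩
  obtain ⟨hy, hE1, hE2, hE3⟩ := hG z hz
  rw [hK.eLpNorm_sub_eq μte hreg]
  refine ENNReal.ofReal_le_ofReal ?_
  change ‖hK.inclusion μte (spectralFun (empOp H (fun i => (z i).1)
    (normalizedWeight (densityRatio μte μtr) fun i => (z i).1)) (g a)
    (samplingOpT H (fun i => (z i).1) (diagOp (normalizedWeight (densityRatio μte μtr)
      fun i => (z i).1) fun i => (z i).2)) - fH)‖ ≤ _
  set ε := 2 * l * (2 * (2 * C) / n + 2 * σ / √n) with hε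
  set E₁ := 2 * l * (2 * (2 * κ * (C * (κ * a ^ (-(1 / 2) : ℝ)))) / n +
    2 * κ * (σ * (κ * a ^ (-(1 / 2) : ℝ)) ^ α * (C₀ * a ^ (-β)) ^ ((1 - α) / 2)) / √n) with hE₁
  set E₂ := 2 * l * (2 * (D * (C * (κ * a ^ (-(1 / 2) : ℝ)))) / n +
    D * (σ * (κ * a ^ (-(1 / 2) : ℝ)) ^ α * (C₀ * a ^ (-β)) ^ ((1 - α) / 2)) / √n) with hE₂
  have hl0 : 0 ≤ l := by linarith
  have hsn : √(n : ℝ) ≤ n := Real.sqrt_le_iff.2 ⟨hn0.le, le_self_pow₀ hn1 two_ne_zero⟩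
  have hsn0 : 0 < √(n : ℝ) := Real.sqrt_pos.2 hn0
  have hεle : ε ≤ l * c₂ / √n := by
    rw [hε]
    calc _ ≤ 2 * l * (2 * (2 * C) / √n + 2 * σ / √n) := by gcongr
      _ = _ := by rw [hc₂]; ring
  have hε0 : 0 ≤ ε := by positivity
  have hE10 : 0 ≤ E₁ := by positivity
  have hE20 : 0 ≤ E₂ := by positivity
  have hal : 0 ≤ a ^ p * l ^ 3 := by positivity
  -- Either the mean of the weights is at least `1 / 2`, or `n` is small.
  rcases le_or_gt (l * c₂ / √n) (1 / 2) with hsmall | hlarge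
  · have hmean : 1 / 2 ≤ 1 / (n : ℝ) * ∑ i, densityRatio μte μtr (z i).1 := by
      have := (abs_le.1 hE3).1
      linarith
    have hmain := norm_regPow_half_estimator_sub_le hκ0.le A hkκ
      (w := densityRatio μte μtr) densityRatio_nonneg (y := fun i => (z i).2) ha0 hg.b_pos.le hγ0
      (by linarith) (by linarith) hφ1 hφ2 hφ3 hfH hmean hE3 hE10 hE1 hE2
    rw [sub_add_cancel] at hmain
    have hsqp : (√(n : ℝ))⁻¹ ≤ a ^ p := by
      rw [← Real.sqrt_inv, hae, Real.sqrt_eq_rpow, ← Real.rpow_mul ha0.le]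
      exact Real.rpow_le_rpow_of_exponent_ge ha0 ha1 (by linarith)
    have hr1 := bernstein_rate_le (σ := σ) hκ0.le hC.le hC₀.le hα0 hα1 hβ0.le hp1
      (by positivity : 0 ≤ 2 * κ) ha0 ha1 hae
    have hr2 := bernstein_rate_le (σ := σ) hκ0.le hC.le hC₀.le hα0 hα1 hβ0.le hp1 hD0.le ha0 ha1 hae
    have hrateE := error_rate_le (G := γ p) (V := V) (D := D) (c₁ := c₁) (c₂ := c₂) (κ := κ)
      (a := a) (p := p) (l := l) (ε := ε) (E₁ := E₁) (E₂ := E₂) hg.b_pos.le hγ0 hV0 hc₁0 hκ0.le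
      ha0 ha1 hp1 hl1 hE10 hε0 hE20 hc₂0
      (by rw [hE₁, mul_comm 2 l, mul_assoc]; exact mul_le_mul_of_nonneg_left hr1 hl0)
      (hεle.trans (by rw [div_eq_mul_inv, mul_assoc]; gcongr))
      (by rw [hE₂, mul_comm 2 l, mul_assoc]; exact mul_le_mul_of_nonneg_left hr2 hl0)
    calc _ ≤ _ := hK.norm_inclusion_le_norm_regPow A ha0 _
      _ ≤ _ := hmain
      _ ≤ _ := add_le_add le_rfl (mul_le_mul_of_nonneg_left hvV (by
        have := hg.b_pos
        positivity))
      _ ≤ _ := hrateE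
      _ = Q₁ * (a ^ p * l ^ 3) := by rw [hQ₁]; ring
      _ ≤ (Q₁ + Q₂ + 1) * (a ^ p * l ^ 3) := by
        gcongr
        linarith
      _ = _ := by ring
  · have htriv := norm_inclusion_estimator_sub_le hK μte hκ0.le hKκ (w := densityRatio μte μtr)
      densityRatio_nonneg (x := fun i => (z i).1) (y := fun i => (z i).2) ha0 ha1 hg.b_pos.le
      (abs_nonneg M) (fun i => (hy i).trans (le_abs_self M)) hφ1 hfHF
    have hb0 := hg.b_pos.le
    calc _ ≤ _ := htriv
      _ ≤ _ := small_sample_rate_le (by positivity) ha0 ha1 he1 he2 hae hlarge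
      _ = Q₂ * (a ^ p * l ^ 3) := by rw [hQ₂]; ring
      _ ≤ (Q₁ + Q₂ + 1) * (a ^ p * l ^ 3) := by
        gcongr
        linarith
      _ = _ := by ring

end
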